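/- **Conventions.** Functions on $\mathbb{R}^n$ ($n\ge 1$) are complex valued, and cubes $Q$ have sides parallel to the axes. A Young function is a strictly increasing convex $\varphi:[0,\infty)\to[0,\infty]$ with $\varphi(0)=0$ and $\varphi(t)\to\infty$ as $t\to\infty$. Put $\bar\varphi(t)=\sup_{s\ge 0}(ts-\varphi(s))$, $\varphi^{-1}(t)=\inf\{s\ge 0:\varphi(s)\ge t\}$, and for a set $A$ of finite positive measure $$\|f\|_{\varphi,A}=\inf\Big\{\lambda>0:\frac1{|A|}\int_A\varphi\big(|f|/\lambda\big)\le 1\Big\}.$$ For $r\ge 1$ let $\|\cdot\|_{\exp L^r,Q}=\|\cdot\|_{\bar\Phi,Q}$, where $\Phi(t)=t(1+\log^+t)^{1/r}$. A locally integrable $b$ belongs to $\mathrm{Osc}_{\exp L^r}$ if $\|b\|_{\mathrm{Osc}_{\exp L^r}}=\sup_Q\|b-b_Q\|_{\exp L^r,Q}<\infty$, where $b_Q=|Q|^{-1}\int_Q b$. $T$ is a linear operator bounded on $L^2(\mathbb{R}^n)$, with a measurable kernel $K$ such that for every $f\in L^2$ with compact support $Tf(x)=\int K(x-y)f(y)\,dy$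 (absolutely convergent) for a.e. $x\notin\operatorname{supp}f$. We write $K\in H_{\varphi,m}$ if there are $c\ge 1$ and $A<\infty$ such that, for all $y\in\mathbb{R}^n$ and $R>c|y|$, $$\sum_{k=1}^\infty(2^kR)^n k^m\big\|(K(\cdot-y)-K(\cdot))\mathcal{X}_{\{2^kR<|x|\le 2^{k+1}R\}}\big\|_{\varphi,B(0,2^{k+1}R)}\le A.$$ For $\mathbf b=(b_1,\dots,b_m)$ the commutator is defined recursively by $T_{\mathbf b}f=b_1T_{(b_2,\dots,b_m)}f-T_{(b_2,\dots,b_m)}(b_1f)$, with $T_{\mathbf b}=T$ for the empty symbol. For $\sigma\in S_m=\{0,1\}^m$ let $|\sigma|=\sum_i\sigma_i$, $\bar\sigma_i=1-\sigma_i$, let $\mathbf b_\sigma$ be the symbol formed by the $b_i$ with $\sigma_i=1$ in increasing order of $i$, and let $\|\mathbf b_\sigma\|=\prod_{i:\sigma_i=1}\|b_i\|_{\mathrm{Osc}_{\exp L^{r_i}}}$, $\|\mathbf b\|=\prod_{i=1}^m\|b_i\|_{\mathrm{Osc}_{\exp L^{r_i}}}$. Finally let $M_\varphi f(x)=\sup_{Q\ni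 x}\|f\|_{\varphi,Q}$, $M_\varepsilon f(x)=\big(\sup_{Q\ni x}\frac1{|Q|}\int_Q|f|^\varepsilon\big)^{1/\varepsilon}$ and $M^\#_\delta f(x)=\big(M^\#(|f|^\delta)(x)\big)^{1/\delta}$ with $M^\#h(x)=\sup_{Q\ni x}\frac1{|Q|}\int_Q|h-h_Q|$. **Proposition.** Let $m\ge 1$ be an integer, $r_i\ge 1$ for $1\le i\le m$ and $1/r=\sum_{i=1}^m1/r_i$. Let $\eta,\phi$ be Young functions for which there is a constant $A$ with $$\bar\eta^{-1}(t)\,\phi^{-1}(t)\,(\log t)^{1/r}\le A\,t\qquad\text{for all }t\ge e.$$ Let $T$ be an operator as above with kernel $K\in H_{\phi,m}$, and let $0<\delta<\varepsilon<1$. Then there is a constant $C$ such that for every $\mathbf b=(b_1,\dots,b_m)$ with $b_i\in\mathrm{Osc}_{\exp L^{r_i}}$, for every $f$ such that $\big(\prod_{i\in I}b_i\big)f\in L^2(\mathbb{R}^n)$ for all $I\subseteq\{1,\dots,m\}$ (so that $T_{\mathbf b}f$ is defined; in particular for every bounded $f$ with compact support), and for every $x\in\mathbb{R}^n$, $$M^\#_\delta(T_{\mathbf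 b}f)(x)\le C\|\mathbf b\|\,M_{\bar\eta}f(x)+C\sum_{\sigma\in S_m,\ |\sigma|<m}\|\mathbf b_{\bar\sigma}\|\,M_\varepsilon(T_{\mathbf b_\sigma}f)(x).$$ Here both sides take values in $[0,\infty]$, with $0\cdot\infty=0$. -/

import Mathlib

open MeasureTheory Filter Topology
open scoped ENNReal NNReal

noncomputable section

namespace HormanderCommutator

/-- Euclidean space `ℝⁿ`. -/
abbrev Rn (n : ℕ) : Type := EuclideanSpace ℝ (Fin n)

/-- The closed cube with sides parallel to the coordinate axes, centre `c` and side length `2 * l`. -/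
def cube {n : ℕ} (c : Rn n) (l : ℝ) : Set (Rn n) := {x | ∀ i, |x i - c i| ≤ l}

/-- The family of all nondegenerate cubes with sides parallel to the coordinate axes. -/
def cubes (n : ℕ) : Set (Set (Rn n)) := {Q | ∃ (c : Rn n) (l : ℝ), 0 < l ∧ Q = cube c l}

/-- Young functions `φ : [0,∞) → [0,∞]`. -/
structure IsYoung (φ : ℝ≥0 → ℝ≥0∞) : Prop where
  strictMono : StrictMono φ
  convex : ConvexOn ℝ≥0 Set.univ φ
  map_zero : φ 0 = 0
  tendsto_top : Tendsto φ atTop (𝓝 ∞)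

/-- The complementary function `sup {t s - φ(s) : s ≥ 0}`. The subtraction is truncated at `0`,
which does not change the supremum when `φ 0 = 0`, as `s = 0` contributes `0`. -/
def complementary (φ : ℝ≥0 → ℝ≥0∞) (t : ℝ≥0) : ℝ≥0∞ :=
  ⨆ s : ℝ≥0, ((t * s : ℝ≥0) : ℝ≥0∞) - φ s

/-- The generalized inverse `inf {s ≥ 0 : φ(s) ≥ t}`, with `inf ∅ = ∞`. -/
def genInv (φ : ℝ≥0 → ℝ≥0∞) (t : ℝ≥0∞) : ℝ≥0∞ :=
  ⨅ (s : ℝ≥0) (_ : t ≤ φ s), (s : ℝ≥0∞)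

/-- The Luxemburg average `inf {lam > 0 : |A|⁻¹ ∫_A φ(|f| / lam) ≤ 1}` of `f` over `A`. -/
def luxemburg {n : ℕ} (φ : ℝ≥0 → ℝ≥0∞) (A : Set (Rn n)) (f : Rn n → ℂ) : ℝ≥0∞ :=
  ⨅ (lam : ℝ≥0) (_ : 0 < lam ∧ ((volume A)⁻¹ * ∫⁻ x in A, φ (‖f x‖₊ / lam)) ≤ 1), (lam : ℝ≥0∞)

/-- `t (1 + log⁺ t)^{1/r}`. -/
def LlogL (r : ℝ) (t : ℝ≥0) : ℝ≥0∞ :=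
  ENNReal.ofReal ((t : ℝ) * (1 + Real.posLog (t : ℝ)) ^ (1 / r))

/-- The Young function defining `exp L^r`: the complementary function of
`t (1 + log⁺ t)^{1/r}`. -/
def expL (r : ℝ) : ℝ≥0 → ℝ≥0∞ := complementary (LlogL r)

/-- The seminorm `sup_Q ‖b - b_Q‖_{exp L^r, Q}`. -/
def oscNorm {n : ℕ} (r : ℝ) (b : Rn n → ℂ) : ℝ≥0∞ :=
  ⨆ Q ∈ cubes n, luxemburg (expL r) Q (fun x => b x - ⨍ y in Q, b y)

/-- `b ∈ Osc_{exp L^r}`. -/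
def MemOsc {n : ℕ} (r : ℝ) (b : Rn n → ℂ) : Prop :=
  LocallyIntegrable b volume ∧ oscNorm r b < ∞

/-- The annulus `{x : s < |x| ≤ 2 s}`. -/
def annulus (n : ℕ) (s : ℝ) : Set (Rn n) := {x | s < ‖x‖ ∧ ‖x‖ ≤ 2 * s}

/-- `‖f‖_{φ, |x| ∼ s}`. -/
def luxAnnulus {n : ℕ} (φ : ℝ≥0 → ℝ≥0∞) (s : ℝ) (f : Rn n → ℂ) : ℝ≥0∞ :=
  luxemburg φ (Metric.ball 0 (2 * s)) ((annulus n s).indicator f)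

/-- The Hörmander condition `K ∈ H_{φ,m}`; the summation index `k` below stands for `k + 1 ≥ 1`. -/
def MemH {n : ℕ} (φ : ℝ≥0 → ℝ≥0∞) (m : ℕ) (K : Rn n → ℂ) : Prop :=
  ∃ (c : ℝ) (A : ℝ≥0), 1 ≤ c ∧ ∀ (y : Rn n) (R : ℝ), c * ‖y‖ < R →
    ∑' k : ℕ, ENNReal.ofReal ((2 ^ (k + 1) * R) ^ n) * ((k + 1 : ℕ) : ℝ≥0∞) ^ m *
      luxAnnulus φ (2 ^ (k + 1) * R) (fun x => K (x - y) - K x) ≤ A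

/-- Bounded linear operators on `L²(ℝⁿ)`. -/
abbrev L2Op (n : ℕ) : Type :=
  Lp ℂ 2 (volume : Measure (Rn n)) →L[ℂ] Lp ℂ 2 (volume : Measure (Rn n))

open Classical in
/-- `T g` for a function `g ∈ L²`, as a function defined up to null sets
(and `0` by convention when `g ∉ L²`). -/
def applyFun {n : ℕ} (T : L2Op n) (g : Rn n → ℂ) : Rn n → ℂ :=
  if h : MemLp g 2 volume then (T (h.toLp g) : Rn n → ℂ) else 0

/-- `T` has kernel `K`: for every `f ∈ L²` with compact support,
`T f (x) = ∫ K(x - y) f(y) dy`, the integral being absolutely convergent,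
for almost every `x` outside the support of `f`. -/
structure HasKernel {n : ℕ} (T : L2Op n) (K : Rn n → ℂ) : Prop where
  measurable : AEStronglyMeasurable K volume
  repr : ∀ f : Rn n → ℂ, MemLp f 2 volume → HasCompactSupport f →
    ∀ᵐ x, x ∉ tsupport f →
      Integrable (fun y => K (x - y) * f y) volume ∧
        applyFun T f x = ∫ y, K (x - y) * f y

/-- The commutator `T_b` of `T` with the multilinear symbol `b = (b₁, …, b_k)`, given as a list:
`T_b f = b₁ T_{(b₂,…,b_k)} f - T_{(b₂,…,b_k)} (b₁ f)`, and `T_b = T` for the empty symbol. -/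
def multiComm {n : ℕ} (T : L2Op n) : List (Rn n → ℂ) → (Rn n → ℂ) → Rn n → ℂ
  | [], f => applyFun T f
  | b :: bs, f => fun x => b x * multiComm T bs f x - multiComm T bs (fun y => b y * f y) x

/-- The symbol `b_σ` whose components are the `b i`, in increasing order of `i`, with `σ_i = 1`.
An element `σ` of `{0,1}^m` is given as the set of the indices `i` with `σ_i = 1`,
so that `|σ|` is its cardinality and `σ̄` its complement. -/
def subSymbol {n m : ℕ} (b : Fin m → Rn n → ℂ) (σ : Finset (Fin m)) : List (Rn n → ℂ) :=
  ((List.finRange m).filter (fun i => i ∈ σ)).map b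

/-- `‖b_σ‖ = ∏_{i : σ_i = 1} ‖b_i‖_{Osc_{exp L^{r_i}}}`. -/
def symbolNorm {n m : ℕ} (r : Fin m → ℝ) (b : Fin m → Rn n → ℂ) (σ : Finset (Fin m)) : ℝ≥0∞ :=
  ∏ i ∈ σ, oscNorm (r i) (b i)

/-- The functions `f` for which `T_b f` is defined for an operator `T` on `L²`: all the functions
to which `T` is applied in the definition of `T_b f`, and of the lower order `T_{b_σ} f`,
are in `L²`. -/
def InDomain {n m : ℕ} (b : Fin m → Rn n → ℂ) (f : Rn n → ℂ) : Prop :=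
  ∀ σ : Finset (Fin m), MemLp (fun x => (∏ i ∈ σ, b i x) * f x) 2 volume

/-- The maximal function `M_φ f(x) = sup_{Q ∋ x} ‖f‖_{φ,Q}`. -/
def maximalYoung {n : ℕ} (φ : ℝ≥0 → ℝ≥0∞) (f : Rn n → ℂ) (x : Rn n) : ℝ≥0∞ :=
  ⨆ Q ∈ {Q ∈ cubes n | x ∈ Q}, luxemburg φ Q f

/-- `M_ε f = (M (|f|^ε))^{1/ε}`, with `M` the Hardy–Littlewood maximal operator over cubes. -/
def maximalPow {n : ℕ} (ε : ℝ) (f : Rn n → ℂ) (x : Rn n) : ℝ≥0∞ :=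
  (⨆ Q ∈ {Q ∈ cubes n | x ∈ Q}, (volume Q)⁻¹ * ∫⁻ y in Q, ‖f y‖ₑ ^ ε) ^ (1 / ε)

/-- The sharp maximal function of a real function. -/
def sharp {n : ℕ} (h : Rn n → ℝ) (x : Rn n) : ℝ≥0∞ :=
  ⨆ Q ∈ {Q ∈ cubes n | x ∈ Q}, (volume Q)⁻¹ * ∫⁻ y in Q, ‖h y - ⨍ z in Q, h z‖ₑ

/-- `M^#_δ f = (M^# (|f|^δ))^{1/δ}`. -/
def sharpPow {n : ℕ} (δ : ℝ) (f : Rn n → ℂ) (x : Rn n) : ℝ≥0∞ :=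
  (sharp (fun y => ‖f y‖ ^ δ) x) ^ (1 / δ)

end HormanderCommutator

end

open HormanderCommutator

noncomputable section

namespace HormanderCommutator

/-! ### Cubes -/

/-! Fix a cube Q containing x, let A be a fixed dilate of Q, a_i the average of b_i over A, and g =
∏ (b_i - a_i) f. Expanding the product gives T g = ∑_σ (-1)^|σ| ∏_{i ∉ σ} (b_i - a_i) T_{b_σ} f,
whose term with |σ| = m is (-1)^m T_b f. So, up to sign, T_b f equals T(g 1_A) + T(g 1_{Aᶜ}) minus
terms of lower order (`enorm_multiComm_sub_le`). Since δ < 1, powers of order δ are subadditive, and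
the contributions to the oscillation of |T_b f|^δ on Q can be estimated one by one, after a constant
z has been subtracted from the far part T(g 1_{Aᶜ}).

The lower order terms follow from Hölder's inequality with exponent ε/δ and its conjugate, because
oscillations in exp L^r have integrable powers of every order (`exists_lintegral_lower_order_le`).

The near part T(g 1_A) is controlled by the mean of |g| over A, through the weak type (1,1) estimate
(`HasKernel.exists_weak_type`) and Kolmogorov's inequality. The weak type estimate rests on the
Calderón–Zygmund decomposition, since H_{φ,m} implies the integral Hörmander condition.

The far part varies little on Q: its differences are integrals of K(z - y) - K(w - y) against g,
split over dyadic annuli (`exists_lintegral_compl_cube_le`). Passing from averages over A to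
averages over 2^k A costs a multiple of k for each symbol, hence k^m in all, which is exactly the
weight in H_{φ,m}.

Both parts use one Hölder inequality, proved pointwise (`exists_mul_prod_le`). With t = e + φ(h) +
η̄(u) + ∑ expL(β_i), each of h, u, β_i is bounded by the corresponding inverse function at t, up to
a constant, and the hypothesis on the inverses bounds the product by a multiple of t. Integrating
over a cube on which each term of t has mean at most 1 gives the inequality. -/

theorem cube_eq_preimage {n : ℕ} (c : Rn n) (l : ℝ) :
    cube c l = (WithLp.ofLp : Rn n → Fin n → ℝ) ⁻¹'
      Set.Icc (fun i => c i - l) (fun i => c i + l) := by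
  ext x
  simp only [cube, Set.mem_ofPred_eq, Set.mem_preimage, Set.mem_Icc, Pi.le_def, abs_le]
  constructor
  · exact fun h => ⟨fun i => by linarith [(h i).1], fun i => by linarith [(h i).2]⟩
  · exact fun h i => ⟨by linarith [h.1 i], by linarith [h.2 i]⟩

theorem measurableSet_cube {n : ℕ} (c : Rn n) (l : ℝ) : MeasurableSet (cube c l) := by
  rw [cube_eq_preimage]
  exact (PiLp.volume_preserving_ofLp (Fin n)).measurable measurableSet_Icc

theorem isClosed_cube {n : ℕ} (c : Rn n) (l : ℝ) : IsClosed (cube c l) := by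
  rw [cube_eq_preimage]
  exact isClosed_Icc.preimage (PiLp.continuous_ofLp 2 _)

theorem volume_cube {n : ℕ} (c : Rn n) (l : ℝ) (hl : 0 < l) :
    volume (cube c l) = ENNReal.ofReal ((2 * l) ^ n) := by
  rw [cube_eq_preimage, (PiLp.volume_preserving_ofLp (Fin n)).measure_preimage
    measurableSet_Icc.nullMeasurableSet, Real.volume_Icc_pi]
  simp only [add_sub_sub_cancel, Finset.prod_const, Finset.card_univ, Fintype.card_fin]
  rw [← ENNReal.ofReal_pow (by linarith)]
  ring_nf

theorem volume_cube_pos {n : ℕ} (c : Rn n) {l : ℝ} (hl : 0 < l) : 0 < volume (cube c l) := by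
  rw [volume_cube c l hl]; simp only [ENNReal.ofReal_pos]; positivity

theorem volume_cube_ne_top {n : ℕ} (c : Rn n) {l : ℝ} (hl : 0 < l) :
    volume (cube c l) ≠ ∞ := by
  rw [volume_cube c l hl]; exact ENNReal.ofReal_ne_top

theorem volume_cube_mul {n : ℕ} (c c' : Rn n) {l a : ℝ} (hl : 0 < l) (ha : 0 < a) :
    volume (cube c (a * l)) = ENNReal.ofReal (a ^ n) * volume (cube c' l) := by
  rw [volume_cube _ _ hl, volume_cube _ _ (mul_pos ha hl), ← ENNReal.ofReal_mul (by positivity)]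
  congr 1; ring

theorem cube_mem_cubes {n : ℕ} (c : Rn n) {l : ℝ} (hl : 0 < l) : cube c l ∈ cubes n :=
  ⟨c, l, hl, rfl⟩

theorem cube_mono {n : ℕ} (c : Rn n) {l l' : ℝ} (h : l ≤ l') : cube c l ⊆ cube c l' :=
  fun _ hx i => (hx i).trans h

theorem abs_coord_le_norm {n : ℕ} (x : Rn n) (i : Fin n) : |x i| ≤ ‖x‖ := by
  simpa using PiLp.norm_apply_le x i

theorem norm_le_sqrt_mul {n : ℕ} (x : Rn n) {a : ℝ} (ha : 0 ≤ a) (h : ∀ i, |x i| ≤ a) :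
    ‖x‖ ≤ √n * a := by
  rw [EuclideanSpace.norm_eq, ← Real.sqrt_sq ha, ← Real.sqrt_mul (Nat.cast_nonneg n)]
  apply Real.sqrt_le_sqrt
  calc ∑ i, ‖x i‖ ^ 2 ≤ ∑ _i : Fin n, a ^ 2 := by
        apply Finset.sum_le_sum; intro i _
        have := h i
        rw [Real.norm_eq_abs]
        gcongr
    _ = n * a ^ 2 := by simp

theorem norm_sub_le_of_mem_cube {n : ℕ} {c z w : Rn n} {l : ℝ} (hl : 0 ≤ l) (hz : z ∈ cube c l)
    (hw : w ∈ cube c l) : ‖z - w‖ ≤ √n * (2 * l) := by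
  apply norm_le_sqrt_mul _ (by linarith)
  intro i
  have h1 := abs_le.1 (hz i)
  have h2 := abs_le.1 (hw i)
  simp only [PiLp.sub_apply]
  rw [abs_le]; constructor <;> linarith

theorem isCompact_cube {n : ℕ} (c : Rn n) (l : ℝ) : IsCompact (cube c l) := by
  rcases lt_or_ge l 0 with hl | hl
  · rcases (cube c l).eq_empty_or_nonempty with h | ⟨x, hx⟩
    · rw [h]; exact isCompact_empty
    · rcases isEmpty_or_nonempty (Fin n) with hn | ⟨⟨i⟩⟩
      · exact (Set.toFinite _).isCompact
      · exact absurd ((abs_nonneg _).trans (hx i)) (not_le.2 hl)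
  · refine Metric.isCompact_of_isClosed_isBounded (isClosed_cube c l)
      ((Metric.isBounded_closedBall (x := c) (r := √n * l)).subset fun x hx => ?_)
    rw [mem_closedBall_iff_norm]
    exact norm_le_sqrt_mul _ hl fun i => by simpa using hx i

/-! ### Young functions and their inverses -/

theorem complementary_mono (φ : ℝ≥0 → ℝ≥0∞) : Monotone (complementary φ) := by
  intro a b hab
  apply iSup_mono
  intro s
  apply tsub_le_tsub_right
  exact_mod_cast mul_le_mul_left hab s

theorem le_genInv_of_strictMono {φ : ℝ≥0 → ℝ≥0∞} (hφ : StrictMono φ) {a : ℝ≥0} {t : ℝ≥0∞}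
    (h : φ a ≤ t) : (a : ℝ≥0∞) ≤ genInv φ t := by
  refine le_iInf₂ fun s hs => ?_
  exact_mod_cast hφ.le_iff_le.1 (h.trans hs)

/-- Convexity along rays from the origin, valid for every φ: the expression under the supremum is
linear in s apart from the term φ(u), and multiplying that term by s / a ≤ 1 only decreases what is
subtracted. -/
theorem complementary_le_mul (φ : ℝ≥0 → ℝ≥0∞) {s a : ℝ≥0} (hsa : s ≤ a) (ha : 0 < a) :
    complementary φ s ≤ ((s / a : ℝ≥0) : ℝ≥0∞) * complementary φ a := by
  refine iSup_le fun u => ?_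
  have hθ : s / a ≤ 1 := div_le_one_of_le₀ hsa zero_le
  have h1 : (((s * u : ℝ≥0)) : ℝ≥0∞) = ((s / a : ℝ≥0) : ℝ≥0∞) * ((a * u : ℝ≥0) : ℝ≥0∞) := by
    rw [← ENNReal.coe_mul]
    congr 1
    field_simp
  calc ((s * u : ℝ≥0) : ℝ≥0∞) - φ u
      ≤ ((s / a : ℝ≥0) : ℝ≥0∞) * ((a * u : ℝ≥0) : ℝ≥0∞) - ((s / a : ℝ≥0) : ℝ≥0∞) * φ u := by
        rw [h1]
        apply tsub_le_tsub_left
        exact mul_le_of_le_one_left' (by exact_mod_cast hθ)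
    _ = ((s / a : ℝ≥0) : ℝ≥0∞) * (((a * u : ℝ≥0) : ℝ≥0∞) - φ u) := by
        rw [ENNReal.mul_sub fun _ _ => ENNReal.coe_ne_top]
    _ ≤ _ := by
        gcongr
        exact le_iSup (fun u : ℝ≥0 => ((a * u : ℝ≥0) : ℝ≥0∞) - φ u) u

/-- A complementary function may vanish near 0, so strict monotonicity is not available. At a
positive finite level t the ray inequality replaces it: a point s < a with value at least t would
give t ≤ (s / a) t < t. -/
theorem le_genInv_complementary (φ : ℝ≥0 → ℝ≥0∞) {a : ℝ≥0} {t : ℝ≥0∞} (ht : t ≠ 0)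
    (ht' : t ≠ ∞) (h : complementary φ a ≤ t) :
    (a : ℝ≥0∞) ≤ genInv (complementary φ) t := by
  refine le_iInf₂ fun s hs => ?_
  by_contra! hlt
  have hsa : s < a := by exact_mod_cast hlt
  have ha : 0 < a := lt_of_le_of_lt zero_le hsa
  have hθ : s / a < 1 := (div_lt_one ha).2 hsa
  have h2 : t ≤ ((s / a : ℝ≥0) : ℝ≥0∞) * t :=
    hs.trans ((complementary_le_mul φ hsa.le ha).trans (by gcongr))
  have h3 : ((s / a : ℝ≥0) : ℝ≥0∞) * t < 1 * t :=
    ENNReal.mul_lt_mul_left ht ht' (by exact_mod_cast hθ)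
  rw [one_mul] at h3
  exact absurd h2 (not_le.2 h3)

theorem IsYoung.ne_top {φ : ℝ≥0 → ℝ≥0∞} (hφ : IsYoung φ) (t : ℝ≥0) : φ t ≠ ∞ :=
  ((hφ.strictMono (lt_add_one t)).trans_le le_top).ne

theorem IsYoung.pos {φ : ℝ≥0 → ℝ≥0∞} (hφ : IsYoung φ) {t : ℝ≥0} (ht : 0 < t) : 0 < φ t := by
  simpa [hφ.map_zero] using hφ.strictMono ht

theorem IsYoung.map_mul_le {φ : ℝ≥0 → ℝ≥0∞} (hφ : IsYoung φ) {s : ℝ≥0} (hs : s ≤ 1) (t : ℝ≥0) :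
    φ (s * t) ≤ (s : ℝ≥0∞) * φ t := by
  have h := hφ.convex.2 (Set.mem_univ t) (Set.mem_univ 0) (zero_le (a := s)) (zero_le (a := 1 - s))
    (add_tsub_cancel_of_le hs)
  simpa [hφ.map_zero, ENNReal.smul_def] using h

/-- A Young function takes small values at some positive point. -/
theorem IsYoung.exists_le_one {φ : ℝ≥0 → ℝ≥0∞} (hφ : IsYoung φ) :
    ∃ a : ℝ≥0, 0 < a ∧ φ a ≤ 1 := by
  obtain ⟨v, hv⟩ : ∃ v : ℝ≥0, (v : ℝ≥0∞) = φ 1 := ⟨_, ENNReal.coe_toNNReal (hφ.ne_top 1)⟩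
  refine ⟨(1 + v)⁻¹, by positivity, ?_⟩
  have h := hφ.map_mul_le (s := (1 + v)⁻¹) (inv_le_one_of_one_le₀ (by simp)) 1
  rw [mul_one, ← hv] at h
  refine h.trans ?_
  rw [← ENNReal.coe_mul]
  have : (1 + v)⁻¹ * v ≤ 1 := by
    rw [inv_mul_le_iff₀ (by positivity)]; simp
  exact_mod_cast this

/-- A Young function grows at least linearly. -/
theorem IsYoung.exists_le_mul {φ : ℝ≥0 → ℝ≥0∞} (hφ : IsYoung φ) :
    ∃ C : ℝ≥0, ∀ t : ℝ≥0, (t : ℝ≥0∞) ≤ C * (1 + φ t) := by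
  have h1 : φ 1 ≠ 0 := (hφ.pos one_pos).ne'
  obtain ⟨v, hv⟩ : ∃ v : ℝ≥0, (v : ℝ≥0∞) = φ 1 := ⟨_, ENNReal.coe_toNNReal (hφ.ne_top 1)⟩
  have hv0 : v ≠ 0 := by rintro rfl; simp [← hv] at h1
  refine ⟨1 + v⁻¹, fun t => ?_⟩
  rcases le_total t 1 with ht | ht
  · calc (t : ℝ≥0∞) ≤ 1 * 1 := by rw [one_mul]; exact_mod_cast ht
      _ ≤ _ := by
        gcongr
        · exact_mod_cast le_self_add
        · exact le_self_add
  · have ht0 : t ≠ 0 := (lt_of_lt_of_le one_pos ht).ne'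
    have h := hφ.map_mul_le (s := t⁻¹) (inv_le_one_of_one_le₀ ht) t
    rw [inv_mul_cancel₀ ht0, ← hv] at h
    have h2 : (t : ℝ≥0∞) * v ≤ φ t := by
      calc (t : ℝ≥0∞) * v ≤ t * ((t⁻¹ : ℝ≥0) * φ t) := by gcongr
        _ = φ t := by
          rw [← mul_assoc, ← ENNReal.coe_mul, mul_inv_cancel₀ ht0]; simp
    calc (t : ℝ≥0∞) = (v⁻¹ : ℝ≥0) * (t * v) := by
          rw [mul_comm (t : ℝ≥0∞), ← mul_assoc, ← ENNReal.coe_mul, inv_mul_cancel₀ hv0]; simp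
      _ ≤ (v⁻¹ : ℝ≥0) * φ t := by gcongr
      _ ≤ _ := by
        gcongr
        · exact le_add_self
        · exact le_add_self

/-! ### Exponential Young functions -/

theorem expL_mono (r : ℝ) : Monotone (expL r) := complementary_mono _

/-- The inverse of exp L^r grows at most like (log t)^{1/r}. This follows by testing the supremum
that defines `expL` at a single point. -/
theorem le_log_rpow_of_expL_le {r : ℝ} (hr : 1 ≤ r) {a : ℝ≥0} {t : ℝ} (ht : Real.exp 1 ≤ t)
    (h : expL r a ≤ ENNReal.ofReal t) : (a : ℝ) ≤ 4 * Real.log t ^ (1 / r) := by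
  have ht0 : 0 < t := (Real.exp_pos 1).trans_le ht
  have hlog : 1 ≤ Real.log t := (Real.le_log_iff_exp_le ht0).2 ht
  have hr0 : 0 < r := by linarith
  have hone : 1 ≤ Real.log t ^ (1 / r) := Real.one_le_rpow hlog (by positivity)
  rcases le_or_gt (a : ℝ) 2 with ha | ha
  · linarith
  have ha2 : (1 : ℝ) ≤ a / 2 := by linarith
  -- The point where (1 + log s)^{1/r} = a / 2: there a s minus the value of `LlogL` is a s / 2,
  -- which is at least s because a > 2.
  set s : ℝ := Real.exp (((a : ℝ) / 2) ^ r - 1) with hs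
  have hpow : 1 ≤ ((a : ℝ) / 2) ^ r := Real.one_le_rpow ha2 hr0.le
  have hs1 : 1 ≤ s := Real.one_le_exp (by linarith)
  have hs0 : 0 ≤ s := by linarith
  have hval : LlogL r s.toNNReal = ENNReal.ofReal (s * (a / 2)) := by
    rw [LlogL, Real.coe_toNNReal _ hs0, Real.posLog_eq_log (by rwa [abs_of_nonneg hs0]), hs,
      Real.log_exp, add_sub_cancel, ← Real.rpow_mul (by positivity), mul_one_div_cancel hr0.ne',
      Real.rpow_one]
  have hle : ENNReal.ofReal (a * s) - ENNReal.ofReal (s * (a / 2)) ≤ ENNReal.ofReal t := by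
    refine le_trans ?_ h
    rw [← hval]
    refine le_trans (le_of_eq ?_) (le_iSup (fun u : ℝ≥0 => ((a * u : ℝ≥0) : ℝ≥0∞) - LlogL r u)
      s.toNNReal)
    rw [ENNReal.ofReal, Real.toNNReal_mul (by positivity), Real.toNNReal_coe]
  rw [← ENNReal.ofReal_sub _ (by positivity), ENNReal.ofReal_le_ofReal_iff ht0.le] at hle
  have hst : s ≤ t := by nlinarith
  have h3 : ((a : ℝ) / 2) ^ r ≤ 2 * Real.log t := by
    have := (Real.le_log_iff_exp_le ht0).2 hst
    linarith
  have h4 : (a : ℝ) / 2 ≤ (2 * Real.log t) ^ (1 / r) := by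
    rw [one_div]
    exact (Real.le_rpow_inv_iff_of_pos (by positivity) (by positivity) hr0).2 h3
  rw [Real.mul_rpow (by norm_num) (by linarith)] at h4
  have h5 : (2 : ℝ) ^ (1 / r) ≤ 2 := by
    calc (2 : ℝ) ^ (1 / r) ≤ 2 ^ (1 : ℝ) :=
          Real.rpow_le_rpow_of_exponent_le (by norm_num) (by rw [div_le_one hr0]; exact hr)
      _ = 2 := by norm_num
  nlinarith

/-! ### Luxemburg averages -/

/-- The strict inequality provides an admissible μ ≤ lam, so no attainment of the infimum is needed,
only monotonicity of φ. -/
theorem lintegral_le_of_luxemburg_lt {n : ℕ} {φ : ℝ≥0 → ℝ≥0∞} (hφ : Monotone φ)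
    {A : Set (Rn n)} (hA : volume A ≠ 0) (hA' : volume A ≠ ∞) {f : Rn n → ℂ} {lam : ℝ≥0}
    (h : luxemburg φ A f < lam) : ∫⁻ x in A, φ (‖f x‖₊ / lam) ≤ volume A := by
  simp only [luxemburg, iInf_lt_iff] at h
  obtain ⟨μ, ⟨hμ, hle⟩, hlt⟩ := h
  have hlt' : μ ≤ lam := by exact_mod_cast hlt.le
  calc ∫⁻ x in A, φ (‖f x‖₊ / lam) ≤ ∫⁻ x in A, φ (‖f x‖₊ / μ) := by
        apply lintegral_mono
        intro x
        apply hφ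
        gcongr
    _ = volume A * ((volume A)⁻¹ * ∫⁻ x in A, φ (‖f x‖₊ / μ)) := by
        rw [← mul_assoc, ENNReal.mul_inv_cancel hA hA', one_mul]
    _ ≤ volume A * 1 := by gcongr
    _ = volume A := mul_one _

/-! ### Pointwise inequalities of Hölder type -/

theorem ofReal_exp_one_add_le {X : ℝ≥0∞} (hX : X ≠ ∞) :
    ENNReal.ofReal (Real.exp 1 + X.toReal) ≤ 3 * (1 + X) := by
  rw [ENNReal.ofReal_add (Real.exp_pos 1).le ENNReal.toReal_nonneg, ENNReal.ofReal_toReal hX,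
    mul_add, mul_one]
  gcongr
  · rw [← ENNReal.ofReal_ofNat 3]
    exact ENNReal.ofReal_le_ofReal (by linarith [Real.exp_one_lt_d9])
  · exact le_mul_of_one_le_left' (by norm_num)

theorem le_ofReal_exp_one_add {X Y : ℝ≥0∞} (hX : X ≠ ∞) (h : Y ≤ X) :
    Y ≤ ENNReal.ofReal (Real.exp 1 + X.toReal) := by
  rw [ENNReal.ofReal_add (Real.exp_pos 1).le ENNReal.toReal_nonneg, ENNReal.ofReal_toReal hX]
  exact h.trans le_add_self

/-- The pointwise generalized Hölder inequality. The shift κ allows for the difference between the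
averages of a symbol over two cubes; it costs (1 + κ)^m because every logarithmic factor is at least
1. -/
theorem exists_mul_prod_le {m : ℕ} (r : Fin m → ℝ) (hr : ∀ i, 1 ≤ r i) (r₀ : ℝ)
    (hr₀ : 1 / r₀ = ∑ i, 1 / r i) (η φ : ℝ≥0 → ℝ≥0∞) (hφ : IsYoung φ)
    (hηφ : ∃ A : ℝ≥0, ∀ t : ℝ, Real.exp 1 ≤ t →
      genInv (complementary η) (ENNReal.ofReal t) * genInv φ (ENNReal.ofReal t) *
        ENNReal.ofReal (Real.log t ^ (1 / r₀)) ≤ A * ENNReal.ofReal t) :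
    ∃ C : ℝ≥0, ∀ (κ h u : ℝ≥0) (β : Fin m → ℝ≥0),
      (h : ℝ≥0∞) * u * ∏ i, ((β i + κ : ℝ≥0) : ℝ≥0∞) ≤
        C * (1 + κ : ℝ≥0) ^ m *
          (1 + (φ h + complementary η u + ∑ i, expL (r i) (β i))) := by
  obtain ⟨A, hA⟩ := hηφ
  -- The summand 1 makes the constant nonzero, so that the right side is ∞ when X = ∞. The 3 comes
  -- from e + X ≤ 3 (1 + X), and each symbol contributes a 4.
  refine ⟨4 ^ m * A * 3 + 1, fun κ h u β => ?_⟩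
  set X := φ h + complementary η u + ∑ i, expL (r i) (β i) with hXdef
  by_cases hX : X = ∞
  · rw [hX, add_top, ENNReal.mul_top]
    · exact le_top
    · refine mul_ne_zero ?_ (pow_ne_zero _ ?_)
      · simp
      · simp
  -- This t is at least e, so the hypothesis on the inverses applies, and it dominates every summand
  -- of X.
  set t : ℝ := Real.exp 1 + X.toReal with ht
  have hte : Real.exp 1 ≤ t := by rw [ht]; linarith [ENNReal.toReal_nonneg (a := X)]
  have ht0 : 0 < t := (Real.exp_pos 1).trans_le hte
  have hlog : 1 ≤ Real.log t := (Real.le_log_iff_exp_le ht0).2 hte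
  have hh : (h : ℝ≥0∞) ≤ genInv φ (ENNReal.ofReal t) :=
    le_genInv_of_strictMono hφ.strictMono
      (le_ofReal_exp_one_add hX (by rw [hXdef, add_assoc]; exact le_self_add))
  have hu : (u : ℝ≥0∞) ≤ genInv (complementary η) (ENNReal.ofReal t) :=
    le_genInv_complementary η (ENNReal.ofReal_pos.2 ht0).ne' ENNReal.ofReal_ne_top
      (le_ofReal_exp_one_add hX (by
        rw [hXdef, add_comm (φ h), add_assoc]; exact le_self_add))
  have hβ : ∀ i, ((β i + κ : ℝ≥0) : ℝ≥0∞) ≤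
      ENNReal.ofReal (4 * (1 + κ) * Real.log t ^ (1 / r i)) := by
    intro i
    have h1 : (β i : ℝ) ≤ 4 * Real.log t ^ (1 / r i) :=
      le_log_rpow_of_expL_le (hr i) hte (le_ofReal_exp_one_add hX (by
        rw [hXdef]
        exact (Finset.single_le_sum (f := fun i => expL (r i) (β i)) (fun _ _ => zero_le)
          (Finset.mem_univ i)).trans le_add_self))
    have h2 : 1 ≤ Real.log t ^ (1 / r i) :=
      Real.one_le_rpow hlog (by have := hr i; positivity)
    rw [← ENNReal.ofReal_coe_nnreal]
    apply ENNReal.ofReal_le_ofReal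
    push_cast
    nlinarith [κ.coe_nonneg]
  calc (h : ℝ≥0∞) * u * ∏ i, ((β i + κ : ℝ≥0) : ℝ≥0∞)
      ≤ genInv φ (ENNReal.ofReal t) * genInv (complementary η) (ENNReal.ofReal t) *
          ∏ i, ENNReal.ofReal (4 * (1 + κ) * Real.log t ^ (1 / r i)) := by
        gcongr with i
        exact hβ i
    _ = 4 ^ m * (1 + κ : ℝ≥0) ^ m * (genInv (complementary η) (ENNReal.ofReal t) *
          genInv φ (ENNReal.ofReal t) * ENNReal.ofReal (Real.log t ^ (1 / r₀))) := by
        rw [← ENNReal.ofReal_prod_of_nonneg (fun i _ => by positivity), Finset.prod_mul_distrib,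
          hr₀, Real.rpow_sum_of_pos (by linarith), ENNReal.ofReal_mul (by positivity)]
        simp only [Finset.prod_const, Finset.card_univ, Fintype.card_fin]
        rw [mul_pow, ENNReal.ofReal_mul (by positivity), ENNReal.ofReal_pow (by norm_num),
          ENNReal.ofReal_pow (by positivity), ENNReal.ofReal_ofNat]
        have : ENNReal.ofReal (1 + (κ : ℝ)) = ((1 + κ : ℝ≥0) : ℝ≥0∞) := by
          rw [← ENNReal.ofReal_coe_nnreal]; simp
        rw [this]
        ring
    _ ≤ 4 ^ m * (1 + κ : ℝ≥0) ^ m * (A * (3 * (1 + X))) := by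
        refine mul_le_mul' le_rfl ((hA t hte).trans ?_)
        gcongr
        exact ofReal_exp_one_add_le hX
    _ = (4 ^ m * A * 3) * (1 + κ : ℝ≥0) ^ m * (1 + X) := by ring
    _ ≤ _ := by
        gcongr
        push_cast
        exact le_self_add

theorem log_rpow_le_mul {P t : ℝ} (hP : 0 < P) (ht : 0 ≤ t) (hlog : 0 ≤ Real.log t) :
    (4 * Real.log t) ^ P ≤ (4 * P) ^ P * t := by
  have h1 : Real.log t ≤ t ^ (1 / P) / (1 / P) := Real.log_le_rpow_div ht (by positivity)
  calc (4 * Real.log t) ^ P ≤ (4 * P * t ^ (1 / P)) ^ P := by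
        apply Real.rpow_le_rpow (by positivity) _ hP.le
        calc 4 * Real.log t ≤ 4 * (t ^ (1 / P) / (1 / P)) := by gcongr
          _ = _ := by field_simp
    _ = _ := by
        rw [Real.mul_rpow (by positivity) (by positivity), ← Real.rpow_mul ht,
          one_div_mul_cancel hP.ne', Real.rpow_one]

/-- The method of `exists_mul_prod_le` with the symbols alone: since 1 / r_i ≤ 1, each factor is at
most (4 log t)^p, and any power of log t is dominated by t. -/
theorem exists_prod_rpow_le {m : ℕ} (r : Fin m → ℝ) (hr : ∀ i, 1 ≤ r i) {p : ℝ} (hp : 0 ≤ p) :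
    ∃ C : ℝ≥0, ∀ (S : Finset (Fin m)) (β : Fin m → ℝ≥0),
      ∏ i ∈ S, (β i : ℝ≥0∞) ^ p ≤ C * (1 + ∑ i ∈ S, expL (r i) (β i)) := by
  -- Exceeds p |S| for every S at once, and is positive even when p or m is 0.
  set P : ℝ := p * m + 1 with hPdef
  have hP : 1 ≤ P := by rw [hPdef]; nlinarith [(Nat.cast_nonneg m : (0 : ℝ) ≤ m)]
  refine ⟨Real.toNNReal ((4 * P) ^ P) * 3, fun S β => ?_⟩
  set X := ∑ i ∈ S, expL (r i) (β i) with hXdef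
  by_cases hX : X = ∞
  · rw [hX, add_top, ENNReal.mul_top]
    · exact le_top
    · have : 0 < (4 * P) ^ P := by positivity
      simpa using this
  set t : ℝ := Real.exp 1 + X.toReal with ht
  have hte : Real.exp 1 ≤ t := by rw [ht]; linarith [ENNReal.toReal_nonneg (a := X)]
  have ht0 : 0 < t := (Real.exp_pos 1).trans_le hte
  have hlog : 1 ≤ Real.log t := (Real.le_log_iff_exp_le ht0).2 hte
  have hβ : ∀ i ∈ S, (β i : ℝ≥0∞) ^ p ≤ ENNReal.ofReal ((4 * Real.log t) ^ p) := by
    intro i hi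
    have h1 : (β i : ℝ) ≤ 4 * Real.log t ^ (1 / r i) :=
      le_log_rpow_of_expL_le (hr i) hte (le_ofReal_exp_one_add hX
        (Finset.single_le_sum (f := fun i => expL (r i) (β i)) (fun _ _ => zero_le) hi))
    have h2 : Real.log t ^ (1 / r i) ≤ Real.log t := by
      conv_rhs => rw [← Real.rpow_one (Real.log t)]
      have h3 := hr i
      exact Real.rpow_le_rpow_of_exponent_le hlog (by rw [div_le_one (by linarith)]; exact h3)
    rw [← ENNReal.ofReal_rpow_of_nonneg (by positivity) hp, ← ENNReal.ofReal_coe_nnreal]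
    gcongr
    linarith
  calc ∏ i ∈ S, (β i : ℝ≥0∞) ^ p ≤ ∏ _i ∈ S, ENNReal.ofReal ((4 * Real.log t) ^ p) :=
        Finset.prod_le_prod' hβ
    _ = ENNReal.ofReal ((4 * Real.log t) ^ (p * S.card)) := by
        rw [Finset.prod_const, ← ENNReal.ofReal_pow (by positivity), Real.rpow_mul_natCast
          (by positivity)]
    _ ≤ ENNReal.ofReal ((4 * P) ^ P * t) := by
        apply ENNReal.ofReal_le_ofReal
        refine le_trans (Real.rpow_le_rpow_of_exponent_le (by linarith) ?_)
          (log_rpow_le_mul (by linarith) ht0.le (by linarith))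
        have : (S.card : ℝ) ≤ m := by
          exact_mod_cast (Finset.card_le_univ S).trans (by simp)
        rw [hPdef]
        nlinarith
    _ = Real.toNNReal ((4 * P) ^ P) * ENNReal.ofReal t := by
        rw [ENNReal.ofReal_mul (by positivity)]; rfl
    _ ≤ Real.toNNReal ((4 * P) ^ P) * (3 * (1 + X)) := by
        gcongr; exact ofReal_exp_one_add_le hX
    _ = _ := by push_cast; ring

/-! ### Oscillation -/

theorem lintegral_expL_le {n : ℕ} {r : ℝ} {b : Rn n → ℂ} {N : ℝ≥0} (hN : oscNorm r b < N)
    (c : Rn n) {l : ℝ} (hl : 0 < l) :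
    ∫⁻ x in cube c l, expL r (‖b x - ⨍ y in cube c l, b y‖₊ / N) ≤ volume (cube c l) := by
  refine lintegral_le_of_luxemburg_lt (f := fun x => b x - ⨍ y in cube c l, b y)
    (expL_mono r) (volume_cube_pos c hl).ne' (volume_cube_ne_top c hl)
    (lt_of_le_of_lt ?_ hN)
  exact le_iSup₂ (f := fun Q (_ : Q ∈ cubes n) => luxemburg (expL r) Q
    (fun x => b x - ⨍ y in Q, b y)) _ (cube_mem_cubes c hl)

/-- Integrals of powers of products of oscillations are bounded by exponential oscillations. -/
theorem exists_lintegral_osc_le {m : ℕ} (r : Fin m → ℝ) (hr : ∀ i, 1 ≤ r i) {p : ℝ}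
    (hp : 0 ≤ p) (n : ℕ) :
    ∃ C : ℝ≥0, ∀ (S : Finset (Fin m)) (b : Fin m → Rn n → ℂ) (N : Fin m → ℝ≥0)
      (_ : ∀ i, LocallyIntegrable (b i) volume)
      (_ : ∀ i ∈ S, oscNorm (r i) (b i) < N i) (c : Rn n) (l : ℝ) (_ : 0 < l),
      ∫⁻ x in cube c l, ∏ i ∈ S, ‖b i x - ⨍ y in cube c l, b i y‖ₑ ^ p ≤
        C * (∏ i ∈ S, (N i : ℝ≥0∞) ^ p) * volume (cube c l) := by
  obtain ⟨C, hC⟩ := exists_prod_rpow_le r hr hp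
  refine ⟨C * (1 + m), fun S b N hb hN c l hl => ?_⟩
  have hN0 : ∀ i ∈ S, N i ≠ 0 := fun i hi h => by
    have := hN i hi; simp [h] at this
  set β : Fin m → Rn n → ℝ≥0 := fun i x => ‖b i x - ⨍ y in cube c l, b i y‖₊ / N i
  have hβ : ∀ i, AEMeasurable (fun x => expL (r i) (β i x)) (volume.restrict (cube c l)) := by
    intro i
    refine (expL_mono (r i)).measurable.comp_aemeasurable ?_
    exact (((hb i).aestronglyMeasurable.sub aestronglyMeasurable_const).nnnorm.aemeasurable.div_const
      _).restrict
  have h1 : ∀ x, ∏ i ∈ S, ‖b i x - ⨍ y in cube c l, b i y‖ₑ ^ p =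
      (∏ i ∈ S, (N i : ℝ≥0∞) ^ p) * ∏ i ∈ S, (β i x : ℝ≥0∞) ^ p := by
    intro x
    rw [← Finset.prod_mul_distrib]
    refine Finset.prod_congr rfl fun i hi => ?_
    rw [← ENNReal.mul_rpow_of_nonneg _ _ hp, ← ENNReal.coe_mul, mul_div_cancel₀ _ (hN0 i hi)]
    rfl
  simp_rw [h1]
  rw [lintegral_const_mul']
  swap
  · exact ENNReal.prod_ne_top fun i _ => ENNReal.rpow_ne_top_of_nonneg hp ENNReal.coe_ne_top
  calc (∏ i ∈ S, (N i : ℝ≥0∞) ^ p) * ∫⁻ x in cube c l, ∏ i ∈ S, (β i x : ℝ≥0∞) ^ p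
      ≤ (∏ i ∈ S, (N i : ℝ≥0∞) ^ p) *
          ∫⁻ x in cube c l, C * (1 + ∑ i ∈ S, expL (r i) (β i x)) := by
        gcongr with x
        exact hC S fun i => β i x
    _ = (∏ i ∈ S, (N i : ℝ≥0∞) ^ p) *
          (C * (volume (cube c l) + ∑ i ∈ S, ∫⁻ x in cube c l, expL (r i) (β i x))) := by
        rw [lintegral_const_mul' _ _ ENNReal.coe_ne_top, lintegral_add_left measurable_const,
          lintegral_finsetSum' _ fun i _ => hβ i]
        simp
    _ ≤ (∏ i ∈ S, (N i : ℝ≥0∞) ^ p) *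
          (C * (volume (cube c l) + m * volume (cube c l))) := by
        gcongr
        calc ∑ i ∈ S, ∫⁻ x in cube c l, expL (r i) (β i x)
            ≤ ∑ _i ∈ S, volume (cube c l) :=
              Finset.sum_le_sum fun i hi => lintegral_expL_le (hN i hi) c hl
          _ = S.card * volume (cube c l) := by simp
          _ ≤ _ := by
            gcongr
            exact (Finset.card_le_univ S).trans (by simp)
    _ = _ := by push_cast; ring

theorem enorm_setAverage_sub_le {n : ℕ} {E : Type*} [NormedAddCommGroup E] [NormedSpace ℝ E]
    [CompleteSpace E] {b : Rn n → E} {A : Set (Rn n)} (hb : IntegrableOn b A)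
    (hA : volume A ≠ 0) (hA' : volume A ≠ ∞) (a : E) :
    ‖(⨍ y in A, b y) - a‖ₑ ≤ (volume A)⁻¹ * ∫⁻ y in A, ‖b y - a‖ₑ := by
  have h1 : (⨍ y in A, b y) - a = ⨍ y in A, (b y - a) := by
    have : IsFiniteMeasure (volume.restrict A) := ⟨by simpa using hA'.lt_top⟩
    have : NeZero (volume.restrict A) := ⟨by simpa using hA⟩
    rw [average_eq, average_eq, integral_sub hb (integrable_const a), smul_sub, integral_const,
      smul_smul, inv_mul_cancel₀, one_smul]
    rw [measureReal_ne_zero_iff]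
    simpa using hA
  rw [h1, average_eq, enorm_smul]
  gcongr
  · rw [Measure.real, Measure.restrict_apply_univ, Real.enorm_eq_ofReal (by positivity),
      ENNReal.ofReal_inv_of_pos (ENNReal.toReal_pos hA hA'), ENNReal.ofReal_toReal hA']
  · exact enorm_integral_le_lintegral_enorm _

theorem LocallyIntegrable.integrableOn_cube {n : ℕ} {b : Rn n → ℂ}
    (hb : LocallyIntegrable b volume) (c : Rn n) (l : ℝ) : IntegrableOn b (cube c l) :=
  hb.integrableOn_isCompact (isCompact_cube c l)

/-- Telescoping over k doublings. Each doubling costs a mean oscillation over the larger cube,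
multiplied by the volume ratio 2^n. -/
theorem exists_enorm_average_sub_le (r : ℝ) (hr : 1 ≤ r) (n : ℕ) :
    ∃ C : ℝ≥0, ∀ (b : Rn n → ℂ) (N : ℝ≥0) (_ : LocallyIntegrable b volume)
      (_ : oscNorm r b < N) (c : Rn n) (l : ℝ) (_ : 0 < l) (k : ℕ),
      ‖(⨍ y in cube c (2 ^ k * l), b y) - ⨍ y in cube c l, b y‖ₑ ≤ k * (C * N) := by
  obtain ⟨C, hC⟩ := exists_lintegral_osc_le (m := 1) (fun _ => r) (fun _ => hr) zero_le_one n
  refine ⟨C * 2 ^ n, fun b N hb hN c l hl k => ?_⟩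
  induction k with
  | zero => simp
  | succ k ih =>
    set l' := 2 ^ k * l with hl'
    have hl'0 : 0 < l' := by positivity
    have hdbl : (2 : ℝ) ^ (k + 1) * l = 2 * l' := by rw [hl']; ring
    rw [hdbl]
    have hstep : ‖(⨍ y in cube c l', b y) - ⨍ y in cube c (2 * l'), b y‖ₑ ≤ C * 2 ^ n * N := by
      have h := hC {0} (fun _ => b) (fun _ => N) (fun _ => hb) (by simpa using hN) c (2 * l')
        (by positivity)
      simp only [Finset.prod_singleton, ENNReal.rpow_one] at h
      refine (enorm_setAverage_sub_le (LocallyIntegrable.integrableOn_cube hb c l')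
        (volume_cube_pos c hl'0).ne' (volume_cube_ne_top c hl'0) _).trans ?_
      calc (volume (cube c l'))⁻¹ * ∫⁻ y in cube c l', ‖b y - ⨍ y in cube c (2 * l'), b y‖ₑ
          ≤ (volume (cube c l'))⁻¹ * (C * N * (2 ^ n * volume (cube c l'))) := by
            gcongr
            refine (lintegral_mono_set (cube_mono c (by linarith))).trans (h.trans_eq ?_)
            rw [volume_cube_mul c c hl'0 two_pos]
            simp [ENNReal.ofReal_pow]
        _ = C * 2 ^ n * N * (volume (cube c l') * (volume (cube c l'))⁻¹) := by ring
        _ = C * 2 ^ n * N := by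
            rw [ENNReal.mul_inv_cancel (volume_cube_pos c hl'0).ne' (volume_cube_ne_top c hl'0),
              mul_one]
    calc _ = ‖((⨍ y in cube c (2 * l'), b y) - ⨍ y in cube c l', b y) +
              ((⨍ y in cube c l', b y) - ⨍ y in cube c l, b y)‖ₑ := by rw [sub_add_sub_cancel]
      _ ≤ _ := enorm_add_le _ _
      _ ≤ C * 2 ^ n * N + k * ((C * 2 ^ n : ℝ≥0) * N) := by
          gcongr
          rw [← enorm_neg, neg_sub]
          exact hstep
      _ = _ := by push_cast; ring

/-- A function of vanishing oscillation is constant almost everywhere on cubes. -/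
theorem ae_eq_average_of_oscNorm_eq_zero {n : ℕ} {r : ℝ} (hr : 1 ≤ r) {b : Rn n → ℂ}
    (hb : LocallyIntegrable b volume) (h0 : oscNorm r b = 0) (c : Rn n) {l : ℝ} (hl : 0 < l) :
    ∀ᵐ x ∂volume.restrict (cube c l), b x = ⨍ y in cube c l, b y := by
  obtain ⟨C, hC⟩ := exists_lintegral_osc_le (m := 1) (fun _ => r) (fun _ => hr) zero_le_one n
  have hz : ∫⁻ x in cube c l, ‖b x - ⨍ y in cube c l, b y‖ₑ = 0 := by
    -- The oscillation estimate wants a bound strictly above the seminorm; every N > 0 qualifies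
    -- here, and N is then made arbitrarily small.
    have h : ∀ N : ℝ≥0, 0 < N → ∫⁻ x in cube c l, ‖b x - ⨍ y in cube c l, b y‖ₑ ≤
        N * (C * volume (cube c l)) := by
      intro N hN
      have h := hC {0} (fun _ => b) (fun _ => N) (fun _ => hb) (by simp [h0, hN]) c l hl
      simp only [Finset.prod_singleton, ENNReal.rpow_one] at h
      exact h.trans_eq (by ring)
    have hne : C * volume (cube c l) ≠ ∞ :=
      ENNReal.mul_ne_top ENNReal.coe_ne_top (volume_cube_ne_top c hl)
    refine le_antisymm (le_of_forall_gt fun τ hτ => ?_) zero_le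
    obtain ⟨N, hN, hlt⟩ := ENNReal.exists_nnreal_pos_mul_lt hne hτ.ne'
    exact (h N hN).trans_lt hlt
  rw [lintegral_eq_zero_iff'] at hz
  · filter_upwards [hz] with x hx
    simpa [sub_eq_zero] using hx
  · exact (hb.aestronglyMeasurable.sub aestronglyMeasurable_const).restrict.enorm

/-! ### Operators on `L²` as operators on functions -/

theorem applyFun_of_memLp {n : ℕ} (T : L2Op n) {g : Rn n → ℂ} (hg : MemLp g 2 volume) :
    applyFun T g = (T (hg.toLp g) : Rn n → ℂ) := by
  rw [applyFun, dif_pos hg]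

theorem aestronglyMeasurable_applyFun {n : ℕ} (T : L2Op n) (g : Rn n → ℂ) :
    AEStronglyMeasurable (applyFun T g) volume := by
  rw [applyFun]
  split_ifs with h
  · exact Lp.aestronglyMeasurable _
  · exact aestronglyMeasurable_const

theorem applyFun_congr {n : ℕ} (T : L2Op n) {g h : Rn n → ℂ} (hgh : g =ᵐ[volume] h) :
    applyFun T g = applyFun T h := by
  by_cases hg : MemLp g 2 volume
  · have hh : MemLp h 2 volume := hg.ae_eq hgh
    rw [applyFun_of_memLp T hg, applyFun_of_memLp T hh, (MemLp.toLp_eq_toLp_iff hg hh).2 hgh]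
  · have hh : ¬ MemLp h 2 volume := fun hh => hg (hh.ae_eq hgh.symm)
    rw [applyFun, dif_neg hg, applyFun, dif_neg hh]

theorem applyFun_add {n : ℕ} (T : L2Op n) {g h : Rn n → ℂ} (hg : MemLp g 2 volume)
    (hh : MemLp h 2 volume) :
    applyFun T (fun x => g x + h x) =ᵐ[volume] fun x => applyFun T g x + applyFun T h x := by
  have hgh : MemLp (fun x => g x + h x) 2 volume := hg.add hh
  rw [applyFun_of_memLp T hg, applyFun_of_memLp T hh, applyFun_of_memLp T hgh]
  have : hgh.toLp _ = hg.toLp g + hh.toLp h := MemLp.toLp_add hg hh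
  rw [this, map_add]
  exact Lp.coeFn_add _ _

theorem applyFun_const_mul {n : ℕ} (T : L2Op n) {g : Rn n → ℂ} (hg : MemLp g 2 volume) (a : ℂ) :
    applyFun T (fun x => a * g x) =ᵐ[volume] fun x => a * applyFun T g x := by
  have hag : MemLp (fun x => a * g x) 2 volume := hg.const_mul a
  rw [applyFun_of_memLp T hg, applyFun_of_memLp T hag]
  have : hag.toLp _ = a • hg.toLp g := MemLp.toLp_const_smul a hg
  rw [this, map_smul]
  exact Lp.coeFn_smul _ _

theorem applyFun_zero {n : ℕ} (T : L2Op n) : applyFun T (fun _ => 0) =ᵐ[volume] 0 := by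
  have h := applyFun_const_mul T (g := fun _ => 0) MemLp.zero' 0
  simp only [mul_zero, zero_mul] at h
  exact h

theorem eLpNorm_applyFun_le {n : ℕ} (T : L2Op n) {g : Rn n → ℂ} (hg : MemLp g 2 volume) :
    eLpNorm (applyFun T g) 2 volume ≤ ‖T‖ₑ * eLpNorm g 2 volume := by
  rw [applyFun_of_memLp T hg, ← Lp.enorm_def]
  refine (T.le_opENorm _).trans_eq ?_
  rw [Lp.enorm_toLp]

/-- Truncations of `g` converge in `L²`, and along a subsequence their images converge almost
everywhere. -/
theorem exists_subseq_applyFun_indicator {n : ℕ} (T : L2Op n) {g : Rn n → ℂ}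
    (hg : MemLp g 2 volume) {A : ℕ → Set (Rn n)} (hA : ∀ N, MeasurableSet (A N))
    (hlim : ∀ x, g x ≠ 0 → ∀ᶠ N in atTop, x ∈ A N) :
    ∃ ns : ℕ → ℕ, StrictMono ns ∧ ∀ᵐ x, Tendsto
      (fun k => applyFun T ((A (ns k)).indicator g) x) atTop (𝓝 (applyFun T g x)) := by
  have hmem : ∀ N, MemLp ((A N).indicator g) 2 volume := fun N => hg.indicator (hA N)
  have h1 : Tendsto (fun N => (hmem N).toLp _) atTop (𝓝 (hg.toLp g)) := by
    rw [Lp.tendsto_Lp_iff_tendsto_eLpNorm'']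
    have hsq : ∀ N, eLpNorm ((A N).indicator g - g) 2 volume =
        (∫⁻ x, ‖((A N).indicator g - g) x‖ₑ ^ (2 : ℝ)) ^ (1 / 2 : ℝ) := by
      intro N
      rw [eLpNorm_eq_lintegral_rpow_enorm_toReal two_ne_zero ENNReal.ofNat_ne_top]
      simp
    simp_rw [hsq]
    have h0 : Tendsto (fun N => ∫⁻ x, ‖((A N).indicator g - g) x‖ₑ ^ (2 : ℝ)) atTop
        (𝓝 (∫⁻ _ : Rn n, 0)) := by
      refine tendsto_lintegral_of_dominated_convergence' (fun x => ‖g x‖ₑ ^ (2 : ℝ)) ?_ ?_ ?_ ?_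
      · intro N
        exact (((hmem N).sub hg).aestronglyMeasurable.enorm).pow_const _
      · intro N
        refine ae_of_all _ fun x => ?_
        refine ENNReal.rpow_le_rpow ?_ (by norm_num)
        by_cases hx : x ∈ A N <;> simp [hx]
      · have h2 := hg.eLpNorm_lt_top
        rw [eLpNorm_lt_top_iff_lintegral_rpow_enorm_lt_top two_ne_zero ENNReal.ofNat_ne_top] at h2
        simpa using h2.ne
      · refine ae_of_all _ fun x => ?_
        refine tendsto_const_nhds.congr' ?_
        by_cases hx : g x = 0
        · refine Eventually.of_forall fun N => ?_
          by_cases hxN : x ∈ A N <;> simp [hxN, hx]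
        · filter_upwards [hlim x hx] with N hN
          simp [hN]
    have h3 := h0.ennrpow_const (1 / 2 : ℝ)
    simpa using h3
  have h2 : Tendsto (fun N => T ((hmem N).toLp _)) atTop (𝓝 (T (hg.toLp g))) :=
    (T.continuous.tendsto _).comp h1
  -- Convergence in L² implies convergence in measure, which yields an almost everywhere convergent
  -- subsequence.
  obtain ⟨ns, hns, hae⟩ := (tendstoInMeasure_of_tendsto_Lp h2).exists_seq_tendsto_ae
  refine ⟨ns, hns, ?_⟩
  filter_upwards [hae] with x hx
  simpa only [applyFun_of_memLp T hg, applyFun_of_memLp T (hmem _)] using hx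

/-! ### Expansion of commutators -/

theorem aestronglyMeasurable_multiComm {n : ℕ} (T : L2Op n) (bs : List (Rn n → ℂ))
    (hbs : ∀ b ∈ bs, AEStronglyMeasurable b volume) (f : Rn n → ℂ) :
    AEStronglyMeasurable (multiComm T bs f) volume := by
  induction bs generalizing f with
  | nil => exact aestronglyMeasurable_applyFun T f
  | cons b bs ih =>
    have ih' := ih fun b hb => hbs b (List.mem_cons_of_mem _ hb)
    exact ((hbs b List.mem_cons_self).mul (ih' f)).sub (ih' _)

/-- Induction on the set of factors: splitting off b_j - a_j leaves the same product applied to b_j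
f and to f. -/
theorem memLp_prod_sub_mul {n : ℕ} {ι : Type*} [DecidableEq ι] (b : ι → Rn n → ℂ) (a : ι → ℂ)
    (S : Finset ι) (f : Rn n → ℂ)
    (hf : ∀ σ ⊆ S, MemLp (fun x => (∏ i ∈ σ, b i x) * f x) 2 volume) :
    MemLp (fun x => (∏ i ∈ S, (b i x - a i)) * f x) 2 volume := by
  induction S using Finset.induction_on generalizing f with
  | empty => simpa using hf ∅ le_rfl
  | insert j S hj ih =>
    have h1 := ih f fun σ hσ => hf σ (hσ.trans (Finset.subset_insert _ _))
    have h2 := ih (fun x => b j x * f x) fun σ hσ => by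
      have := hf (insert j σ) (Finset.insert_subset_insert _ hσ)
      simp only [Finset.prod_insert fun h => hj (hσ h)] at this
      convert! this using 2 with x
      ring
    have h3 := h2.sub (h1.const_mul (a j))
    convert! h3 using 2 with x
    simp only [Finset.prod_insert hj, Pi.sub_apply]
    ring

/-- The expansion of `T (∏ (b_i - a_i) f)` in commutators, with the symbols taken from a list of
indices. -/
theorem applyFun_prod_sub_mul_list {n : ℕ} {ι : Type*} [DecidableEq ι] (T : L2Op n)
    (b : ι → Rn n → ℂ) (a : ι → ℂ) (I : List ι) (hI : I.Nodup) (f : Rn n → ℂ)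
    (hf : ∀ σ ⊆ I.toFinset, MemLp (fun x => (∏ i ∈ σ, b i x) * f x) 2 volume) :
    applyFun T (fun x => (∏ i ∈ I.toFinset, (b i x - a i)) * f x) =ᵐ[volume]
      fun x => ∑ σ ∈ I.toFinset.powerset, (-1) ^ σ.card *
        (∏ i ∈ I.toFinset \ σ, (b i x - a i)) *
          multiComm T ((I.filter (fun i => i ∈ σ)).map b) f x := by
  induction I generalizing f with
  | nil => simp [multiComm]
  | cons j I ih =>
    have hjI : j ∉ I := (List.nodup_cons.1 hI).1
    have hj : j ∉ I.toFinset := by simpa using hjI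
    have hf1 : ∀ σ ⊆ I.toFinset, MemLp (fun x => (∏ i ∈ σ, b i x) * f x) 2 volume :=
      fun σ hσ => hf σ (hσ.trans (by simp))
    have hf2 : ∀ σ ⊆ I.toFinset,
        MemLp (fun x => (∏ i ∈ σ, b i x) * (b j x * f x)) 2 volume := fun σ hσ => by
      have := hf (insert j σ) (by
        rw [List.toFinset_cons]; exact Finset.insert_subset_insert _ hσ)
      simp only [Finset.prod_insert fun h => hj (hσ h)] at this
      convert! this using 2 with x
      ring
    have h1 := ih (List.nodup_cons.1 hI).2 f hf1
    have h2 := ih (List.nodup_cons.1 hI).2 (fun x => b j x * f x) hf2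
    have m1 := memLp_prod_sub_mul b a I.toFinset f hf1
    have m2 := memLp_prod_sub_mul b a I.toFinset _ hf2
    have h3 := applyFun_add T m2 (m1.const_mul (-a j))
    have h4 := applyFun_const_mul T m1 (-a j)
    -- The factor b_j - a_j is split off, so that the induction hypothesis applies to b_j f and to
    -- f.
    have h5 : (fun x => (∏ i ∈ (j :: I).toFinset, (b i x - a i)) * f x) = fun x =>
        (∏ i ∈ I.toFinset, (b i x - a i)) * (b j x * f x) +
          -a j * ((∏ i ∈ I.toFinset, (b i x - a i)) * f x) := by
      funext x
      rw [List.toFinset_cons, Finset.prod_insert hj]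
      ring
    rw [h5]
    filter_upwards [h1, h2, h3, h4] with x h1 h2 h3 h4
    -- Subsets are grouped into pairs σ, σ ∪ {j}. As j heads the list, the symbol of σ ∪ {j} starts
    -- with b_j, and b_j T_{b_σ} f - T_{b_σ}(b_j f) is the recursive definition of its commutator.
    rw [h3, h4, h1, h2, List.toFinset_cons, Finset.sum_powerset_insert hj, Finset.mul_sum,
      ← Finset.sum_add_distrib, ← Finset.sum_add_distrib]
    refine Finset.sum_congr rfl fun σ hσ => ?_
    have hσ' : σ ⊆ I.toFinset := Finset.mem_powerset.1 hσ
    have hjσ : j ∉ σ := fun h => hj (hσ' h)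
    have e1 : (j :: I).filter (fun i => i ∈ σ) = I.filter (fun i => i ∈ σ) := by
      simp [hjσ]
    have e2 : (j :: I).filter (fun i => i ∈ insert j σ) = j :: I.filter (fun i => i ∈ σ) := by
      rw [List.filter_cons_of_pos (by simp)]
      congr 1
      refine List.filter_congr fun i hi => ?_
      have : i ≠ j := fun h => hjI (h ▸ hi)
      simp [this]
    have e3 : insert j I.toFinset \ σ = insert j (I.toFinset \ σ) :=
      Finset.insert_sdiff_of_notMem _ hjσ
    have e4 : insert j I.toFinset \ insert j σ = I.toFinset \ σ := by
      ext i
      simp only [Finset.mem_sdiff, Finset.mem_insert]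
      by_cases hij : i = j
      · subst hij; simp [hjI]
      · simp [hij]
    rw [e1, e2, e3, e4, Finset.card_insert_of_notMem hjσ,
      Finset.prod_insert (by simp [hjI] : j ∉ I.toFinset \ σ)]
    simp only [List.map_cons, multiComm]
    ring

theorem applyFun_prod_sub_mul {n m : ℕ} (T : L2Op n) (b : Fin m → Rn n → ℂ) (a : Fin m → ℂ)
    (f : Rn n → ℂ) (hf : InDomain b f) :
    applyFun T (fun x => (∏ i, (b i x - a i)) * f x) =ᵐ[volume]
      fun x => ∑ σ : Finset (Fin m), (-1) ^ σ.card * (∏ i ∈ σᶜ, (b i x - a i)) *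
          multiComm T (subSymbol b σ) f x := by
  have h := applyFun_prod_sub_mul_list T b a (List.finRange m) (List.nodup_finRange m) f
    fun σ _ => hf σ
  simpa [Finset.compl_eq_univ_sdiff, subSymbol] using h

theorem subSymbol_univ {n m : ℕ} (b : Fin m → Rn n → ℂ) :
    subSymbol b Finset.univ = List.ofFn b := by
  simp [subSymbol, List.ofFn_eq_map]

/-- Pointwise control of the commutator of top order by those of lower order. -/
theorem enorm_multiComm_sub_le {n m : ℕ} (T : L2Op n) (b : Fin m → Rn n → ℂ) (a : Fin m → ℂ)
    (f : Rn n → ℂ) (hf : InDomain b f) (A : Set (Rn n)) (hA : MeasurableSet A) (z : ℂ) :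
    ∀ᵐ x, ‖multiComm T (List.ofFn b) f x - (-1) ^ m * z‖ₑ ≤
      ‖applyFun T (A.indicator fun x => (∏ i, (b i x - a i)) * f x) x‖ₑ +
      ‖applyFun T (Aᶜ.indicator fun x => (∏ i, (b i x - a i)) * f x) x - z‖ₑ +
      ∑ σ ∈ Finset.univ.filter (fun σ : Finset (Fin m) => σ.card < m),
        (∏ i ∈ σᶜ, ‖b i x - a i‖ₑ) * ‖multiComm T (subSymbol b σ) f x‖ₑ := by
  have hg := memLp_prod_sub_mul b a Finset.univ f fun σ _ => hf σ
  have h1 := applyFun_prod_sub_mul T b a f hf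
  have h2 := applyFun_add T (hg.indicator hA) (hg.indicator hA.compl)
  have h3 : (fun x => A.indicator (fun x => (∏ i, (b i x - a i)) * f x) x +
      Aᶜ.indicator (fun x => (∏ i, (b i x - a i)) * f x) x) =
      fun x => (∏ i, (b i x - a i)) * f x := Set.indicator_self_add_compl A _
  rw [h3] at h2
  filter_upwards [h1, h2] with x h1 h2
  set u := applyFun T (A.indicator fun x => (∏ i, (b i x - a i)) * f x) x
  set v := applyFun T (Aᶜ.indicator fun x => (∏ i, (b i x - a i)) * f x) x
  have huniv : (Finset.univ : Finset (Finset (Fin m))).filter (fun σ => ¬ σ.card < m) =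
      {Finset.univ} := by
    ext σ
    simp only [Finset.mem_filter, Finset.mem_univ, true_and, Finset.mem_singleton, not_lt]
    rw [← Finset.card_eq_iff_eq_univ, Fintype.card_fin]
    have := (Finset.card_le_univ σ).trans_eq (Fintype.card_fin m)
    omega
  rw [← Finset.sum_filter_add_sum_filter_not _ (fun σ : Finset (Fin m) => σ.card < m), huniv,
    Finset.sum_singleton, subSymbol_univ, h2] at h1
  simp only [Finset.card_univ, Fintype.card_fin, Finset.compl_univ, Finset.prod_empty,
    mul_one] at h1
  set s := ∑ σ ∈ Finset.univ.filter (fun σ : Finset (Fin m) => σ.card < m), (-1) ^ σ.card *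
    (∏ i ∈ σᶜ, (b i x - a i)) * multiComm T (subSymbol b σ) f x with hs
  have hsgn : ((-1 : ℂ) ^ m) * (-1) ^ m = 1 := by rw [← mul_pow]; simp
  -- The term of top order carries the sign (-1)^m, whose square is 1; this is why the comparison
  -- constant is (-1)^m z.
  have h4 : multiComm T (List.ofFn b) f x - (-1) ^ m * z = (-1) ^ m * (u + (v - z) - s) := by
    calc _ = ((-1 : ℂ) ^ m * (-1) ^ m) * multiComm T (List.ofFn b) f x - (-1) ^ m * z := by
          rw [hsgn, one_mul]
      _ = _ := by linear_combination (-1 : ℂ) ^ m * (-h1)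
  have hone : ∀ k : ℕ, ‖(-1 : ℂ) ^ k‖ₑ = 1 := fun k => by
    rw [enorm_pow, enorm_neg, enorm_one, one_pow]
  rw [h4, enorm_mul, hone, one_mul]
  refine (enorm_sub_le).trans ?_
  gcongr
  · exact enorm_add_le _ _
  · refine (enorm_sum_le _ _).trans (Finset.sum_le_sum fun σ _ => ?_)
    rw [enorm_mul, enorm_mul, hone, one_mul]
    gcongr
    simp only [enorm_eq_nnnorm, nnnorm_prod]
    push_cast
    rfl

/-! ### Kernels -/

/-- The map y ↦ x - y preserves null sets, so the representation sees only the class of K modulo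
null sets. With `MemH.congr` this allows K to be replaced by a Borel function. -/
theorem HasKernel.congr {n : ℕ} {T : L2Op n} {K K' : Rn n → ℂ} (h : HasKernel T K)
    (hK : K =ᵐ[volume] K') : HasKernel T K' where
  measurable := h.measurable.congr hK
  repr f hf hc := by
    filter_upwards [h.repr f hf hc] with x hx hxf
    have hae : (fun y => K (x - y) * f y) =ᵐ[volume] fun y => K' (x - y) * f y := by
      have := (Measure.measurePreserving_sub_left volume x).quasiMeasurePreserving.ae_eq_comp hK
      filter_upwards [this] with y hy
      simp only [Function.comp_apply] at hy
      rw [hy]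
    obtain ⟨h1, h2⟩ := hx hxf
    exact ⟨h1.congr hae, by rw [h2, integral_congr_ae hae]⟩

theorem MemH.congr {n m : ℕ} {φ : ℝ≥0 → ℝ≥0∞} {K K' : Rn n → ℂ} (h : MemH φ m K)
    (hK : K =ᵐ[volume] K') : MemH φ m K' := by
  obtain ⟨c, A, hc, hA⟩ := h
  refine ⟨c, A, hc, fun y R hR => ?_⟩
  refine le_of_eq_of_le ?_ (hA y R hR)
  have hae : (fun x => K (x - y) - K x) =ᵐ[volume] fun x => K' (x - y) - K' x := by
    have := (measurePreserving_sub_right volume y).quasiMeasurePreserving.ae_eq_comp hK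
    filter_upwards [this, hK] with x h1 h2
    simp only [Function.comp_apply] at h1
    rw [h1, h2]
  have hlux : ∀ s : ℝ, luxAnnulus φ s (fun x => K' (x - y) - K' x) =
      luxAnnulus φ s (fun x => K (x - y) - K x) := by
    intro s
    have : ∀ lam : ℝ≥0, ∫⁻ x in Metric.ball 0 (2 * s), φ (‖(annulus n s).indicator
          (fun x => K' (x - y) - K' x) x‖₊ / lam) = ∫⁻ x in Metric.ball 0 (2 * s),
          φ (‖(annulus n s).indicator (fun x => K (x - y) - K x) x‖₊ / lam) := by
      intro lam
      refine lintegral_congr_ae (ae_restrict_of_ae ?_)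
      filter_upwards [hae] with x hx
      by_cases hxs : x ∈ annulus n s <;> simp [hxs, hx]
    simp only [luxAnnulus, luxemburg, this]
  simp_rw [hlux]

/-- Turns a bound for each admissible lam into one for the infimum. The conditions 0 ≠ D ≠ ∞ let
multiplication by D commute with the infimum, also when it runs over the empty set. -/
theorem le_mul_luxemburg {n : ℕ} {φ : ℝ≥0 → ℝ≥0∞} {A : Set (Rn n)} (hA : volume A ≠ 0)
    (hA' : volume A ≠ ∞) {f : Rn n → ℂ} {D X : ℝ≥0∞} (hD : D ≠ 0) (hD' : D ≠ ∞)
    (h : ∀ lam : ℝ≥0, 0 < lam → ∫⁻ x in A, φ (‖f x‖₊ / lam) ≤ volume A → X ≤ D * lam) :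
    X ≤ D * luxemburg φ A f := by
  rw [luxemburg, ENNReal.mul_iInf_of_ne hD hD']
  refine le_iInf fun lam => ?_
  rw [ENNReal.mul_iInf_of_ne hD hD']
  refine le_iInf fun hlam => h lam hlam.1 ?_
  calc ∫⁻ x in A, φ (‖f x‖₊ / lam)
      = volume A * ((volume A)⁻¹ * ∫⁻ x in A, φ (‖f x‖₊ / lam)) := by
        rw [← mul_assoc, ENNReal.mul_inv_cancel hA hA', one_mul]
    _ ≤ volume A * 1 := by gcongr; exact hlam.2
    _ = volume A := mul_one _

theorem measurableSet_annulus (n : ℕ) (s : ℝ) : MeasurableSet (annulus n s) :=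
  (measurableSet_lt measurable_const measurable_norm).inter
    (measurableSet_le measurable_norm measurable_const)

/-- The annulus contains its outer sphere while the ball in `luxAnnulus` is open; the sphere is a
null set. -/
theorem annulus_ae_eq_inter_ball (n : ℕ) {s : ℝ} (hs : 0 < s) :
    annulus n s =ᵐ[volume] (annulus n s ∩ Metric.ball 0 (2 * s) : Set (Rn n)) := by
  have h : volume (Metric.sphere (0 : Rn n) (2 * s)) = 0 :=
    Measure.addHaar_sphere_of_ne_zero _ _ (by positivity)
  have h' : ∀ᵐ x : Rn n, x ∉ Metric.sphere (0 : Rn n) (2 * s) := measure_eq_zero_iff_ae_notMem.1 h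
  refine Filter.eventuallyEq_set.2 ?_
  filter_upwards [h'] with x hx
  simp only [mem_sphere_zero_iff_norm] at hx
  simp only [annulus, Set.mem_inter_iff, Set.mem_ofPred_eq, mem_ball_zero_iff]
  constructor
  · exact fun h => ⟨h, lt_of_le_of_ne h.2 hx⟩
  · exact fun h => h.1

theorem subset_iUnion_annulus {n : ℕ} {R : ℝ} (hR : 0 < R) :
    {x : Rn n | 2 * R < ‖x‖} ⊆ ⋃ k : ℕ, annulus n (2 ^ (k + 1) * R) := by
  intro x hx
  have hx' : 2 * R < ‖x‖ := hx
  have hex : ∃ k : ℕ, ‖x‖ ≤ 2 * (2 ^ (k + 1) * R) := by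
    obtain ⟨k, hk⟩ := pow_unbounded_of_one_lt (‖x‖ / R) (one_lt_two (α := ℝ))
    refine ⟨k, ?_⟩
    rw [div_lt_iff₀ hR] at hk
    have : 0 ≤ (2 : ℝ) ^ k * R := by positivity
    rw [pow_succ]
    linarith
  refine Set.mem_iUnion.2 ⟨Nat.find hex, ?_, Nat.find_spec hex⟩
  rcases h : Nat.find hex with _ | k
  · simpa using hx'
  · have := Nat.find_min hex (m := k) (by omega)
    push Not at this
    calc (2 : ℝ) ^ (k + 1 + 1) * R = 2 * (2 ^ (k + 1) * R) := by ring
      _ < ‖x‖ := this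

theorem volume_ball_two_mul {n : ℕ} {s : ℝ} (hs : 0 < s) :
    volume (Metric.ball (0 : Rn n) (2 * s)) =
      ENNReal.ofReal (s ^ n) * volume (Metric.ball (0 : Rn n) 2) := by
  rw [mul_comm 2 s, Measure.addHaar_ball_mul_of_pos _ _ hs]
  simp

/-- The integral form of the Hörmander condition. -/
theorem MemH.exists_lintegral_le {n m : ℕ} {φ : ℝ≥0 → ℝ≥0∞} (hφ : IsYoung φ) {K : Rn n → ℂ}
    (hKm : Measurable K) (hK : MemH φ m K) :
    ∃ (c : ℝ) (B : ℝ≥0), 1 ≤ c ∧ ∀ (y : Rn n) (R : ℝ), c * ‖y‖ < R →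
      ∫⁻ x in {x | 2 * R < ‖x‖}, ‖K (x - y) - K x‖ₑ ≤ B := by
  obtain ⟨c, A, hc, hA⟩ := hK
  obtain ⟨C, hC⟩ := hφ.exists_le_mul
  have hC0 : C ≠ 0 := by
    rintro rfl
    have := hC 1
    simp at this
  have hv : volume (Metric.ball (0 : Rn n) 2) ≠ ∞ := measure_ball_lt_top.ne
  have hv0 : volume (Metric.ball (0 : Rn n) 2) ≠ 0 := (Metric.measure_ball_pos _ _ two_pos).ne'
  refine ⟨c, C * 2 * (volume (Metric.ball (0 : Rn n) 2)).toNNReal * A, hc, fun y R hR => ?_⟩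
  have hR0 : 0 < R := lt_of_le_of_lt (by positivity) hR
  set h : Rn n → ℂ := fun x => K (x - y) - K x with hh
  have hhm : Measurable h := (hKm.comp (measurable_id.sub_const y)).sub hKm
  have hstep : ∀ s : ℝ, 0 < s → ∫⁻ x in annulus n s, ‖h x‖ₑ ≤
      (C * 2 * (ENNReal.ofReal (s ^ n) * volume (Metric.ball (0 : Rn n) 2))) *
        luxAnnulus φ s h := by
    intro s hs
    rw [← volume_ball_two_mul hs]
    have hb : volume (Metric.ball (0 : Rn n) (2 * s)) ≠ ∞ := measure_ball_lt_top.ne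
    have hb0 : volume (Metric.ball (0 : Rn n) (2 * s)) ≠ 0 :=
      (Metric.measure_ball_pos _ _ (by positivity)).ne'
    refine le_mul_luxemburg hb0 hb
      (mul_ne_zero (mul_ne_zero (by exact_mod_cast hC0) two_ne_zero) hb0)
      (ENNReal.mul_ne_top (by finiteness) hb) fun lam hlam hle => ?_
    calc ∫⁻ x in annulus n s, ‖h x‖ₑ
        = ∫⁻ x in annulus n s ∩ Metric.ball 0 (2 * s), ‖h x‖ₑ :=
          setLIntegral_congr (annulus_ae_eq_inter_ball n hs)
      _ = ∫⁻ x in Metric.ball 0 (2 * s), (annulus n s).indicator (fun x => ‖h x‖ₑ) x := by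
          rw [lintegral_indicator (measurableSet_annulus n s), Measure.restrict_restrict
            (measurableSet_annulus n s)]
      -- At least linear growth of φ bounds the integral of |h| by the modular. The constant 1 and
      -- the modular each contribute the volume of the ball, whence the factor 2.
      _ ≤ ∫⁻ x in Metric.ball 0 (2 * s),
            lam * (C * (1 + φ (‖(annulus n s).indicator h x‖₊ / lam))) := by
          refine lintegral_mono fun x => ?_
          have h1 : (annulus n s).indicator (fun x => ‖h x‖ₑ) x =
              ‖(annulus n s).indicator h x‖ₑ := by
            by_cases hx : x ∈ annulus n s <;> simp [hx]
          rw [h1]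
          calc ‖(annulus n s).indicator h x‖ₑ
              = lam * ((‖(annulus n s).indicator h x‖₊ / lam : ℝ≥0) : ℝ≥0∞) := by
                rw [← ENNReal.coe_mul, mul_div_cancel₀ _ hlam.ne']; rfl
            _ ≤ _ := by gcongr; exact hC _
      _ = lam * (C * (volume (Metric.ball (0 : Rn n) (2 * s)) + ∫⁻ x in Metric.ball 0 (2 * s),
            φ (‖(annulus n s).indicator h x‖₊ / lam))) := by
          rw [lintegral_const_mul' _ _ ENNReal.coe_ne_top,
            lintegral_const_mul' _ _ ENNReal.coe_ne_top, lintegral_add_left measurable_const]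
          simp
      _ ≤ lam * (C * (volume (Metric.ball (0 : Rn n) (2 * s)) +
            volume (Metric.ball (0 : Rn n) (2 * s)))) := by gcongr
      _ = _ := by ring
  calc ∫⁻ x in {x | 2 * R < ‖x‖}, ‖h x‖ₑ
      ≤ ∫⁻ x in ⋃ k : ℕ, annulus n (2 ^ (k + 1) * R), ‖h x‖ₑ :=
        lintegral_mono_set (subset_iUnion_annulus hR0)
    _ ≤ ∑' k : ℕ, ∫⁻ x in annulus n (2 ^ (k + 1) * R), ‖h x‖ₑ := lintegral_iUnion_le _ _
    _ ≤ ∑' k : ℕ, (C * 2 * volume (Metric.ball (0 : Rn n) 2)) *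
          (ENNReal.ofReal ((2 ^ (k + 1) * R) ^ n) * ((k + 1 : ℕ) : ℝ≥0∞) ^ m *
            luxAnnulus φ (2 ^ (k + 1) * R) h) := by
        refine ENNReal.tsum_le_tsum fun k => (hstep _ (by positivity)).trans ?_
        -- The weight k^m is at least 1 and is simply discarded: only the case m = 0 of the
        -- condition is needed here.
        have h1 : (1 : ℝ≥0∞) ≤ ((k + 1 : ℕ) : ℝ≥0∞) ^ m :=
          one_le_pow₀ (by exact_mod_cast Nat.succ_le_succ (Nat.zero_le k))
        calc _ = (C * 2 * volume (Metric.ball (0 : Rn n) 2)) *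
              (ENNReal.ofReal ((2 ^ (k + 1) * R) ^ n) * 1 *
                luxAnnulus φ (2 ^ (k + 1) * R) h) := by ring
          _ ≤ _ := by gcongr
    _ ≤ (C * 2 * volume (Metric.ball (0 : Rn n) 2)) * A := by
        rw [ENNReal.tsum_mul_left]
        gcongr
        exact hA y R hR
    _ = _ := by
        push_cast
        rw [ENNReal.coe_toNNReal hv]

/-! ### Hölder's inequality for the symbols -/

/-- The integrated Hölder inequality on the k-th dilate of a cube, with the averages of the symbols
still taken over the original cube. This mismatch produces (k + 1)^m. -/
theorem exists_lintegral_mul_prod_le {m : ℕ} (r : Fin m → ℝ) (hr : ∀ i, 1 ≤ r i) (r₀ : ℝ)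
    (hr₀ : 1 / r₀ = ∑ i, 1 / r i) (η φ : ℝ≥0 → ℝ≥0∞) (hφ : IsYoung φ)
    (hηφ : ∃ A : ℝ≥0, ∀ t : ℝ, Real.exp 1 ≤ t →
      genInv (complementary η) (ENNReal.ofReal t) * genInv φ (ENNReal.ofReal t) *
        ENNReal.ofReal (Real.log t ^ (1 / r₀)) ≤ A * ENNReal.ofReal t) (n : ℕ) :
    ∃ C : ℝ≥0, C ≠ 0 ∧ ∀ (b : Fin m → Rn n → ℂ) (N : Fin m → ℝ≥0)
      (_ : ∀ i, LocallyIntegrable (b i) volume) (_ : ∀ i, oscNorm (r i) (b i) < N i)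
      (f : Rn n → ℂ) (_ : AEStronglyMeasurable f volume) (lam : ℝ≥0)
      (c : Rn n) (L : ℝ) (_ : 0 < L) (k : ℕ)
      (_ : luxemburg (complementary η) (cube c (2 ^ k * L)) f < lam)
      (E : Set (Rn n)) (_ : E ⊆ cube c (2 ^ k * L)) (H : Rn n → ℝ≥0) (_ : Measurable H)
      (_ : ∫⁻ y in E, φ (H y) ≤ volume (cube c (2 ^ k * L))),
      ∫⁻ y in E, H y * (‖f y‖ₑ * ∏ i, ‖b i y - ⨍ x in cube c L, b i x‖ₑ) ≤
        C * ((k + 1 : ℕ) : ℝ≥0∞) ^ m * (lam * ∏ i, (N i : ℝ≥0∞)) *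
          volume (cube c (2 ^ k * L)) := by
  obtain ⟨C₁, hC₁⟩ := exists_mul_prod_le r hr r₀ hr₀ η φ hφ hηφ
  choose D hD using fun i => exists_enorm_average_sub_le (r i) (hr i) n
  set D' := ∑ i, D i with hD'
  -- The constant 1, φ(H), η̄(u) and the m exponential terms each integrate to at most the volume of
  -- the cube, which gives 3 + m. The final 1 makes the constant nonzero.
  refine ⟨C₁ * (1 + D') ^ m * (3 + m) + 1, by positivity, ?_⟩
  intro b N hb hN f hf lam c L hL k hlam E hE H hHm hH
  have hL' : 0 < 2 ^ k * L := by positivity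
  have hlam0 : lam ≠ 0 := by rintro rfl; simp at hlam
  have hN0 : ∀ i, N i ≠ 0 := fun i h => by have := hN i; simp [h] at this
  set Q := cube c (2 ^ k * L) with hQ
  set β : Fin m → Rn n → ℝ≥0 := fun i y => ‖b i y - ⨍ x in Q, b i x‖₊ / N i with hβdef
  set u : Rn n → ℝ≥0 := fun y => ‖f y‖₊ / lam with hu
  have hβ : ∀ i, AEMeasurable (fun x => expL (r i) (β i x)) volume := by
    intro i
    refine (expL_mono (r i)).measurable.comp_aemeasurable ?_
    exact ((hb i).aestronglyMeasurable.sub aestronglyMeasurable_const).nnnorm.aemeasurable.div_const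
      _
  have hum : AEMeasurable (fun y => complementary η (u y)) volume :=
    (complementary_mono η).measurable.comp_aemeasurable (hf.nnnorm.aemeasurable.div_const _)
  have hHm' : Measurable fun y => φ (H y) := hφ.strictMono.monotone.measurable.comp hHm
  -- A bound, after normalization by N i, for the drift of the averages over k doublings, uniform in
  -- i.
  set κ : ℝ≥0 := k * D' with hκ
  have hpt : ∀ i y, ‖b i y - ⨍ x in cube c L, b i x‖ₑ ≤ N i * ((β i y + κ : ℝ≥0) : ℝ≥0∞) := by
    intro i y
    calc ‖b i y - ⨍ x in cube c L, b i x‖ₑ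
        = ‖(b i y - ⨍ x in Q, b i x) + ((⨍ x in Q, b i x) - ⨍ x in cube c L, b i x)‖ₑ := by
          rw [sub_add_sub_cancel]
      _ ≤ ‖b i y - ⨍ x in Q, b i x‖ₑ + ‖(⨍ x in Q, b i x) - ⨍ x in cube c L, b i x‖ₑ :=
          enorm_add_le _ _
      _ ≤ N i * (β i y : ℝ≥0∞) + k * (D i * N i) := by
          gcongr
          · rw [← ENNReal.coe_mul, hβdef, mul_div_cancel₀ _ (hN0 i)]; rfl
          · exact hD i (b i) (N i) (hb i) (hN i) c L hL k
      _ ≤ N i * (β i y : ℝ≥0∞) + k * (D' * N i) := by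
          gcongr
          exact Finset.single_le_sum (f := D) (fun _ _ => zero_le) (Finset.mem_univ i)
      _ = _ := by rw [hκ]; push_cast; ring
  have hκ' : 1 + κ ≤ (1 + D') * ((k + 1 : ℕ) : ℝ≥0) := by
    rw [hκ]
    push_cast
    calc 1 + (k : ℝ≥0) * D' ≤ 1 + k * D' + (k + D') := le_self_add
      _ = _ := by ring
  calc ∫⁻ y in E, H y * (‖f y‖ₑ * ∏ i, ‖b i y - ⨍ x in cube c L, b i x‖ₑ)
      ≤ ∫⁻ y in E, (lam * ∏ i, (N i : ℝ≥0∞)) * (C₁ * (1 + κ : ℝ≥0) ^ m *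
          (1 + (φ (H y) + complementary η (u y) + ∑ i, expL (r i) (β i y)))) := by
        refine lintegral_mono fun y => ?_
        calc (H y : ℝ≥0∞) * (‖f y‖ₑ * ∏ i, ‖b i y - ⨍ x in cube c L, b i x‖ₑ)
            ≤ H y * ((lam * (u y : ℝ≥0∞)) * ∏ i, (N i * ((β i y + κ : ℝ≥0) : ℝ≥0∞))) := by
              gcongr with i
              · rw [← ENNReal.coe_mul, hu, mul_div_cancel₀ _ hlam0]; rfl
              · exact hpt i y
          _ = (lam * ∏ i, (N i : ℝ≥0∞)) *
                (H y * u y * ∏ i, ((β i y + κ : ℝ≥0) : ℝ≥0∞)) := by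
              rw [Finset.prod_mul_distrib]; ring
          _ ≤ _ := by
              exact mul_le_mul' le_rfl (hC₁ κ (H y) (u y) fun i => β i y)
    _ = (lam * ∏ i, (N i : ℝ≥0∞)) * (C₁ * (1 + κ : ℝ≥0) ^ m *
          (volume E + ((∫⁻ y in E, φ (H y)) + (∫⁻ y in E, complementary η (u y)) +
            ∑ i, ∫⁻ y in E, expL (r i) (β i y)))) := by
        rw [lintegral_const_mul' _ _ (ENNReal.mul_ne_top ENNReal.coe_ne_top
            (ENNReal.prod_ne_top fun i _ => ENNReal.coe_ne_top)),
          lintegral_const_mul' _ _ (by finiteness), lintegral_add_left measurable_const,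
          lintegral_add_right' _ (Finset.aemeasurable_fun_sum _ fun i _ => (hβ i).restrict),
          lintegral_add_left hHm', lintegral_finsetSum' _ fun i _ => (hβ i).restrict]
        simp
    _ ≤ (lam * ∏ i, (N i : ℝ≥0∞)) * (C₁ * ((1 + D') * ((k + 1 : ℕ) : ℝ≥0) : ℝ≥0) ^ m *
          (volume Q + (volume Q + volume Q + ∑ _i : Fin m, volume Q))) := by
        gcongr with i
        · refine (lintegral_mono_set hE).trans ?_
          exact lintegral_le_of_luxemburg_lt (complementary_mono η) (volume_cube_pos c hL').ne'
            (volume_cube_ne_top c hL') hlam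
        · exact (lintegral_mono_set hE).trans (lintegral_expL_le (hN i) c hL')
    _ = (C₁ * (1 + D') ^ m * (3 + m) : ℝ≥0) * ((k + 1 : ℕ) : ℝ≥0∞) ^ m *
          (lam * ∏ i, (N i : ℝ≥0∞)) * volume Q := by
        rw [Finset.sum_const, Finset.card_univ, Fintype.card_fin, nsmul_eq_mul]
        push_cast
        rw [mul_pow]
        ring
    _ ≤ _ := by
        gcongr
        exact le_self_add

/-! ### The part of the operator away from a cube -/

/-- The complement of the dilated cube is covered by dyadic annuli centred at w. On each of them
Hölder's inequality bounds the integral by one term of the series in the Hörmander condition for the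
translation w - z. -/
theorem exists_lintegral_compl_cube_le {m : ℕ} (r : Fin m → ℝ) (hr : ∀ i, 1 ≤ r i) (r₀ : ℝ)
    (hr₀ : 1 / r₀ = ∑ i, 1 / r i) (η φ : ℝ≥0 → ℝ≥0∞) (hφ : IsYoung φ)
    (hηφ : ∃ A : ℝ≥0, ∀ t : ℝ, Real.exp 1 ≤ t →
      genInv (complementary η) (ENNReal.ofReal t) * genInv φ (ENNReal.ofReal t) *
        ENNReal.ofReal (Real.log t ^ (1 / r₀)) ≤ A * ENNReal.ofReal t) {n : ℕ}
    {K : Rn n → ℂ} (hKm : Measurable K) (hK : MemH φ m K) :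
    ∃ (ρ : ℝ) (C : ℝ≥0), 1 ≤ ρ ∧ ∀ (b : Fin m → Rn n → ℂ) (N : Fin m → ℝ≥0)
      (_ : ∀ i, LocallyIntegrable (b i) volume) (_ : ∀ i, oscNorm (r i) (b i) < N i)
      (f : Rn n → ℂ) (_ : AEStronglyMeasurable f volume) (lam : ℝ≥0)
      (c : Rn n) (l : ℝ) (_ : 0 < l)
      (_ : ∀ k : ℕ, luxemburg (complementary η) (cube c (2 ^ k * ((2 * ρ + 1) * l))) f < lam)
      (z w : Rn n) (_ : z ∈ cube c l) (_ : w ∈ cube c l),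
      ∫⁻ y in (cube c ((2 * ρ + 1) * l))ᶜ, ‖K (z - y) - K (w - y)‖ₑ *
        (‖f y‖ₑ * ∏ i, ‖b i y - ⨍ x in cube c ((2 * ρ + 1) * l), b i x‖ₑ) ≤
        C * (lam * ∏ i, (N i : ℝ≥0∞)) := by
  obtain ⟨C, hC0, hC⟩ := exists_lintegral_mul_prod_le r hr r₀ hr₀ η φ hφ hηφ n
  obtain ⟨cH, A, hcH, hA⟩ := hK
  -- Two points of the cube are at distance at most 2 √n l, so with R = ρ l the requirement c |w -
  -- z| < R holds. The dilate has half side 2R + l, so points outside it are farther than 2R from w.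
  have hρ : 1 ≤ cH * (√n * 2) + 1 := by
    have : 0 ≤ cH * (√n * 2) := by positivity
    linarith
  -- The 2^m absorbs the passage from (k + 2)^m to (k + 1)^m. The 6^n compares the volume of the
  -- cube of half side 2^(k+1) L with s^n, as L ≤ 3R and s = 2^(k+1) R.
  refine ⟨cH * (√n * 2) + 1, C * 2 ^ m * 6 ^ n * A, hρ, ?_⟩
  set ρ := cH * (√n * 2) + 1 with hρdef
  intro b N hb hN f hf lam c l hl hlam z w hz hw
  set L := (2 * ρ + 1) * l with hLdef
  set R := ρ * l with hRdef
  have hR0 : 0 < R := by positivity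
  have hL0 : 0 < L := by positivity
  have hLR : L = 2 * R + l := by rw [hLdef, hRdef]; ring
  have hlR : l ≤ R := by rw [hRdef]; nlinarith
  have hlam0 : lam ≠ 0 := by rintro rfl; simpa using hlam 0
  have hN0 : ∀ i, N i ≠ 0 := fun i h => by have := hN i; simp [h] at this
  have hv : cH * ‖w - z‖ < R := by
    calc cH * ‖w - z‖ ≤ cH * (√n * (2 * l)) := by
          gcongr; exact norm_sub_le_of_mem_cube hl.le hw hz
      _ < R := by rw [hRdef, hρdef]; nlinarith
  set h : Rn n → ℂ := fun x => K (x - (w - z)) - K x with hh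
  set g : Rn n → ℝ≥0∞ := fun y => ‖f y‖ₑ * ∏ i, ‖b i y - ⨍ x in cube c L, b i x‖ₑ with hg
  have hhy : ∀ y, h (w - y) = K (z - y) - K (w - y) := fun y => by
    simp only [hh]
    congr 2
    abel
  have hsub : (cube c L)ᶜ ⊆ ⋃ k : ℕ, (fun y => w - y) ⁻¹' annulus n (2 ^ (k + 1) * R) := by
    intro y hy
    have : 2 * R < ‖w - y‖ := by
      simp only [cube, Set.mem_compl_iff, Set.mem_ofPred_eq, not_forall, not_le] at hy
      obtain ⟨i, hi⟩ := hy
      have h1 := hw i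
      have h2 := abs_coord_le_norm (w - y) i
      simp only [PiLp.sub_apply] at h2
      have h3 : |y i - c i| ≤ |w i - y i| + |w i - c i| := by
        rw [abs_sub_comm (w i) (y i)]
        calc |y i - c i| = |(y i - w i) + (w i - c i)| := by ring_nf
          _ ≤ _ := abs_add_le _ _
      linarith
    rw [← Set.preimage_iUnion]
    exact subset_iUnion_annulus hR0 this
  have hstep : ∀ k : ℕ, ∫⁻ y in (fun y => w - y) ⁻¹' annulus n (2 ^ (k + 1) * R),
      ‖K (z - y) - K (w - y)‖ₑ * g y ≤ (C * 2 ^ m * 6 ^ n * (lam * ∏ i, (N i : ℝ≥0∞)) *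
        (ENNReal.ofReal ((2 ^ (k + 1) * R) ^ n) * ((k + 1 : ℕ) : ℝ≥0∞) ^ m)) *
          luxAnnulus φ (2 ^ (k + 1) * R) h := by
    intro k
    set s := 2 ^ (k + 1) * R with hs
    have hs0 : 0 < s := by positivity
    have hpow : (1 : ℝ) ≤ 2 ^ (k + 1) := one_le_pow₀ (by norm_num)
    have hb0 : volume (Metric.ball (0 : Rn n) (2 * s)) ≠ 0 :=
      (Metric.measure_ball_pos _ _ (by positivity)).ne'
    refine le_mul_luxemburg hb0 measure_ball_lt_top.ne ?_ ?_ fun μ hμ hle => ?_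
    · refine mul_ne_zero (mul_ne_zero ?_ (mul_ne_zero ?_ ?_)) (mul_ne_zero ?_ ?_)
      · have : C * 2 ^ m * 6 ^ n ≠ 0 := by positivity
        exact_mod_cast this
      · exact_mod_cast hlam0
      · exact Finset.prod_ne_zero_iff.2 fun i _ => by exact_mod_cast hN0 i
      · have : 0 < s ^ n := by positivity
        simpa using this
      · exact pow_ne_zero _ (by exact_mod_cast Nat.succ_ne_zero k)
    · have : ∏ i, (N i : ℝ≥0∞) ≠ ∞ := ENNReal.prod_ne_top fun i _ => ENNReal.coe_ne_top
      exact ENNReal.mul_ne_top (ENNReal.mul_ne_top (by finiteness)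
        (ENNReal.mul_ne_top ENNReal.coe_ne_top this)) (by finiteness)
    set E : Set (Rn n) := (fun y => w - y) ⁻¹' (annulus n s ∩ Metric.ball 0 (2 * s)) with hE
    set H : Rn n → ℝ≥0 := fun y => ‖K (z - y) - K (w - y)‖₊ / μ with hH
    have hHm : Measurable H :=
      ((hKm.comp (measurable_id.const_sub z)).sub
        (hKm.comp (measurable_id.const_sub w))).nnnorm.div_const _
    have hEm : MeasurableSet (annulus n s ∩ Metric.ball (0 : Rn n) (2 * s)) :=
      (measurableSet_annulus n s).inter measurableSet_ball
    have hEQ : E ⊆ cube c (2 ^ (k + 1) * L) := by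
      intro y hy i
      have h1 : ‖w - y‖ ≤ 2 * s := hy.1.2
      have h2 := abs_coord_le_norm (w - y) i
      simp only [PiLp.sub_apply] at h2
      have h3 := hw i
      have h4 : |y i - c i| ≤ |w i - y i| + |w i - c i| := by
        rw [abs_sub_comm (w i) (y i)]
        calc |y i - c i| = |(y i - w i) + (w i - c i)| := by ring_nf
          _ ≤ _ := abs_add_le _ _
      rw [hLR]
      have h5 : 2 * s = 2 ^ (k + 1) * (2 * R) := by rw [hs]; ring
      nlinarith
    -- The Luxemburg average in the kernel condition is normalized by the ball, Hölder's inequality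
    -- by the cube. The cube has the larger volume, so an admissible μ remains usable.
    have hvol : volume (Metric.ball (0 : Rn n) (2 * s)) ≤ volume (cube c (2 ^ (k + 1) * L)) := by
      calc volume (Metric.ball (0 : Rn n) (2 * s)) ≤ volume (cube (0 : Rn n) (2 * s)) := by
            refine measure_mono fun x hx i => ?_
            have := abs_coord_le_norm x i
            rw [mem_ball_zero_iff] at hx
            simp only [PiLp.zero_apply, sub_zero]
            linarith
        _ ≤ _ := by
            rw [volume_cube _ _ (by positivity), volume_cube _ _ (by positivity)]
            refine ENNReal.ofReal_le_ofReal (pow_le_pow_left₀ (by positivity) ?_ _)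
            rw [hLR, hs]
            have : 0 ≤ (2 : ℝ) ^ (k + 1) * l := by positivity
            linarith
    have hHφ : ∫⁻ y in E, φ (H y) ≤ volume (cube c (2 ^ (k + 1) * L)) := by
      refine le_trans ?_ (hle.trans hvol)
      calc ∫⁻ y in E, φ (H y)
          = ∫⁻ y, (annulus n s ∩ Metric.ball 0 (2 * s)).indicator
              (fun x => φ (‖h x‖₊ / μ)) (w - y) := by
            have hE' : MeasurableSet E := hEm.preimage (measurable_id.const_sub w)
            rw [← lintegral_indicator hE']
            refine lintegral_congr fun y => ?_
            by_cases hy : w - y ∈ annulus n s ∩ Metric.ball (0 : Rn n) (2 * s)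
            · rw [Set.indicator_of_mem (show y ∈ E from hy), Set.indicator_of_mem hy, hhy]
            · rw [Set.indicator_of_notMem (show y ∉ E from hy), Set.indicator_of_notMem hy]
        _ = ∫⁻ x, (annulus n s ∩ Metric.ball 0 (2 * s)).indicator
              (fun x => φ (‖h x‖₊ / μ)) x := lintegral_sub_left_eq_self _ w
        _ = ∫⁻ x in annulus n s ∩ Metric.ball 0 (2 * s), φ (‖h x‖₊ / μ) :=
            lintegral_indicator hEm _
        _ = ∫⁻ x in annulus n s ∩ Metric.ball 0 (2 * s),
              φ (‖(annulus n s).indicator h x‖₊ / μ) := by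
            refine setLIntegral_congr_fun hEm fun x hx => ?_
            simp only [Set.indicator_of_mem hx.1]
        _ ≤ _ := lintegral_mono_set Set.inter_subset_right
    have hae : (fun y => w - y) ⁻¹' annulus n s =ᵐ[volume] E :=
      (Measure.measurePreserving_sub_left volume w).quasiMeasurePreserving.preimage_ae_eq
        (annulus_ae_eq_inter_ball n hs0)
    have hQvol : volume (cube c (2 ^ (k + 1) * L)) ≤ 6 ^ n * ENNReal.ofReal (s ^ n) := by
      rw [volume_cube _ _ (by positivity), ← ENNReal.ofReal_ofNat 6, ← ENNReal.ofReal_pow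
        (by norm_num), ← ENNReal.ofReal_mul (by positivity), ← mul_pow]
      refine ENNReal.ofReal_le_ofReal (pow_le_pow_left₀ (by positivity) ?_ _)
      rw [hs, hLR]
      have : (2 : ℝ) ^ (k + 1) * l ≤ 2 ^ (k + 1) * R := by gcongr
      linarith
    have hk2 : ((k + 1 + 1 : ℕ) : ℝ≥0∞) ≤ 2 * ((k + 1 : ℕ) : ℝ≥0∞) := by
      exact_mod_cast (by omega : k + 1 + 1 ≤ 2 * (k + 1))
    rw [setLIntegral_congr hae]
    calc ∫⁻ y in E, ‖K (z - y) - K (w - y)‖ₑ * g y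
        = μ * ∫⁻ y in E, H y * g y := by
          rw [← lintegral_const_mul' _ _ ENNReal.coe_ne_top]
          refine lintegral_congr fun y => ?_
          have : ‖K (z - y) - K (w - y)‖ₑ = μ * (H y : ℝ≥0∞) := by
            rw [← ENNReal.coe_mul, hH, mul_div_cancel₀ _ hμ.ne']
            rfl
          rw [this, mul_assoc]
      _ ≤ μ * (C * ((k + 1 + 1 : ℕ) : ℝ≥0∞) ^ m * (lam * ∏ i, (N i : ℝ≥0∞)) *
            volume (cube c (2 ^ (k + 1) * L))) := by
          gcongr
          exact hC b N hb hN f hf lam c L hL0 (k + 1) (hlam (k + 1)) E hEQ H hHm hHφ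
      _ ≤ μ * (C * (2 * ((k + 1 : ℕ) : ℝ≥0∞)) ^ m * (lam * ∏ i, (N i : ℝ≥0∞)) *
            (6 ^ n * ENNReal.ofReal (s ^ n))) := by gcongr
      _ = _ := by rw [mul_pow]; ring
  calc ∫⁻ y in (cube c L)ᶜ, ‖K (z - y) - K (w - y)‖ₑ * g y
      ≤ ∫⁻ y in ⋃ k : ℕ, (fun y => w - y) ⁻¹' annulus n (2 ^ (k + 1) * R),
          ‖K (z - y) - K (w - y)‖ₑ * g y := lintegral_mono_set hsub
    _ ≤ ∑' k : ℕ, ∫⁻ y in (fun y => w - y) ⁻¹' annulus n (2 ^ (k + 1) * R),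
          ‖K (z - y) - K (w - y)‖ₑ * g y := lintegral_iUnion_le _ _
    _ ≤ ∑' k : ℕ, (C * 2 ^ m * 6 ^ n * (lam * ∏ i, (N i : ℝ≥0∞))) *
        (ENNReal.ofReal ((2 ^ (k + 1) * R) ^ n) * ((k + 1 : ℕ) : ℝ≥0∞) ^ m *
          luxAnnulus φ (2 ^ (k + 1) * R) h) :=
        ENNReal.tsum_le_tsum fun k => (hstep k).trans_eq (by ring)
    _ ≤ (C * 2 ^ m * 6 ^ n * (lam * ∏ i, (N i : ℝ≥0∞))) * A := by
        rw [ENNReal.tsum_mul_left]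
        exact mul_le_mul' le_rfl (hA (w - z) R hv)
    _ = _ := by push_cast; ring

theorem cube_mem_nhds {n : ℕ} {c x : Rn n} {l L : ℝ} (hlL : l < L) (hx : x ∈ cube c l) :
    cube c L ∈ 𝓝 x := by
  refine Filter.mem_of_superset (Metric.ball_mem_nhds x (sub_pos.2 hlL)) fun y hy i => ?_
  rw [mem_ball_iff_norm] at hy
  have h1 := abs_coord_le_norm (y - x) i
  simp only [PiLp.sub_apply] at h1
  have h2 := hx i
  calc |y i - c i| = |(y i - x i) + (x i - c i)| := by ring_nf
    _ ≤ |y i - x i| + |x i - c i| := abs_add_le _ _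
    _ ≤ L := by linarith

/-- The image of a function vanishing near a cube is almost constant on the cube. -/
theorem HasKernel.exists_ae_enorm_sub_le {n : ℕ} {T : L2Op n} {K : Rn n → ℂ}
    (hTK : HasKernel T K) {g : Rn n → ℂ} (hg : MemLp g 2 volume) {c : Rn n} {l L : ℝ}
    (hlL : l < L) (hsupp : ∀ y ∈ cube c L, g y = 0) {B : ℝ≥0∞}
    (hB : ∀ z ∈ cube c l, ∀ w ∈ cube c l, ∫⁻ y, ‖K (z - y) - K (w - y)‖ₑ * ‖g y‖ₑ ≤ B) :
    ∃ a : ℂ, ∀ᵐ x ∂volume.restrict (cube c l), ‖applyFun T g x - a‖ₑ ≤ B := by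
  -- The kernel formula is available only for compact support, so g is truncated to balls and the
  -- limit is taken along a subsequence.
  set A : ℕ → Set (Rn n) := fun N => Metric.closedBall 0 N with hA
  have hAm : ∀ N, MeasurableSet (A N) := fun N => measurableSet_closedBall
  obtain ⟨ns, -, hns⟩ := exists_subseq_applyFun_indicator T hg hAm fun x _ => by
    filter_upwards [eventually_ge_atTop ⌈‖x‖⌉₊] with N hN
    rw [mem_closedBall_zero_iff]
    exact (Nat.le_ceil _).trans (by exact_mod_cast hN)
  have hrep : ∀ᵐ x, ∀ k, x ∉ tsupport ((A (ns k)).indicator g) →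
      Integrable (fun y => K (x - y) * (A (ns k)).indicator g y) volume ∧
        applyFun T ((A (ns k)).indicator g) x = ∫ y, K (x - y) * (A (ns k)).indicator g y := by
    rw [ae_all_iff]
    intro k
    refine hTK.repr _ (hg.indicator (hAm _)) ?_
    exact HasCompactSupport.intro (isCompact_closedBall 0 (ns k : ℝ))
      fun x hx => Set.indicator_of_notMem hx _
  -- Since l < L, every point of the small cube has a neighbourhood on which g vanishes, so it lies
  -- off the closed support of each truncation.
  have hts : ∀ k, ∀ x ∈ cube c l, x ∉ tsupport ((A (ns k)).indicator g) := by
    intro k x hx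
    rw [notMem_tsupport_iff_eventuallyEq]
    filter_upwards [cube_mem_nhds hlL hx] with y hy
    simp [hsupp y hy]
  set G : Set (Rn n) := {x | x ∈ cube c l ∧ (∀ k,
    Integrable (fun y => K (x - y) * (A (ns k)).indicator g y) volume ∧
        applyFun T ((A (ns k)).indicator g) x = ∫ y, K (x - y) * (A (ns k)).indicator g y) ∧
    Tendsto (fun k => applyFun T ((A (ns k)).indicator g) x) atTop (𝓝 (applyFun T g x))} with hG
  have hGae : ∀ᵐ x ∂volume.restrict (cube c l), x ∈ G := by
    rw [ae_restrict_iff' (measurableSet_cube c l)]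
    filter_upwards [hns, hrep] with x h1 h2 hx
    exact ⟨hx, fun k => h2 k (hts k x hx), h1⟩
  have hpair : ∀ z ∈ G, ∀ w ∈ G, ‖applyFun T g z - applyFun T g w‖ₑ ≤ B := by
    rintro z ⟨hz, hz1, hz2⟩ w ⟨hw, hw1, hw2⟩
    refine le_of_tendsto (hz2.sub hw2).enorm (Eventually.of_forall fun k => ?_)
    rw [(hz1 k).2, (hw1 k).2, ← integral_sub (hz1 k).1 (hw1 k).1]
    refine (enorm_integral_le_lintegral_enorm _).trans ((lintegral_mono fun y => ?_).trans
      (hB z hz w hw))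
    rw [← sub_mul, enorm_mul]
    gcongr
    exact enorm_indicator_le_enorm_self _ _
  -- The constant is the value at any good point; if there is none, the almost everywhere statement
  -- is vacuous.
  by_cases hne : G.Nonempty
  · obtain ⟨w, hw⟩ := hne
    exact ⟨applyFun T g w, hGae.mono fun z hz => hpair z hz w hw⟩
  · exact ⟨0, hGae.mono fun z hz => absurd ⟨z, hz⟩ hne⟩

/-! ### Dyadic cells and the Calderón–Zygmund decomposition -/

/-- The index of the cell of side `s` that contains `x`. -/
def cellIdx {n : ℕ} (s : ℝ) (x : Rn n) : Fin n → ℤ := fun i => ⌊x i / s⌋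

/-- The half-open cell of side `s` with index `ν`. -/
def cell {n : ℕ} (s : ℝ) (ν : Fin n → ℤ) : Set (Rn n) := {x | cellIdx s x = ν}

theorem mem_cell_cellIdx {n : ℕ} (s : ℝ) (x : Rn n) : x ∈ cell s (cellIdx s x) := rfl

theorem cell_eq_preimage {n : ℕ} {s : ℝ} (hs : 0 < s) (ν : Fin n → ℤ) :
    cell s ν = (WithLp.ofLp : Rn n → Fin n → ℝ) ⁻¹'
      Set.univ.pi fun i => Set.Ico (ν i * s) ((ν i + 1) * s) := by
  ext x
  simp only [cell, cellIdx, Set.mem_ofPred_eq, funext_iff, Set.mem_preimage, Set.mem_univ_pi,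
    Set.mem_Ico, Int.floor_eq_iff, le_div_iff₀ hs, div_lt_iff₀ hs]

theorem measurableSet_cell {n : ℕ} {s : ℝ} (hs : 0 < s) (ν : Fin n → ℤ) :
    MeasurableSet (cell s ν) := by
  rw [cell_eq_preimage hs]
  exact (PiLp.volume_preserving_ofLp (Fin n)).measurable
    (MeasurableSet.univ_pi fun _ => measurableSet_Ico)

theorem volume_cell {n : ℕ} {s : ℝ} (hs : 0 < s) (ν : Fin n → ℤ) :
    volume (cell s ν) = ENNReal.ofReal (s ^ n) := by
  rw [cell_eq_preimage hs, (PiLp.volume_preserving_ofLp (Fin n)).measure_preimage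
    (MeasurableSet.univ_pi fun _ => measurableSet_Ico).nullMeasurableSet, Real.volume_pi_Ico]
  have : ∀ i, (ν i + 1) * s - ν i * s = s := fun i => by ring
  simp only [this, Finset.prod_const, Finset.card_univ, Fintype.card_fin]
  rw [← ENNReal.ofReal_pow hs.le]

theorem abs_sub_le_of_mem_cell {n : ℕ} {s : ℝ} (hs : 0 < s) {ν : Fin n → ℤ} {x y : Rn n}
    (hx : x ∈ cell s ν) (hy : y ∈ cell s ν) (i : Fin n) : |x i - y i| ≤ s := by
  rw [cell_eq_preimage hs] at hx hy
  have h1 := hx i (Set.mem_univ i)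
  have h2 := hy i (Set.mem_univ i)
  simp only [Set.mem_Ico] at h1 h2
  rw [abs_le]
  constructor <;> linarith [h1.1, h1.2, h2.1, h2.2]

theorem cell_subset_cube {n : ℕ} {s : ℝ} (hs : 0 < s) (ν : Fin n → ℤ) :
    cell s ν ⊆ cube (WithLp.toLp 2 fun i => (ν i + 1 / 2) * s : Rn n) (s / 2) := by
  intro x hx i
  rw [cell_eq_preimage hs] at hx
  have h1 := hx i (Set.mem_univ i)
  simp only [Set.mem_Ico] at h1
  simp only
  rw [abs_le]
  constructor <;> linarith [h1.1, h1.2]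

/-- Dyadic nesting: ⌊t / s⌋ is the integer quotient by 2 of ⌊t / (s / 2)⌋, so the finer index
determines the coarser one. -/
theorem cellIdx_eq_of_half {n : ℕ} {s : ℝ} {x y : Rn n}
    (h : cellIdx (s / 2) x = cellIdx (s / 2) y) : cellIdx s x = cellIdx s y := by
  funext i
  have key : ∀ t : ℝ, ⌊t / s⌋ = ⌊t / (s / 2)⌋ / 2 := fun t => by
    have : t / s = t / (s / 2) / 2 := by
      rcases eq_or_ne s 0 with rfl | hs
      · simp
      · field_simp
    rw [this]
    generalize t / (s / 2) = a
    have h1 := Int.floor_le a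
    have h2 := Int.lt_floor_add_one a
    have h3 : ((2 * (⌊a⌋ / 2) : ℤ) : ℝ) ≤ (⌊a⌋ : ℤ) := by exact_mod_cast (by omega)
    have h4 : ((⌊a⌋ : ℤ) : ℝ) ≤ ((2 * (⌊a⌋ / 2) + 1 : ℤ) : ℝ) := by exact_mod_cast (by omega)
    push_cast at h3 h4
    rw [Int.floor_eq_iff]
    constructor <;> linarith
  simp only [cellIdx]
  rw [key, key]
  have := congrFun h i
  simp only [cellIdx] at this
  rw [this]

theorem cellIdx_eq_of_le {n : ℕ} {s : ℝ} {x y : Rn n} {i j : ℕ} (hij : i ≤ j)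
    (h : cellIdx (s / 2 ^ j) x = cellIdx (s / 2 ^ j) y) :
    cellIdx (s / 2 ^ i) x = cellIdx (s / 2 ^ i) y := by
  induction j, hij using Nat.le_induction with
  | base => exact h
  | succ j hij ih =>
    refine ih (cellIdx_eq_of_half ?_)
    rwa [pow_succ, ← div_div] at h

/-- An integrable function is bounded almost everywhere by bounds for its averages on small
cells. -/
theorem ae_norm_le_of_cell_average_le {n : ℕ} (hn : 1 ≤ n) {g : Rn n → ℂ}
    (hg : Integrable g volume) {s : ℝ} (hs : 0 < s) (α : ℝ) :
    ∀ᵐ x, (∀ j : ℕ, ∫ y in cell (s / 2 ^ j) (cellIdx (s / 2 ^ j) x), ‖g y‖ ≤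
      α * (s / 2 ^ j) ^ n) → ‖g x‖ ≤ α := by
  have hn0 : 0 < √(n : ℝ) := Real.sqrt_pos.2 (by exact_mod_cast hn)
  filter_upwards [IsUnifLocDoublingMeasure.ae_tendsto_average_norm_sub volume
    hg.locallyIntegrable 1] with x hx hj
  have hδ : Tendsto (fun j : ℕ => √(n : ℝ) * (s / 2 ^ j)) atTop (𝓝[>] 0) := by
    refine tendsto_nhdsWithin_iff.2 ⟨?_, Eventually.of_forall fun j => ?_⟩
    · have h1 : Tendsto (fun j : ℕ => √(n : ℝ) * s * (1 / 2 : ℝ) ^ j) atTop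
          (𝓝 (√(n : ℝ) * s * 0)) :=
        (tendsto_pow_atTop_nhds_zero_of_lt_one (by norm_num) (by norm_num)).const_mul _
      rw [mul_zero] at h1
      refine h1.congr fun j => ?_
      rw [one_div, inv_pow]
      ring
    · have : 0 < √(n : ℝ) * (s / 2 ^ j) := by positivity
      exact this
  have hlim := hx (fun _ : ℕ => x) _ hδ (Eventually.of_forall fun j => by
    rw [one_mul]
    exact Metric.mem_closedBall_self (by positivity))
  -- The ratio of the volume of a ball of radius √n t to that of a cell of side t. The cell of x
  -- lies in such a ball around x, so Lebesgue differentiation over balls transfers to cells with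
  -- this loss.
  set V : ℝ := volume.real (Metric.closedBall (0 : Rn n) √n) with hV
  have hlim' : Tendsto (fun j : ℕ => α + V *
      ⨍ y in Metric.closedBall x (√n * (s / 2 ^ j)), ‖g y - g x‖) atTop (𝓝 (α + V * 0)) :=
    (hlim.const_mul V).const_add α
  rw [mul_zero, add_zero] at hlim'
  refine ge_of_tendsto' hlim' fun j => ?_
  set t := s / 2 ^ j with ht
  have ht0 : 0 < t := by positivity
  set P : Set (Rn n) := cell t (cellIdx t x) with hP
  have hPm : MeasurableSet P := measurableSet_cell ht0 _
  have hPv : volume.real P = t ^ n := by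
    rw [Measure.real, volume_cell ht0, ENNReal.toReal_ofReal (by positivity)]
  have hPfin : volume P ≠ ∞ := by rw [volume_cell ht0]; exact ENNReal.ofReal_ne_top
  have hPsub : P ⊆ Metric.closedBall x (√n * t) := by
    intro y hy
    rw [mem_closedBall_iff_norm]
    exact norm_le_sqrt_mul _ ht0.le fun i => by
      simpa using abs_sub_le_of_mem_cell ht0 hy (mem_cell_cellIdx t x) i
  have hBv : volume.real (Metric.closedBall x (√n * t)) = t ^ n * V := by
    rw [Measure.real, mul_comm (√(n : ℝ)) t, Measure.addHaar_closedBall_mul _ _ ht0.le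
      (Real.sqrt_nonneg _), hV, Measure.real, ENNReal.toReal_mul,
      ENNReal.toReal_ofReal (by positivity)]
    simp
  have hint : IntegrableOn (fun y => ‖g y - g x‖) (Metric.closedBall x (√n * t)) := by
    refine (hg.integrableOn.sub ?_).norm
    exact integrableOn_const measure_closedBall_lt_top.ne
  have h1 : ‖g x‖ * t ^ n ≤ α * t ^ n + t ^ n * V *
      ⨍ y in Metric.closedBall x (√n * t), ‖g y - g x‖ := by
    calc ‖g x‖ * t ^ n = ∫ _ in P, ‖g x‖ := by
          rw [setIntegral_const, hPv, smul_eq_mul, mul_comm]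
      _ ≤ ∫ y in P, (‖g y‖ + ‖g y - g x‖) := by
          refine integral_mono (integrableOn_const hPfin)
            (hg.norm.integrableOn.add (hint.mono_set hPsub)) fun y => ?_
          calc ‖g x‖ = ‖g y - (g y - g x)‖ := by rw [sub_sub_cancel]
            _ ≤ _ := norm_sub_le _ _
      _ = (∫ y in P, ‖g y‖) + ∫ y in P, ‖g y - g x‖ :=
          integral_add hg.norm.integrableOn (hint.mono_set hPsub)
      _ ≤ α * t ^ n + ∫ y in Metric.closedBall x (√n * t), ‖g y - g x‖ := by
          refine add_le_add (hj j) ?_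
          exact setIntegral_mono_set hint (Eventually.of_forall fun y => norm_nonneg _)
            hPsub.eventuallyLE
      _ = _ := by
          congr 1
          rw [← measure_smul_setAverage _ measure_closedBall_lt_top.ne, hBv, smul_eq_mul]
  have h2 : 0 < t ^ n := by positivity
  have h3 : ‖g x‖ * t ^ n ≤
      (α + V * ⨍ y in Metric.closedBall x (√n * t), ‖g y - g x‖) * t ^ n :=
    h1.trans_eq (by ring)
  exact le_of_mul_le_mul_right h3 h2

/-- The Calderón–Zygmund cells of an integrable function at height `α`. -/
theorem exists_calderonZygmund_cells {n : ℕ} (hn : 1 ≤ n) {g : Rn n → ℂ}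
    (hg : Integrable g volume) {α : ℝ} (hα : 0 < α) :
    ∃ (ι : Type) (_ : Countable ι) (c : ι → Rn n) (l : ι → ℝ) (P : ι → Set (Rn n)),
      (∀ i, 0 < l i) ∧ (∀ i, MeasurableSet (P i)) ∧ Pairwise (fun i j => Disjoint (P i) (P j)) ∧
      (∀ i, P i ⊆ cube (c i) (l i)) ∧ (∀ i, volume (P i) = ENNReal.ofReal ((2 * l i) ^ n)) ∧
      (∀ i, ENNReal.ofReal α * volume (P i) ≤ ∫⁻ x in P i, ‖g x‖ₑ) ∧
      (∀ i, ∫⁻ x in P i, ‖g x‖ₑ ≤ 2 ^ n * ENNReal.ofReal α * volume (P i)) ∧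
      ∀ᵐ x, x ∉ ⋃ i, P i → ‖g x‖ₑ ≤ ENNReal.ofReal α := by
  -- The initial scale is so large that no cell of side s is heavy; every selected cell therefore
  -- has a parent.
  obtain ⟨s, hs, hbig⟩ : ∃ s : ℝ, 0 < s ∧ ∫⁻ x, ‖g x‖ₑ ≤ ENNReal.ofReal (α * s ^ n) := by
    set I := (∫⁻ x, ‖g x‖ₑ).toReal
    refine ⟨1 + I / α, by positivity, ?_⟩
    rw [← ENNReal.ofReal_toReal hg.2.ne]
    refine ENNReal.ofReal_le_ofReal ?_
    have h1 : 1 + I / α ≤ (1 + I / α) ^ n :=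
      le_self_pow₀ (le_add_of_nonneg_right (by positivity)) (by omega)
    calc I ≤ α * (1 + I / α) := by
          rw [mul_add, mul_div_cancel₀ _ hα.ne']; linarith
      _ ≤ _ := by gcongr
  have hsj : ∀ j : ℕ, 0 < s / 2 ^ j := fun j => by positivity
  set heavy : ℕ → (Fin n → ℤ) → Prop := fun j ν =>
    ENNReal.ofReal (α * (s / 2 ^ j) ^ n) < ∫⁻ x in cell (s / 2 ^ j) ν, ‖g x‖ₑ with hheavy
  have hzero : ∀ ν, ¬ heavy 0 ν := by
    intro ν
    simp only [hheavy, not_lt, pow_zero, div_one]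
    exact (setLIntegral_le_lintegral _ _).trans hbig
  -- Stopping time: a heavy cell is selected when none of its dyadic ancestors is heavy. Maximality
  -- gives disjointness.
  set sel : ℕ × (Fin n → ℤ) → Prop := fun p => heavy p.1 p.2 ∧
    ∀ i < p.1, ∀ x ∈ cell (s / 2 ^ p.1) p.2, ¬ heavy i (cellIdx (s / 2 ^ i) x) with hsel
  refine ⟨{p // sel p}, inferInstance,
    fun p => WithLp.toLp 2 fun i => (p.1.2 i + 1 / 2) * (s / 2 ^ p.1.1),
    fun p => s / 2 ^ p.1.1 / 2, fun p => cell (s / 2 ^ p.1.1) p.1.2, ?_, ?_, ?_, ?_, ?_, ?_, ?_, ?_⟩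
  · exact fun p => by have := hsj p.1.1; positivity
  · exact fun p => measurableSet_cell (hsj _) _
  · rintro ⟨⟨j, ν⟩, hp⟩ ⟨⟨k, μ⟩, hq⟩ hne
    rw [Set.disjoint_left]
    intro x hx hy
    apply hne
    have hx' : cellIdx (s / 2 ^ j) x = ν := hx
    have hy' : cellIdx (s / 2 ^ k) x = μ := hy
    have hjk : j = k := by
      rcases lt_trichotomy j k with h | h | h
      · exact absurd hp.1 (by have := hq.2 j h x hy; rwa [hx'] at this)
      · exact h
      · exact absurd hq.1 (by have := hp.2 k h x hx; rwa [hy'] at this)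
    subst hjk
    rw [Subtype.mk.injEq, Prod.mk.injEq]
    exact ⟨rfl, hx'.symm.trans hy'⟩
  · exact fun p => cell_subset_cube (hsj _) _
  · intro p
    rw [volume_cell (hsj _)]
    congr 2
    ring
  · intro p
    rw [volume_cell (hsj _), ← ENNReal.ofReal_mul hα.le]
    exact p.2.1.le
  · rintro ⟨⟨j, ν⟩, hp⟩
    rcases j with _ | j
    · exact absurd hp.1 (hzero ν)
    · simp only
      have hne : (cell (s / 2 ^ (j + 1)) ν : Set (Rn n)).Nonempty := by
        rw [Set.nonempty_iff_ne_empty]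
        intro h
        have := hp.1
        simp only [hheavy, h, Measure.restrict_empty, lintegral_zero_measure] at this
        exact absurd this (not_lt.2 zero_le)
      obtain ⟨x, hx⟩ := hne
      -- The parent of a selected cell is not heavy, and its volume is 2^n times larger; this is the
      -- upper bound.
      have h1 := hp.2 j (Nat.lt_succ_self j) x hx
      simp only [hheavy, not_lt] at h1
      have hsub : (cell (s / 2 ^ (j + 1)) ν : Set (Rn n)) ⊆
          cell (s / 2 ^ j) (cellIdx (s / 2 ^ j) x) := fun y hy =>
        cellIdx_eq_of_le (Nat.le_succ j) (Eq.trans hy (Eq.symm hx))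
      refine (lintegral_mono_set hsub).trans (h1.trans_eq ?_)
      rw [volume_cell (hsj _), ← ENNReal.ofReal_ofNat 2, ← ENNReal.ofReal_pow (by norm_num),
        ← ENNReal.ofReal_mul (by positivity), ← ENNReal.ofReal_mul (by positivity)]
      congr 1
      rw [mul_comm (2 ^ n) α, mul_assoc, ← mul_pow]
      congr 2
      rw [pow_succ]
      field_simp
  · filter_upwards [ae_norm_le_of_cell_average_le hn hg hs α] with x hx hxu
    -- By strong induction on j, a heavy cell containing x would be a first one, hence selected, and
    -- x would lie in the union.
    have hno : ∀ j, ¬ heavy j (cellIdx (s / 2 ^ j) x) := by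
      intro j
      induction j using Nat.strong_induction_on with
      | _ j ih =>
        intro hj
        apply hxu
        refine Set.mem_iUnion.2 ⟨⟨(j, cellIdx (s / 2 ^ j) x), hj, fun i hi y hy => ?_⟩, rfl⟩
        have h1 : cellIdx (s / 2 ^ i) y = cellIdx (s / 2 ^ i) x := cellIdx_eq_of_le hi.le hy
        rw [h1]
        exact ih i hi
    rw [← ofReal_norm, ENNReal.ofReal_le_ofReal_iff hα.le]
    refine hx fun j => ?_
    have h1 := hno j
    simp only [hheavy, not_lt] at h1
    rw [← ofReal_integral_norm_eq_lintegral_enorm hg.integrableOn] at h1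
    exact (ENNReal.ofReal_le_ofReal_iff (by positivity)).1 h1

/-! ### The weak type `(1,1)` estimate -/

theorem applyFun_sum {n : ℕ} {ι : Type*} (T : L2Op n) (F : Finset ι) (h : ι → Rn n → ℂ)
    (hh : ∀ i ∈ F, MemLp (h i) 2 volume) :
    applyFun T (fun x => ∑ i ∈ F, h i x) =ᵐ[volume] fun x => ∑ i ∈ F, applyFun T (h i) x := by
  classical
  induction F using Finset.induction_on with
  | empty =>
    simp only [Finset.sum_empty]
    exact applyFun_zero T
  | insert j F hj ih =>
    have h1 := ih fun i hi => hh i (Finset.mem_insert_of_mem hi)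
    have h2 := applyFun_add T (hh j (Finset.mem_insert_self j F))
      (memLp_finsetSum F fun i hi => hh i (Finset.mem_insert_of_mem hi))
    simp only [Finset.sum_insert hj]
    filter_upwards [h1, h2] with x h1 h2
    rw [h2, h1]

/-- The estimate for functions of mean zero supported in a cube. -/
theorem HasKernel.lintegral_compl_closedBall_le {n : ℕ} {T : L2Op n} {K : Rn n → ℂ}
    (hTK : HasKernel T K) (hKm : Measurable K) {cH : ℝ} (hcH : 1 ≤ cH) {B : ℝ≥0}
    (hB : ∀ (y : Rn n) (R : ℝ), cH * ‖y‖ < R →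
      ∫⁻ x in {x | 2 * R < ‖x‖}, ‖K (x - y) - K x‖ₑ ≤ B)
    {h : Rn n → ℂ} (hh : MemLp h 2 volume) (hint : Integrable h volume) {c : Rn n} {l : ℝ}
    (hl : 0 < l) (hsupp : ∀ y ∉ cube c l, h y = 0) (hmean : ∫ y, h y = 0) :
    ∫⁻ x in (Metric.closedBall c (2 * ((cH * √n + 1) * l)))ᶜ, ‖applyFun T h x‖ₑ ≤
      B * ∫⁻ y, ‖h y‖ₑ := by
  set R := (cH * √n + 1) * l with hR
  set S : Set (Rn n) := Metric.closedBall c (2 * R) with hS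
  have hcube : cube c l ⊆ S := by
    intro x hx
    rw [mem_closedBall_iff_norm]
    refine (norm_le_sqrt_mul _ hl.le fun i => by simpa using hx i).trans ?_
    have h0 : 0 ≤ √(n : ℝ) * l := by positivity
    rw [hR]
    nlinarith
  have hts : tsupport h ⊆ cube c l :=
    closure_minimal (fun y hy => by
      by_contra hyc
      exact hy (hsupp y hyc)) (isClosed_cube c l)
  have hrep := hTK.repr h hh ((isCompact_cube c l).of_isClosed_subset (isClosed_tsupport h) hts)
  set F : Rn n → Rn n → ℝ≥0∞ := fun x y => ‖K (x - y) - K (x - c)‖ₑ * ‖h y‖ₑ with hF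
  have hpt : ∀ᵐ x, x ∈ Sᶜ → ‖applyFun T h x‖ₑ ≤ ∫⁻ y, F x y := by
    filter_upwards [hrep] with x hx hxS
    obtain ⟨h1, h2⟩ := hx fun hxt => hxS (hcube (hts hxt))
    -- The vanishing mean of h allows K(x - c) to be subtracted from the kernel.
    have h3 : ∫ y, K (x - y) * h y = ∫ y, (K (x - y) - K (x - c)) * h y := by
      simp_rw [sub_mul]
      rw [integral_sub h1 (hint.const_mul _), integral_const_mul, hmean, mul_zero, sub_zero]
    rw [h2, h3]
    refine (enorm_integral_le_lintegral_enorm _).trans (lintegral_mono fun y => ?_)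
    rw [enorm_mul]
  -- Tonelli's theorem needs joint measurability of the kernel difference; Borel measurability of K
  -- supplies it.
  have hFm : AEMeasurable (Function.uncurry F) ((volume.restrict Sᶜ).prod volume) := by
    have m1 : AEMeasurable (fun p : Rn n × Rn n => ‖K (p.1 - p.2) - K (p.1 - c)‖ₑ)
        ((volume.restrict Sᶜ).prod volume) :=
      ((hKm.comp (measurable_fst.sub measurable_snd)).sub
        (hKm.comp (measurable_fst.sub_const c))).enorm.aemeasurable
    have m2 : AEMeasurable (fun p : Rn n × Rn n => ‖h p.2‖ₑ)
        ((volume.restrict Sᶜ).prod volume) :=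
      (hint.aestronglyMeasurable.enorm).comp_quasiMeasurePreserving
        Measure.quasiMeasurePreserving_snd
    exact m1.mul m2
  have hinner : ∀ y, ∫⁻ x in Sᶜ, F x y ≤ B * ‖h y‖ₑ := by
    intro y
    by_cases hy : y ∈ cube c l
    · simp only [hF]
      rw [lintegral_mul_const' _ _ enorm_ne_top]
      gcongr
      have hyR : cH * ‖y - c‖ < R := by
        have h1 : ‖y - c‖ ≤ √n * l := norm_le_sqrt_mul _ hl.le fun i => by simpa using hy i
        calc cH * ‖y - c‖ ≤ cH * (√n * l) := by gcongr
          _ < R := by rw [hR]; nlinarith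
      refine le_of_eq_of_le ?_ (hB (y - c) R hyR)
      have hm : MeasurableSet {x : Rn n | 2 * R < ‖x‖} :=
        measurableSet_lt measurable_const measurable_norm
      rw [← lintegral_indicator hm, ← lintegral_indicator measurableSet_closedBall.compl,
        ← lintegral_sub_right_eq_self (Set.indicator {x : Rn n | 2 * R < ‖x‖} _) c]
      refine lintegral_congr fun x => ?_
      by_cases hx : 2 * R < ‖x - c‖
      · rw [Set.indicator_of_mem (show x - c ∈ {x : Rn n | 2 * R < ‖x‖} from hx),
          Set.indicator_of_mem]
        · rw [sub_sub_sub_cancel_right]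
        · rw [Set.mem_compl_iff, mem_closedBall_iff_norm]
          exact not_le.2 hx
      · rw [Set.indicator_of_notMem (show x - c ∉ {x : Rn n | 2 * R < ‖x‖} from hx),
          Set.indicator_of_notMem]
        rw [Set.mem_compl_iff, mem_closedBall_iff_norm, not_not]
        exact not_lt.1 hx
    · simp [hF, hsupp y hy]
  calc ∫⁻ x in Sᶜ, ‖applyFun T h x‖ₑ ≤ ∫⁻ x in Sᶜ, ∫⁻ y, F x y :=
        lintegral_mono_ae ((ae_restrict_iff' measurableSet_closedBall.compl).2 hpt)
    _ = ∫⁻ y, ∫⁻ x in Sᶜ, F x y := lintegral_lintegral_swap hFm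
    _ ≤ ∫⁻ y, B * ‖h y‖ₑ := lintegral_mono hinner
    _ = _ := lintegral_const_mul' _ _ ENNReal.coe_ne_top

/-- The Calderón–Zygmund decomposition of an integrable function into a bounded function and
functions of mean zero supported in cubes. -/
theorem exists_calderonZygmund_decomposition {n : ℕ} (hn : 1 ≤ n) {g : Rn n → ℂ}
    (hg : Integrable g volume) (hg2 : MemLp g 2 volume) {α : ℝ} (hα : 0 < α) :
    ∃ (ι : Type) (_ : Countable ι) (c : ι → Rn n) (l : ι → ℝ) (P : ι → Set (Rn n))
      (G h : Rn n → ℂ),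
      (∀ i, 0 < l i) ∧ (∀ i, MeasurableSet (P i)) ∧ Pairwise (fun i j => Disjoint (P i) (P j)) ∧
      (∀ i, P i ⊆ cube (c i) (l i)) ∧
      ENNReal.ofReal α * ∑' i, ENNReal.ofReal ((2 * l i) ^ n) ≤ ∫⁻ x, ‖g x‖ₑ ∧
      MemLp G 2 volume ∧ MemLp h 2 volume ∧ (∀ x, g x = G x + h x) ∧
      ∫⁻ x, ‖G x‖ₑ ^ (2 : ℝ) ≤ 2 ^ n * ENNReal.ofReal α * ∫⁻ x, ‖g x‖ₑ ∧
      (∀ x ∉ ⋃ i, P i, h x = 0) ∧ (∀ i, ∫ x in P i, h x = 0) ∧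
      (∀ i, IntegrableOn h (P i)) ∧
      ∑' i, ∫⁻ x in P i, ‖h x‖ₑ ≤ 2 * ∫⁻ x, ‖g x‖ₑ := by
  classical
  obtain ⟨ι, hι, c, l, P, hl, hPm, hPd, hPc, hPv, hlow, hup, hout⟩ :=
    exists_calderonZygmund_cells hn hg hα
  set Ω := ⋃ i, P i with hΩ
  have hΩm : MeasurableSet Ω := MeasurableSet.iUnion hPm
  have hPfin : ∀ i, volume (P i) ≠ ∞ := fun i => by rw [hPv]; exact ENNReal.ofReal_ne_top
  have hPpos : ∀ i, volume (P i) ≠ 0 := fun i => by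
    have := hl i
    rw [hPv]
    exact (ENNReal.ofReal_pos.2 (by positivity)).ne'
  set a : ι → ℂ := fun i => ⨍ x in P i, g x with ha
  -- The cells are disjoint, so the chosen index is the only possible one.
  set av : Rn n → ℂ := fun x => if hx : ∃ i, x ∈ P i then a hx.choose else 0 with hav
  have hav_mem : ∀ i, ∀ x ∈ P i, av x = a i := by
    intro i x hx
    have hex : ∃ i, x ∈ P i := ⟨i, hx⟩
    have : hex.choose = i := by
      by_contra hne
      exact Set.disjoint_left.1 (hPd hne) hex.choose_spec hx
    simp only [hav, dif_pos hex, this]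
  have hav_out : ∀ x ∉ Ω, av x = 0 := by
    intro x hx
    have : ¬ ∃ i, x ∈ P i := fun h => hx (Set.mem_iUnion.2 h)
    simp only [hav, dif_neg this]
  have hav_meas : AEStronglyMeasurable av volume := by
    have h1 : Ω.indicator av = av := by
      ext x
      by_cases hx : x ∈ Ω
      · simp [hx]
      · simp [hx, hav_out x hx]
    rw [← h1, aestronglyMeasurable_indicator_iff hΩm, hΩ, aestronglyMeasurable_iUnion_iff]
    intro i
    refine (aestronglyMeasurable_const (b := a i)).congr ?_
    rw [Filter.EventuallyEq, ae_restrict_iff' (hPm i)]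
    exact Eventually.of_forall fun x hx => (hav_mem i x hx).symm
  have ha_le : ∀ i, volume (P i) * ‖a i‖ₑ ≤ ∫⁻ x in P i, ‖g x‖ₑ := by
    intro i
    have h := enorm_setAverage_sub_le (hg.integrableOn (s := P i)) (hPpos i) (hPfin i) 0
    simp only [sub_zero] at h
    calc volume (P i) * ‖a i‖ₑ ≤ volume (P i) * ((volume (P i))⁻¹ * ∫⁻ x in P i, ‖g x‖ₑ) := by
          gcongr
      _ = _ := by rw [← mul_assoc, ENNReal.mul_inv_cancel (hPpos i) (hPfin i), one_mul]
  have ha_le' : ∀ i, ‖a i‖ₑ ≤ 2 ^ n * ENNReal.ofReal α := by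
    intro i
    have h := (ha_le i).trans (hup i)
    rw [mul_comm] at h
    exact (ENNReal.mul_le_mul_iff_left (hPpos i) (hPfin i)).1 h
  set G : Rn n → ℂ := fun x => Ωᶜ.indicator g x + av x with hG
  have hGm : AEStronglyMeasurable G volume :=
    (hg.aestronglyMeasurable.indicator hΩm.compl).add hav_meas
  have hG_in : ∀ i, ∀ x ∈ P i, G x = a i := by
    intro i x hx
    have hxΩ : x ∈ Ω := Set.mem_iUnion.2 ⟨i, hx⟩
    simp [hG, hxΩ, hav_mem i x hx]
  have hG_out : ∀ x ∉ Ω, G x = g x := by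
    intro x hx
    simp [hG, hx, hav_out x hx]
  have hsumP : ∑' i, ∫⁻ x in P i, ‖g x‖ₑ = ∫⁻ x in Ω, ‖g x‖ₑ :=
    (lintegral_iUnion hPm hPd _).symm
  have hGbd : ∀ᵐ x, ‖G x‖ₑ ≤ 2 ^ n * ENNReal.ofReal α := by
    filter_upwards [hout] with x hx
    by_cases hxΩ : x ∈ Ω
    · obtain ⟨i, hi⟩ := Set.mem_iUnion.1 hxΩ
      rw [hG_in i x hi]
      exact ha_le' i
    · rw [hG_out x hxΩ]
      refine (hx hxΩ).trans (le_mul_of_one_le_left' (one_le_pow₀ (by norm_num)))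
  have hG1 : ∫⁻ x, ‖G x‖ₑ ≤ ∫⁻ x, ‖g x‖ₑ := by
    rw [← lintegral_add_compl _ hΩm, ← lintegral_add_compl (fun x => ‖g x‖ₑ) hΩm]
    refine add_le_add ?_ (le_of_eq ?_)
    · rw [← hsumP, hΩ, lintegral_iUnion hPm hPd]
      refine ENNReal.tsum_le_tsum fun i => ?_
      calc ∫⁻ x in P i, ‖G x‖ₑ = ∫⁻ _ in P i, ‖a i‖ₑ :=
            setLIntegral_congr_fun (hPm i) fun x hx => by simp only [hG_in i x hx]
        _ = volume (P i) * ‖a i‖ₑ := by rw [setLIntegral_const, mul_comm]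
        _ ≤ _ := ha_le i
    · exact setLIntegral_congr_fun hΩm.compl fun x hx => by simp only [hG_out x hx]
  -- The good part is at most 2^n α almost everywhere, so its square is at most 2^n α |G|.
  have hG2 : ∫⁻ x, ‖G x‖ₑ ^ (2 : ℝ) ≤ 2 ^ n * ENNReal.ofReal α * ∫⁻ x, ‖g x‖ₑ := by
    calc ∫⁻ x, ‖G x‖ₑ ^ (2 : ℝ) ≤ ∫⁻ x, 2 ^ n * ENNReal.ofReal α * ‖G x‖ₑ := by
          refine lintegral_mono_ae ?_
          filter_upwards [hGbd] with x hx
          rw [ENNReal.rpow_two, sq]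
          gcongr
      _ = 2 ^ n * ENNReal.ofReal α * ∫⁻ x, ‖G x‖ₑ :=
          lintegral_const_mul' _ _ (by finiteness)
      _ ≤ _ := by gcongr
  have hGL : MemLp G 2 volume := by
    refine ⟨hGm, ?_⟩
    rw [eLpNorm_lt_top_iff_lintegral_rpow_enorm_lt_top two_ne_zero ENNReal.ofNat_ne_top]
    rw [ENNReal.toReal_ofNat]
    exact hG2.trans_lt (ENNReal.mul_lt_top (by finiteness) hg.2)
  have hint : ∀ i, IntegrableOn (fun x => g x - a i) (P i) := fun i =>
    hg.integrableOn.sub (integrableOn_const (hPfin i))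
  have hh_in : ∀ i, Set.EqOn (fun x => g x - G x) (fun x => g x - a i) (P i) :=
    fun i x hx => by simp only [hG_in i x hx]
  refine ⟨ι, hι, c, l, P, G, fun x => g x - G x, hl, hPm, hPd, hPc, ?_, hGL, hg2.sub hGL,
    fun x => by ring, hG2, fun x hx => by simp only [hG_out x hx, sub_self], fun i => ?_, fun i => ?_, ?_⟩
  · rw [← ENNReal.tsum_mul_left]
    calc ∑' i, ENNReal.ofReal α * ENNReal.ofReal ((2 * l i) ^ n)
        ≤ ∑' i, ∫⁻ x in P i, ‖g x‖ₑ := by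
          refine ENNReal.tsum_le_tsum fun i => ?_
          rw [← hPv]
          exact hlow i
      _ ≤ _ := by rw [hsumP]; exact setLIntegral_le_lintegral _ _
  · rw [setIntegral_congr_fun (hPm i) (hh_in i), integral_sub hg.integrableOn
      (integrableOn_const (hPfin i)), setIntegral_const, ha]
    simp only
    rw [← measure_smul_setAverage _ (hPfin i), sub_self]
  · exact (hint i).congr_fun (hh_in i).symm (hPm i)
  · calc ∑' i, ∫⁻ x in P i, ‖g x - G x‖ₑ ≤ ∑' i, 2 * ∫⁻ x in P i, ‖g x‖ₑ := by
          refine ENNReal.tsum_le_tsum fun i => ?_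
          calc ∫⁻ x in P i, ‖g x - G x‖ₑ = ∫⁻ x in P i, ‖g x - a i‖ₑ :=
                setLIntegral_congr_fun (hPm i) fun x hx => by simp only [hG_in i x hx]
            _ ≤ ∫⁻ x in P i, (‖g x‖ₑ + ‖a i‖ₑ) := lintegral_mono fun x => enorm_sub_le
            _ = (∫⁻ x in P i, ‖g x‖ₑ) + volume (P i) * ‖a i‖ₑ := by
                rw [lintegral_add_right _ measurable_const, setLIntegral_const, mul_comm]
            _ ≤ (∫⁻ x in P i, ‖g x‖ₑ) + ∫⁻ x in P i, ‖g x‖ₑ := by gcongr; exact ha_le i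
            _ = _ := (two_mul _).symm
      _ = 2 * ∫⁻ x in Ω, ‖g x‖ₑ := by rw [ENNReal.tsum_mul_left, hsumP]
      _ ≤ _ := by gcongr; exact Measure.restrict_le_self

/-- The image of the bad part of a Calderón–Zygmund decomposition away from the cells. -/
theorem HasKernel.lintegral_compl_iUnion_le {n : ℕ} {T : L2Op n} {K : Rn n → ℂ}
    (hTK : HasKernel T K) (hKm : Measurable K) {cH : ℝ} (hcH : 1 ≤ cH) {B : ℝ≥0}
    (hB : ∀ (y : Rn n) (R : ℝ), cH * ‖y‖ < R →
      ∫⁻ x in {x | 2 * R < ‖x‖}, ‖K (x - y) - K x‖ₑ ≤ B)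
    {ι : Type} [Countable ι] {c : ι → Rn n} {l : ι → ℝ} {P : ι → Set (Rn n)} {h : Rn n → ℂ}
    (hl : ∀ i, 0 < l i) (hPm : ∀ i, MeasurableSet (P i))
    (hPd : Pairwise (fun i j => Disjoint (P i) (P j))) (hPc : ∀ i, P i ⊆ cube (c i) (l i))
    (hh : MemLp h 2 volume) (hout : ∀ x ∉ ⋃ i, P i, h x = 0)
    (hmean : ∀ i, ∫ x in P i, h x = 0) (hint : ∀ i, IntegrableOn h (P i)) :
    ∫⁻ x in (⋃ i, Metric.closedBall (c i) (2 * ((cH * √n + 1) * l i)))ᶜ, ‖applyFun T h x‖ₑ ≤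
      B * ∑' i, ∫⁻ x in P i, ‖h x‖ₑ := by
  classical
  set S : ι → Set (Rn n) := fun i => Metric.closedBall (c i) (2 * ((cH * √n + 1) * l i)) with hS
  have := Encodable.ofCountable ι
  -- Additivity of T is used only for finite sums. Finite subfamilies exhaust the cells, the bound
  -- is uniform over them, and Fatou's lemma along a subsequence gives the full bad part.
  set F : ℕ → Finset ι := fun N =>
    (Finset.range N).preimage Encodable.encode Encodable.encode_injective.injOn with hF
  have hFmem : ∀ N i, i ∈ F N ↔ Encodable.encode i < N := fun N i => by simp [hF]
  set A : ℕ → Set (Rn n) := fun N => ⋃ i ∈ F N, P i with hA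
  have hAm : ∀ N, MeasurableSet (A N) := fun N =>
    Finset.measurableSet_biUnion _ fun i _ => hPm i
  obtain ⟨ns, -, hns⟩ := exists_subseq_applyFun_indicator T hh hAm fun x hx => by
    obtain ⟨i, hi⟩ : ∃ i, x ∈ P i := by
      by_contra hno
      exact hx (hout x fun h => hno (Set.mem_iUnion.1 h))
    filter_upwards [eventually_gt_atTop (Encodable.encode i)] with N hN
    exact Set.mem_biUnion ((hFmem N i).2 hN) hi
  have hpiece : ∀ i, MemLp ((P i).indicator h) 2 volume := fun i => hh.indicator (hPm i)
  have hsum : ∀ N, applyFun T ((A N).indicator h) =ᵐ[volume]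
      fun x => ∑ i ∈ F N, applyFun T ((P i).indicator h) x := by
    intro N
    have h1 : (A N).indicator h = fun x => ∑ i ∈ F N, (P i).indicator h x := by
      rw [hA]
      exact Finset.indicator_biUnion (F N) P fun i _ j _ hij => hPd hij
    rw [h1]
    exact applyFun_sum T (F N) _ fun i _ => hpiece i
  have hbound : ∀ N, ∫⁻ x in (⋃ i, S i)ᶜ, ‖applyFun T ((A N).indicator h) x‖ₑ ≤
      B * ∑' i, ∫⁻ x in P i, ‖h x‖ₑ := by
    intro N
    calc ∫⁻ x in (⋃ i, S i)ᶜ, ‖applyFun T ((A N).indicator h) x‖ₑ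
        ≤ ∫⁻ x in (⋃ i, S i)ᶜ, ∑ i ∈ F N, ‖applyFun T ((P i).indicator h) x‖ₑ := by
          refine lintegral_mono_ae (ae_restrict_of_ae ?_)
          filter_upwards [hsum N] with x hx
          rw [hx]
          exact enorm_sum_le _ _
      _ = ∑ i ∈ F N, ∫⁻ x in (⋃ i, S i)ᶜ, ‖applyFun T ((P i).indicator h) x‖ₑ :=
          lintegral_finsetSum' _ fun i _ => (aestronglyMeasurable_applyFun T _).enorm.restrict
      _ ≤ ∑ i ∈ F N, B * ∫⁻ x in P i, ‖h x‖ₑ := by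
          refine Finset.sum_le_sum fun i _ => ?_
          have hsub : (⋃ i, S i)ᶜ ⊆ (S i)ᶜ :=
            Set.compl_subset_compl.2 (Set.subset_iUnion S i)
          refine (lintegral_mono_set hsub).trans ?_
          have h1 := hTK.lintegral_compl_closedBall_le hKm hcH hB (hpiece i)
            ((integrable_indicator_iff (hPm i)).2 (hint i)) (hl i)
            (fun y hy => Set.indicator_of_notMem (fun hyP => hy (hPc i hyP)) _)
            (by rw [integral_indicator (hPm i)]; exact hmean i)
          refine h1.trans_eq ?_
          congr 1
          rw [← lintegral_indicator (hPm i)]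
          refine lintegral_congr fun x => ?_
          by_cases hx : x ∈ P i <;> simp [hx]
      _ = B * ∑ i ∈ F N, ∫⁻ x in P i, ‖h x‖ₑ := by rw [Finset.mul_sum]
      _ ≤ _ := by gcongr; exact ENNReal.sum_le_tsum _
  calc ∫⁻ x in (⋃ i, S i)ᶜ, ‖applyFun T h x‖ₑ
      = ∫⁻ x in (⋃ i, S i)ᶜ,
          liminf (fun k => ‖applyFun T ((A (ns k)).indicator h) x‖ₑ) atTop := by
        refine lintegral_congr_ae (ae_restrict_of_ae ?_)
        filter_upwards [hns] with x hx
        exact hx.enorm.liminf_eq.symm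
    _ ≤ liminf (fun k => ∫⁻ x in (⋃ i, S i)ᶜ, ‖applyFun T ((A (ns k)).indicator h) x‖ₑ) atTop :=
        lintegral_liminf_le' fun k => (aestronglyMeasurable_applyFun T _).enorm.restrict
    _ ≤ _ := by
        refine (liminf_le_liminf (Eventually.of_forall fun k => hbound (ns k))).trans ?_
        rw [liminf_const]

theorem lintegral_enorm_applyFun_sq_le {n : ℕ} (T : L2Op n) {G : Rn n → ℂ}
    (hG : MemLp G 2 volume) :
    ∫⁻ x, ‖applyFun T G x‖ₑ ^ (2 : ℝ) ≤ ‖T‖ₑ ^ (2 : ℝ) * ∫⁻ x, ‖G x‖ₑ ^ (2 : ℝ) := by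
  have h := ENNReal.rpow_le_rpow (eLpNorm_applyFun_le T hG) (zero_le_two (α := ℝ))
  rw [ENNReal.mul_rpow_of_nonneg _ _ zero_le_two,
    eLpNorm_eq_lintegral_rpow_enorm_toReal two_ne_zero ENNReal.ofNat_ne_top,
    eLpNorm_eq_lintegral_rpow_enorm_toReal two_ne_zero ENNReal.ofNat_ne_top,
    ENNReal.toReal_ofNat, ← ENNReal.rpow_mul, ← ENNReal.rpow_mul] at h
  simpa using h

/-- Calderón–Zygmund decomposition at height α: Chebyshev in L² for the good part, the measure of
the enlarged balls, and Chebyshev in L¹ for the bad part outside these balls. -/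
theorem HasKernel.exists_weak_type {n : ℕ} (hn : 1 ≤ n) {T : L2Op n} {K : Rn n → ℂ}
    (hTK : HasKernel T K) (hKm : Measurable K) {cH : ℝ} (hcH : 1 ≤ cH) {B : ℝ≥0}
    (hB : ∀ (y : Rn n) (R : ℝ), cH * ‖y‖ < R →
      ∫⁻ x in {x | 2 * R < ‖x‖}, ‖K (x - y) - K x‖ₑ ≤ B) :
    ∃ C : ℝ≥0, ∀ (g : Rn n → ℂ) (_ : Integrable g volume) (_ : MemLp g 2 volume) (α : ℝ)
      (_ : 0 < α), volume {x | ENNReal.ofReal α < ‖applyFun T g x‖ₑ} ≤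
        C * (∫⁻ x, ‖g x‖ₑ) / ENNReal.ofReal α := by
  set V : ℝ≥0 := (volume (Metric.closedBall (0 : Rn n) (2 * (cH * √n + 1)))).toNNReal with hV
  have hVe : (V : ℝ≥0∞) = volume (Metric.closedBall (0 : Rn n) (2 * (cH * √n + 1))) :=
    ENNReal.coe_toNNReal measure_closedBall_lt_top.ne
  -- Both Chebyshev bounds are at height α / 2: the good part gives 4 ‖T‖² 2^n, and the bad part 2 ·
  -- 2B, as its L¹ norm is at most twice that of g. V bounds the total volume of the balls.
  refine ⟨4 * ‖T‖₊ ^ 2 * 2 ^ n + (V + 4 * B), fun g hg hg2 α hα => ?_⟩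
  obtain ⟨ι, hι, c, l, P, G, h, hl, hPm, hPd, hPc, hvol, hGL, hhL, hgGh, hG2, hout, hmean, hint,
    hsum⟩ := exists_calderonZygmund_decomposition hn hg hg2 hα
  set a := ENNReal.ofReal α with ha
  have ha0 : a ≠ 0 := (ENNReal.ofReal_pos.2 hα).ne'
  have hat : a ≠ ∞ := ENNReal.ofReal_ne_top
  set I := ∫⁻ x, ‖g x‖ₑ with hI
  set U : Set (Rn n) := ⋃ i, Metric.closedBall (c i) (2 * ((cH * √n + 1) * l i)) with hU
  have hUm : MeasurableSet U := MeasurableSet.iUnion fun i => measurableSet_closedBall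
  have h1 : volume {x | a / 2 ≤ ‖applyFun T G x‖ₑ} ≤ (4 * ‖T‖₊ ^ 2 * 2 ^ n : ℝ≥0) * I / a := by
    have hsq : {x | a / 2 ≤ ‖applyFun T G x‖ₑ} ⊆
        {x | (a / 2) ^ (2 : ℝ) ≤ ‖applyFun T G x‖ₑ ^ (2 : ℝ)} := fun x hx =>
      ENNReal.rpow_le_rpow hx zero_le_two
    have ha2 : (a / 2) ^ (2 : ℝ) ≠ 0 := by
      rw [ENNReal.rpow_two]
      exact pow_ne_zero _ (ENNReal.div_ne_zero.2 ⟨ha0, ENNReal.ofNat_ne_top⟩)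
    have ha2t : (a / 2) ^ (2 : ℝ) ≠ ∞ :=
      ENNReal.rpow_ne_top_of_nonneg zero_le_two (ENNReal.div_ne_top hat two_ne_zero)
    refine (measure_mono hsq).trans ((meas_ge_le_lintegral_div
      ((aestronglyMeasurable_applyFun T G).enorm.pow_const _) ha2 ha2t).trans ?_)
    rw [ENNReal.div_le_iff ha2 ha2t]
    calc ∫⁻ x, ‖applyFun T G x‖ₑ ^ (2 : ℝ)
        ≤ ‖T‖ₑ ^ (2 : ℝ) * (2 ^ n * a * I) :=
          (lintegral_enorm_applyFun_sq_le T hGL).trans (by gcongr)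
      _ = (4 * ‖T‖₊ ^ 2 * 2 ^ n : ℝ≥0) * I / a * (a / 2) ^ (2 : ℝ) := by
          rw [ENNReal.rpow_two, ENNReal.rpow_two]
          have h4 : (2⁻¹ : ℝ≥0∞) ^ 2 * 4 = 1 := by
            rw [← ENNReal.inv_pow, show (2 : ℝ≥0∞) ^ 2 = 4 by norm_num]
            exact ENNReal.inv_mul_cancel (by norm_num) (by norm_num)
          have h5 : a⁻¹ * a = 1 := ENNReal.inv_mul_cancel ha0 hat
          push_cast
          rw [div_eq_mul_inv, div_eq_mul_inv, mul_pow, enorm_eq_nnnorm]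
          calc (‖T‖₊ : ℝ≥0∞) ^ 2 * (2 ^ n * a * I)
              = (2⁻¹ ^ 2 * 4) * (a⁻¹ * a) * ((‖T‖₊ : ℝ≥0∞) ^ 2 * (2 ^ n * a * I)) := by
                rw [h4, h5]; simp
            _ = _ := by ring
  have h2 : volume U ≤ V * I / a := by
    rw [ENNReal.le_div_iff_mul_le (Or.inl ha0) (Or.inl hat)]
    calc volume U * a ≤ (∑' i, V * ENNReal.ofReal ((2 * l i) ^ n)) * a := by
          gcongr
          refine (measure_iUnion_le _).trans (ENNReal.tsum_le_tsum fun i => ?_)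
          have hli := hl i
          have e1 : 2 * ((cH * √n + 1) * l i) = l i * (2 * (cH * √n + 1)) := by ring
          rw [e1, Measure.addHaar_closedBall_mul _ _ hli.le (by positivity), ← hVe, mul_comm]
          gcongr
          · simp only [finrank_euclideanSpace, Fintype.card_fin]
            exact pow_le_pow_left₀ hli.le (by linarith) n
      _ = V * (a * ∑' i, ENNReal.ofReal ((2 * l i) ^ n)) := by
          rw [ENNReal.tsum_mul_left]; ring
      _ ≤ V * I := by gcongr
  have h3 : volume ({x | a / 2 ≤ ‖applyFun T h x‖ₑ} ∩ Uᶜ) ≤ (4 * B : ℝ≥0) * I / a := by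
    have ha2 : a / 2 ≠ 0 := ENNReal.div_ne_zero.2 ⟨ha0, ENNReal.ofNat_ne_top⟩
    have ha2t : a / 2 ≠ ∞ := ENNReal.div_ne_top hat two_ne_zero
    rw [← Measure.restrict_apply' hUm.compl]
    refine (meas_ge_le_lintegral_div
      ((aestronglyMeasurable_applyFun T h).enorm.restrict) ha2 ha2t).trans ?_
    rw [ENNReal.div_le_iff ha2 ha2t]
    calc ∫⁻ x in Uᶜ, ‖applyFun T h x‖ₑ ≤ B * (2 * I) :=
          (hTK.lintegral_compl_iUnion_le hKm hcH hB hl hPm hPd hPc hhL hout hmean hint).trans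
            (by gcongr)
      _ = (4 * B : ℝ≥0) * I / a * (a / 2) := by
          have h4 : (2⁻¹ : ℝ≥0∞) * 2 = 1 := ENNReal.inv_mul_cancel (by norm_num) (by norm_num)
          have h5 : a⁻¹ * a = 1 := ENNReal.inv_mul_cancel ha0 hat
          push_cast
          rw [div_eq_mul_inv, div_eq_mul_inv]
          calc (B : ℝ≥0∞) * (2 * I) = (2⁻¹ * 2) * (a⁻¹ * a) * (B * (2 * I)) := by
                rw [h4, h5]; simp
            _ = (4 : ℝ≥0∞) * B * I * a⁻¹ * (a * 2⁻¹) := by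
                rw [show (4 : ℝ≥0∞) = 2 * 2 by norm_num]; ring
  have hsub : {x | a < ‖applyFun T g x‖ₑ} ≤ᵐ[volume]
      ({x | a / 2 ≤ ‖applyFun T G x‖ₑ} ∪ (U ∪ ({x | a / 2 ≤ ‖applyFun T h x‖ₑ} ∩ Uᶜ)) :
        Set (Rn n)) := by
    have hT := applyFun_add T hGL hhL
    have hgf : (fun x => G x + h x) = g := funext fun x => (hgGh x).symm
    rw [hgf] at hT
    filter_upwards [hT] with x hx hxa
    have hxa' : a < ‖applyFun T g x‖ₑ := hxa
    by_contra hno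
    have n1 : ‖applyFun T G x‖ₑ < a / 2 := not_le.1 fun h => hno (Or.inl h)
    have n2 : x ∉ U := fun h => hno (Or.inr (Or.inl h))
    have n3 : ‖applyFun T h x‖ₑ < a / 2 := not_le.1 fun h => hno (Or.inr (Or.inr ⟨h, n2⟩))
    rw [hx] at hxa'
    have := (enorm_add_le _ _).trans (add_le_add n1.le n3.le)
    rw [ENNReal.add_halves] at this
    exact absurd hxa' (not_lt.2 this)
  calc volume {x | a < ‖applyFun T g x‖ₑ}
      ≤ _ := measure_mono_ae hsub
    _ ≤ (4 * ‖T‖₊ ^ 2 * 2 ^ n : ℝ≥0) * I / a + (V * I / a + (4 * B : ℝ≥0) * I / a) := by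
        refine (measure_union_le _ _).trans (add_le_add h1 ?_)
        exact (measure_union_le _ _).trans (add_le_add h2 h3)
    _ = _ := by
        rw [ENNReal.coe_add _ (V + 4 * B), ENNReal.coe_add V, add_mul, add_mul,
          ENNReal.add_div, ENNReal.add_div]

/-! ### Kolmogorov's inequality -/

theorem exists_two_pow_lt_le {t : ℝ} (ht : 0 < t) {y : ℝ≥0∞} (hy : y ≠ ∞)
    (h : ENNReal.ofReal t < y) : ∃ k : ℕ, ENNReal.ofReal (2 ^ k * t) < y ∧
      y ≤ ENNReal.ofReal (2 ^ (k + 1) * t) := by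
  have hex : ∃ k : ℕ, y ≤ ENNReal.ofReal (2 ^ (k + 1) * t) := by
    obtain ⟨k, hk⟩ := pow_unbounded_of_one_lt (y.toReal / t) (one_lt_two (α := ℝ))
    refine ⟨k, ?_⟩
    rw [← ENNReal.ofReal_toReal hy]
    refine ENNReal.ofReal_le_ofReal ?_
    rw [div_lt_iff₀ ht] at hk
    have : 0 ≤ (2 : ℝ) ^ k * t := by positivity
    rw [pow_succ]
    linarith
  refine ⟨Nat.find hex, ?_, Nat.find_spec hex⟩
  rcases hk : Nat.find hex with _ | k
  · simpa using h
  · exact not_le.1 (Nat.find_min hex (m := k) (by omega))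

/-- **Kolmogorov's inequality**: weak type estimates give local estimates for small powers. -/
theorem exists_lintegral_rpow_le_of_weak {δ : ℝ} (hδ : 0 < δ) (hδ1 : δ < 1) (n : ℕ) :
    ∃ C : ℝ≥0, ∀ (Q : Set (Rn n)) (_ : MeasurableSet Q) (F : Rn n → ℝ≥0∞)
      (_ : AEMeasurable F volume) (_ : ∀ x, F x ≠ ∞) (t : ℝ≥0) (_ : 0 < t)
      (_ : ∀ α : ℝ, 0 < α → volume {x | ENNReal.ofReal α < F x} ≤
        t * volume Q / ENNReal.ofReal α),
      ∫⁻ x in Q, F x ^ δ ≤ C * (t : ℝ≥0∞) ^ δ * volume Q := by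
  -- The layer 2^k t < F ≤ 2^(k+1) t contributes at most (2^(k+1) t)^δ |Q| / 2^k, a geometric
  -- sequence of ratio 2^(δ-1), which is less than 1 because δ < 1.
  set q : ℝ≥0∞ := ENNReal.ofReal (2 ^ (δ - 1)) with hq
  have hq1 : q < 1 := by
    rw [hq, ← ENNReal.ofReal_one, ENNReal.ofReal_lt_ofReal_iff one_pos]
    exact Real.rpow_lt_one_of_one_lt_of_neg (by norm_num) (by linarith)
  set S : ℝ≥0∞ := 1 + 2 ^ δ * ∑' k : ℕ, q ^ k with hS
  have hSfin : S ≠ ∞ := by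
    rw [hS, ENNReal.tsum_geometric]
    refine ENNReal.add_ne_top.2 ⟨ENNReal.one_ne_top, ENNReal.mul_ne_top
      (ENNReal.rpow_ne_top_of_nonneg hδ.le ENNReal.ofNat_ne_top) ?_⟩
    exact ENNReal.inv_ne_top.2 (tsub_pos_of_lt hq1).ne'
  refine ⟨S.toNNReal, fun Q hQ F hF hFt t ht hweak => ?_⟩
  rw [ENNReal.coe_toNNReal hSfin]
  have ht' : (0 : ℝ) < t := by exact_mod_cast ht
  set A : ℕ → Set (Rn n) := fun k => {x | ENNReal.ofReal (2 ^ k * t) < F x} with hA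
  have hAm : ∀ k, NullMeasurableSet (A k) volume := fun k =>
    nullMeasurableSet_lt aemeasurable_const hF
  have hpt : ∀ x, F x ^ δ ≤ (t : ℝ≥0∞) ^ δ +
      ∑' k : ℕ, (A k).indicator (fun _ => ENNReal.ofReal (2 ^ (k + 1) * t) ^ δ) x := by
    intro x
    rcases le_or_gt (F x) (ENNReal.ofReal t) with hx | hx
    · refine le_trans ?_ le_self_add
      rw [ENNReal.ofReal_coe_nnreal] at hx
      exact ENNReal.rpow_le_rpow hx hδ.le
    · obtain ⟨k, hk1, hk2⟩ := exists_two_pow_lt_le ht' (hFt x) hx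
      refine le_trans ?_ le_add_self
      refine le_trans ?_ (ENNReal.le_tsum k)
      rw [Set.indicator_of_mem (show x ∈ A k from hk1)]
      exact ENNReal.rpow_le_rpow hk2 hδ.le
  have hterm : ∀ k : ℕ, ENNReal.ofReal (2 ^ (k + 1) * t) ^ δ * (volume (A k)) ≤
      (t : ℝ≥0∞) ^ δ * volume Q * (2 ^ δ * q ^ k) := by
    intro k
    have hpos : (0 : ℝ) < 2 ^ k * t := by positivity
    have e1 : ENNReal.ofReal (2 ^ (k + 1) * t) ^ δ / ENNReal.ofReal (2 ^ k * t) * t =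
        (t : ℝ≥0∞) ^ δ * (2 ^ δ * q ^ k) := by
      rw [← ENNReal.ofReal_coe_nnreal (p := t), ← ENNReal.ofReal_ofNat 2, hq,
        ENNReal.ofReal_rpow_of_pos (by positivity), ← ENNReal.ofReal_div_of_pos hpos,
        ← ENNReal.ofReal_mul (by positivity), ENNReal.ofReal_rpow_of_pos ht',
        ENNReal.ofReal_rpow_of_pos two_pos, ← ENNReal.ofReal_pow (by positivity),
        ← ENNReal.ofReal_mul (by positivity), ← ENNReal.ofReal_mul (by positivity)]
      congr 1
      have e2 : ((2 : ℝ) ^ (δ - 1)) ^ k = ((2 : ℝ) ^ δ) ^ k / 2 ^ k := by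
        rw [Real.rpow_sub_one two_ne_zero, div_pow]
      rw [e2, Real.mul_rpow (by positivity) ht'.le, pow_succ,
        Real.mul_rpow (by positivity) zero_le_two, ← Real.rpow_natCast 2 k,
        ← Real.rpow_mul zero_le_two, mul_comm (k : ℝ) δ, Real.rpow_mul zero_le_two,
        Real.rpow_natCast]
      field_simp
    calc ENNReal.ofReal (2 ^ (k + 1) * t) ^ δ * volume (A k)
        ≤ ENNReal.ofReal (2 ^ (k + 1) * t) ^ δ * (t * volume Q / ENNReal.ofReal (2 ^ k * t)) := by
          gcongr
          exact hweak _ hpos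
      _ = ENNReal.ofReal (2 ^ (k + 1) * t) ^ δ / ENNReal.ofReal (2 ^ k * t) * t * volume Q := by
          simp only [div_eq_mul_inv]; ring
      _ = _ := by rw [e1]; ring
  calc ∫⁻ x in Q, F x ^ δ
      ≤ ∫⁻ x in Q, ((t : ℝ≥0∞) ^ δ +
          ∑' k : ℕ, (A k).indicator (fun _ => ENNReal.ofReal (2 ^ (k + 1) * t) ^ δ) x) :=
        lintegral_mono hpt
    _ = (t : ℝ≥0∞) ^ δ * volume Q + ∑' k : ℕ, ∫⁻ x in Q,
          (A k).indicator (fun _ => ENNReal.ofReal (2 ^ (k + 1) * t) ^ δ) x := by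
        rw [lintegral_add_left measurable_const, setLIntegral_const, lintegral_tsum]
        exact fun k => (aemeasurable_const.indicator₀ (hAm k)).restrict
    _ ≤ (t : ℝ≥0∞) ^ δ * volume Q +
          ∑' k : ℕ, (t : ℝ≥0∞) ^ δ * volume Q * (2 ^ δ * q ^ k) := by
        gcongr with k
        refine (setLIntegral_le_lintegral _ _).trans ?_
        rw [lintegral_indicator₀ (hAm k), setLIntegral_const]
        exact hterm k
    _ = S * (t : ℝ≥0∞) ^ δ * volume Q := by
        rw [ENNReal.tsum_mul_left, ENNReal.tsum_mul_left, hS]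
        ring

/-! ### Oscillation of powers -/

theorem enorm_rpow_norm_sub_le {δ : ℝ} (hδ : 0 < δ) (hδ1 : δ ≤ 1) (u v : ℂ) :
    ‖‖u‖ ^ δ - ‖v‖ ^ δ‖ₑ ≤ ‖u - v‖ₑ ^ δ := by
  have key : ∀ u v : ℂ, ‖u‖ ^ δ - ‖v‖ ^ δ ≤ ‖u - v‖ ^ δ := by
    intro u v
    have h1 : ‖u‖ ≤ ‖u - v‖ + ‖v‖ := by
      calc ‖u‖ = ‖(u - v) + v‖ := by rw [sub_add_cancel]
        _ ≤ _ := norm_add_le _ _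
    have h2 := (Real.rpow_le_rpow (norm_nonneg _) h1 hδ.le).trans
      (Real.rpow_add_le_add_rpow (norm_nonneg _) (norm_nonneg _) hδ.le hδ1)
    linarith
  rw [← ofReal_norm (u - v), ENNReal.ofReal_rpow_of_nonneg (norm_nonneg _) hδ.le,
    Real.enorm_eq_ofReal_abs]
  refine ENNReal.ofReal_le_ofReal (abs_le.2 ⟨?_, key u v⟩)
  have := key v u
  rw [norm_sub_rev] at this
  linarith

/-- The average may be replaced by any constant at the cost of a factor 2. If the right side is
finite then h is integrable on Q, and the average is a genuine one. -/
theorem lintegral_sub_average_le {n : ℕ} {h : Rn n → ℝ} (hm : AEStronglyMeasurable h volume)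
    {Q : Set (Rn n)} (hQ : volume Q ≠ 0) (hQ' : volume Q ≠ ∞) (a : ℝ) :
    ∫⁻ y in Q, ‖h y - ⨍ z in Q, h z‖ₑ ≤ 2 * ∫⁻ y in Q, ‖h y - a‖ₑ := by
  by_cases hfin : ∫⁻ y in Q, ‖h y - a‖ₑ = ∞
  · rw [hfin]; simp
  have hconst : IntegrableOn (fun _ : Rn n => a) Q := integrableOn_const hQ'
  have hint : IntegrableOn h Q := by
    have h1 : IntegrableOn (fun y => h y - a) Q :=
      ⟨(hm.sub aestronglyMeasurable_const).restrict, lt_top_iff_ne_top.2 hfin⟩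
    have h2 := h1.add hconst
    have e : ((fun y => h y - a) + fun _ => a) = h := by ext; simp
    rwa [e] at h2
  have hav := enorm_setAverage_sub_le hint hQ hQ' a
  calc ∫⁻ y in Q, ‖h y - ⨍ z in Q, h z‖ₑ
      ≤ ∫⁻ y in Q, (‖h y - a‖ₑ + ‖(⨍ z in Q, h z) - a‖ₑ) := by
        refine lintegral_mono fun y => ?_
        calc ‖h y - ⨍ z in Q, h z‖ₑ = ‖(h y - a) - ((⨍ z in Q, h z) - a)‖ₑ := by
              rw [sub_sub_sub_cancel_right]
          _ ≤ _ := enorm_sub_le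
    _ = (∫⁻ y in Q, ‖h y - a‖ₑ) + ‖(⨍ z in Q, h z) - a‖ₑ * volume Q := by
        rw [lintegral_add_right _ measurable_const, setLIntegral_const]
    _ ≤ (∫⁻ y in Q, ‖h y - a‖ₑ) +
          ((volume Q)⁻¹ * ∫⁻ y in Q, ‖h y - a‖ₑ) * volume Q := by gcongr
    _ = _ := by
        rw [mul_comm _ (volume Q), ← mul_assoc, ENNReal.mul_inv_cancel hQ hQ', one_mul, two_mul]

theorem rpow_sum_le_sum_rpow {ι : Type*} (s : Finset ι) (f : ι → ℝ≥0∞) {δ : ℝ} (hδ : 0 < δ)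
    (hδ1 : δ ≤ 1) : (∑ i ∈ s, f i) ^ δ ≤ ∑ i ∈ s, f i ^ δ := by
  classical
  induction s using Finset.induction_on with
  | empty => simp [hδ]
  | insert j s hj ih =>
    rw [Finset.sum_insert hj, Finset.sum_insert hj]
    exact (ENNReal.rpow_add_le_add_rpow _ _ hδ.le hδ1).trans (by gcongr)

/-! ### Estimates in terms of the exact seminorms -/

/-- Passes from strict upper bounds to the seminorms themselves. A nonzero seminorm is doubled; if
one vanishes, its factor is zero almost everywhere and so is the integral. -/
theorem exists_lintegral_prod_osc_le {m : ℕ} (r : Fin m → ℝ) (hr : ∀ i, 1 ≤ r i) {p : ℝ}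
    (hp : 0 < p) (n : ℕ) :
    ∃ C : ℝ≥0, ∀ (S : Finset (Fin m)) (b : Fin m → Rn n → ℂ)
      (_ : ∀ i, MemOsc (r i) (b i)) (c : Rn n) (l : ℝ) (_ : 0 < l),
      ∫⁻ x in cube c l, (∏ i ∈ S, ‖b i x - ⨍ y in cube c l, b i y‖ₑ) ^ p ≤
        C * symbolNorm r b S ^ p * volume (cube c l) := by
  obtain ⟨C, hC⟩ := exists_lintegral_osc_le r hr hp.le n
  refine ⟨C * (2 ^ m) ^ p, fun S b hb c l hl => ?_⟩
  by_cases h0 : ∃ i ∈ S, oscNorm (r i) (b i) = 0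
  · obtain ⟨i, hi, hi0⟩ := h0
    have hz : ∫⁻ x in cube c l, (∏ i ∈ S, ‖b i x - ⨍ y in cube c l, b i y‖ₑ) ^ p = 0 := by
      rw [← lintegral_zero (μ := volume.restrict (cube c l))]
      refine lintegral_congr_ae ?_
      filter_upwards [ae_eq_average_of_oscNorm_eq_zero (hr i) (hb i).1 hi0 c hl] with x hx
      rw [Finset.prod_eq_zero hi, ENNReal.zero_rpow_of_pos hp]
      rw [hx, sub_self, enorm_zero]
    rw [hz]
    exact zero_le
  · push Not at h0
    set N : Fin m → ℝ≥0 := fun i => 2 * (oscNorm (r i) (b i)).toNNReal with hN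
    have hNe : ∀ i, (N i : ℝ≥0∞) = 2 * oscNorm (r i) (b i) := fun i => by
      rw [hN]
      push_cast
      rw [ENNReal.coe_toNNReal (hb i).2.ne]
    have hlt : ∀ i ∈ S, oscNorm (r i) (b i) < N i := fun i hi => by
      rw [hNe, two_mul]
      exact ENNReal.lt_add_right (hb i).2.ne (h0 i hi)
    have h1 := hC S b N (fun i => (hb i).1) hlt c l hl
    simp_rw [ENNReal.prod_rpow_of_nonneg hp.le] at h1
    refine h1.trans ?_
    push_cast
    rw [mul_assoc (C : ℝ≥0∞) _ (symbolNorm r b S ^ p)]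
    gcongr
    rw [ENNReal.coe_rpow_of_nonneg _ hp.le, ← ENNReal.mul_rpow_of_nonneg _ _ hp.le]
    refine ENNReal.rpow_le_rpow ?_ hp.le
    simp_rw [hNe]
    rw [Finset.prod_mul_distrib, Finset.prod_const, symbolNorm]
    gcongr
    push_cast
    exact pow_le_pow_right₀ (by norm_num) ((Finset.card_le_univ S).trans_eq (Fintype.card_fin m))

theorem lintegral_rpow_le_maximalPow {n : ℕ} {ε : ℝ} (hε : 0 < ε) (f : Rn n → ℂ) {x c : Rn n}
    {l : ℝ} (hl : 0 < l) (hx : x ∈ cube c l) :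
    ∫⁻ y in cube c l, ‖f y‖ₑ ^ ε ≤ volume (cube c l) * maximalPow ε f x ^ ε := by
  rw [maximalPow, ← ENNReal.rpow_mul, one_div_mul_cancel hε.ne', ENNReal.rpow_one]
  calc ∫⁻ y in cube c l, ‖f y‖ₑ ^ ε
      = volume (cube c l) * ((volume (cube c l))⁻¹ * ∫⁻ y in cube c l, ‖f y‖ₑ ^ ε) := by
        rw [← mul_assoc, ENNReal.mul_inv_cancel (volume_cube_pos c hl).ne'
          (volume_cube_ne_top c hl), one_mul]
    _ ≤ _ := by
        gcongr
        exact le_iSup₂ (f := fun Q (_ : Q ∈ {Q ∈ cubes n | x ∈ Q}) =>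
          (volume Q)⁻¹ * ∫⁻ y in Q, ‖f y‖ₑ ^ ε) (cube c l) ⟨cube_mem_cubes c hl, hx⟩

/-- The terms with commutators of lower order. -/
theorem exists_lintegral_lower_order_le {m : ℕ} (r : Fin m → ℝ) (hr : ∀ i, 1 ≤ r i) (n : ℕ)
    {δ ε : ℝ} (hδ : 0 < δ) (hδε : δ < ε) {κ : ℝ} (hκ : 1 ≤ κ) :
    ∃ C : ℝ≥0, ∀ (S : Finset (Fin m)) (b : Fin m → Rn n → ℂ) (_ : ∀ i, MemOsc (r i) (b i))
      (F : Rn n → ℂ) (_ : AEStronglyMeasurable F volume) (x c : Rn n) (l : ℝ) (_ : 0 < l)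
      (_ : x ∈ cube c l),
      ∫⁻ y in cube c l,
        ((∏ i ∈ S, ‖b i y - ⨍ z in cube c (κ * l), b i z‖ₑ) * ‖F y‖ₑ) ^ δ ≤
        C * (symbolNorm r b S * maximalPow ε F x) ^ δ * volume (cube c l) := by
  have hε : 0 < ε := hδ.trans hδε
  -- With this exponent the power of F becomes |F|^ε, and the conjugate exponent falls on the
  -- oscillations, for which every power is admissible.
  set p := ε / δ with hp
  have hp1 : 1 < p := (one_lt_div hδ).2 hδε
  have hpq := Real.HolderConjugate.conjExponent hp1
  set q := Real.conjExponent p with hq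
  have hq0 : 0 < q := hpq.symm.pos
  have hp0 : 0 < p := hpq.pos
  have hsum : 1 / q + 1 / p = 1 := by
    rw [one_div, one_div, add_comm]; exact hpq.inv_add_inv_eq_one
  have hδp : δ * p = ε := by rw [hp]; field_simp
  obtain ⟨C, hC⟩ := exists_lintegral_prod_osc_le r hr (mul_pos hδ hq0) n
  have hκ0 : 0 < κ := by linarith
  refine ⟨(C * Real.toNNReal (κ ^ n)) ^ (1 / q), fun S b hb F hF x c l hl hx => ?_⟩
  set v := volume (cube c l) with hv
  have hv0 : v ≠ 0 := (volume_cube_pos c hl).ne'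
  have hvt : v ≠ ∞ := volume_cube_ne_top c hl
  set W : Rn n → ℝ≥0∞ := fun y => ∏ i ∈ S, ‖b i y - ⨍ z in cube c (κ * l), b i z‖ₑ with hW
  have hWm : AEMeasurable W volume := by
    refine Finset.aemeasurable_fun_prod _ fun i _ => ?_
    exact ((hb i).1.aestronglyMeasurable.sub aestronglyMeasurable_const).enorm
  have h1 : ∫⁻ y in cube c l, (W y ^ δ) ^ q ≤
      (C * Real.toNNReal (κ ^ n) : ℝ≥0) * symbolNorm r b S ^ (δ * q) * v := by
    calc ∫⁻ y in cube c l, (W y ^ δ) ^ q = ∫⁻ y in cube c l, W y ^ (δ * q) := by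
          simp_rw [← ENNReal.rpow_mul]
      -- The averages belong to the dilated cube, so the integral is extended to it; the price is
      -- the volume factor κ^n.
      _ ≤ ∫⁻ y in cube c (κ * l), W y ^ (δ * q) :=
          lintegral_mono_set (cube_mono c (by nlinarith))
      _ ≤ C * symbolNorm r b S ^ (δ * q) * volume (cube c (κ * l)) :=
          hC S b hb c (κ * l) (by positivity)
      _ = _ := by
          rw [volume_cube_mul c c hl hκ0]
          push_cast
          rw [ENNReal.ofReal]
          ring
  have h2 : ∫⁻ y in cube c l, (‖F y‖ₑ ^ δ) ^ p ≤ v * maximalPow ε F x ^ ε := by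
    simp_rw [← ENNReal.rpow_mul, hδp]
    exact lintegral_rpow_le_maximalPow hε F hl hx
  calc ∫⁻ y in cube c l, (W y * ‖F y‖ₑ) ^ δ
      = ∫⁻ y in cube c l, ((fun y => W y ^ δ) * fun y => ‖F y‖ₑ ^ δ) y := by
        refine lintegral_congr fun y => ?_
        rw [ENNReal.mul_rpow_of_nonneg _ _ hδ.le, Pi.mul_apply]
    _ ≤ (∫⁻ y in cube c l, (W y ^ δ) ^ q) ^ (1 / q) *
          (∫⁻ y in cube c l, (‖F y‖ₑ ^ δ) ^ p) ^ (1 / p) :=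
        ENNReal.lintegral_mul_le_Lp_mul_Lq _ hpq.symm (hWm.pow_const _).restrict
          (hF.enorm.pow_const _).restrict
    _ ≤ ((C * Real.toNNReal (κ ^ n) : ℝ≥0) * symbolNorm r b S ^ (δ * q) * v) ^ (1 / q) *
          (v * maximalPow ε F x ^ ε) ^ (1 / p) := by gcongr
    _ = ((C * Real.toNNReal (κ ^ n)) ^ (1 / q) : ℝ≥0) *
          (symbolNorm r b S * maximalPow ε F x) ^ δ * (v ^ (1 / q) * v ^ (1 / p)) := by
        rw [ENNReal.mul_rpow_of_nonneg _ _ (by positivity),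
          ENNReal.mul_rpow_of_nonneg _ _ (by positivity),
          ENNReal.mul_rpow_of_nonneg _ _ (by positivity), ENNReal.mul_rpow_of_nonneg _ _ hδ.le,
          ← ENNReal.rpow_mul, ← ENNReal.rpow_mul, ENNReal.coe_rpow_of_nonneg _ (by positivity)]
        have e1 : δ * q * (1 / q) = δ := by field_simp
        have e2 : ε * (1 / p) = δ := by rw [← hδp]; field_simp
        rw [e1, e2]
        ring
    _ = _ := by
        rw [← ENNReal.rpow_add _ _ hv0 hvt, hsum, ENNReal.rpow_one]

/-! ### The term of top order -/

/-- Hölder's inequality with a constant in the place of the kernel: if φ(a) ≤ 1, the modular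
condition for the constant a holds on every cube. -/
theorem exists_lintegral_cube_mul_prod_le {m : ℕ} (r : Fin m → ℝ) (hr : ∀ i, 1 ≤ r i) (r₀ : ℝ)
    (hr₀ : 1 / r₀ = ∑ i, 1 / r i) (η φ : ℝ≥0 → ℝ≥0∞) (hφ : IsYoung φ)
    (hηφ : ∃ A : ℝ≥0, ∀ t : ℝ, Real.exp 1 ≤ t →
      genInv (complementary η) (ENNReal.ofReal t) * genInv φ (ENNReal.ofReal t) *
        ENNReal.ofReal (Real.log t ^ (1 / r₀)) ≤ A * ENNReal.ofReal t) (n : ℕ) :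
    ∃ C : ℝ≥0, C ≠ 0 ∧ ∀ (b : Fin m → Rn n → ℂ) (N : Fin m → ℝ≥0)
      (_ : ∀ i, LocallyIntegrable (b i) volume) (_ : ∀ i, oscNorm (r i) (b i) < N i)
      (f : Rn n → ℂ) (_ : AEStronglyMeasurable f volume) (lam : ℝ≥0)
      (c : Rn n) (L : ℝ) (_ : 0 < L) (k : ℕ)
      (_ : luxemburg (complementary η) (cube c (2 ^ k * L)) f < lam),
      ∫⁻ y in cube c (2 ^ k * L), ‖f y‖ₑ * ∏ i, ‖b i y - ⨍ x in cube c L, b i x‖ₑ ≤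
        C * ((k + 1 : ℕ) : ℝ≥0∞) ^ m * (lam * ∏ i, (N i : ℝ≥0∞)) *
          volume (cube c (2 ^ k * L)) := by
  obtain ⟨C, hC0, hC⟩ := exists_lintegral_mul_prod_le r hr r₀ hr₀ η φ hφ hηφ n
  obtain ⟨a, ha, hφa⟩ := hφ.exists_le_one
  refine ⟨a⁻¹ * C, mul_ne_zero (inv_ne_zero ha.ne') hC0, ?_⟩
  intro b N hb hN f hf lam c L hL k hlam
  have h := hC b N hb hN f hf lam c L hL k hlam _ le_rfl (fun _ => a) measurable_const (by
    rw [setLIntegral_const]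
    exact mul_le_of_le_one_left' hφa)
  rw [lintegral_const_mul' _ _ ENNReal.coe_ne_top] at h
  calc ∫⁻ y in cube c (2 ^ k * L), ‖f y‖ₑ * ∏ i, ‖b i y - ⨍ x in cube c L, b i x‖ₑ
      = (a⁻¹ : ℝ≥0) * (a * ∫⁻ y in cube c (2 ^ k * L),
          ‖f y‖ₑ * ∏ i, ‖b i y - ⨍ x in cube c L, b i x‖ₑ) := by
        rw [← mul_assoc, ← ENNReal.coe_mul, inv_mul_cancel₀ ha.ne', ENNReal.coe_one, one_mul]
    _ ≤ (a⁻¹ : ℝ≥0) * (C * ((k + 1 : ℕ) : ℝ≥0∞) ^ m * (lam * ∏ i, (N i : ℝ≥0∞)) *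
          volume (cube c (2 ^ k * L))) := by gcongr
    _ = _ := by rw [ENNReal.coe_mul]; ring

theorem ae_of_forall_ae_restrict_cube {n : ℕ} {p : Rn n → Prop} (c : Rn n) {L : ℝ} (hL : 0 < L)
    (h : ∀ k : ℕ, ∀ᵐ x ∂volume.restrict (cube c (2 ^ k * L)), p x) : ∀ᵐ x, p x := by
  have hall : ∀ᵐ x, ∀ k : ℕ, x ∈ cube c (2 ^ k * L) → p x := by
    rw [ae_all_iff]
    exact fun k => (ae_restrict_iff' (measurableSet_cube _ _)).1 (h k)
  filter_upwards [hall] with x hx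
  obtain ⟨k, hk⟩ := pow_unbounded_of_one_lt (‖x - c‖ / L) (one_lt_two (α := ℝ))
  rw [div_lt_iff₀ hL] at hk
  refine hx k fun i => ?_
  have := abs_coord_le_norm (x - c) i
  simp only [PiLp.sub_apply] at this
  linarith

/-- The symbol is constant almost everywhere on each cube of an increasing exhaustion, and the
constants agree by nesting. -/
theorem ae_eq_average_of_oscNorm_eq_zero_global {n : ℕ} {r : ℝ} (hr : 1 ≤ r) {b : Rn n → ℂ}
    (hb : LocallyIntegrable b volume) (h0 : oscNorm r b = 0) (c : Rn n) {L : ℝ} (hL : 0 < L) :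
    ∀ᵐ x, b x = ⨍ y in cube c L, b y := by
  refine ae_of_forall_ae_restrict_cube c hL fun k => ?_
  have hL' : 0 < 2 ^ k * L := by positivity
  have hsub : cube c L ⊆ cube c (2 ^ k * L) :=
    cube_mono c (le_mul_of_one_le_left hL.le (one_le_pow₀ (by norm_num)))
  have h1 := ae_eq_average_of_oscNorm_eq_zero hr hb h0 c hL'
  have h2 : ⨍ y in cube c L, b y = ⨍ y in cube c (2 ^ k * L), b y := by
    rw [average_congr (ae_restrict_of_ae_restrict_of_subset hsub h1)]
    exact setAverage_const (volume_cube_pos c hL).ne' (volume_cube_ne_top c hL) _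
  filter_upwards [h1] with x hx
  rw [hx, h2]

theorem luxemburg_le_maximalYoung {n : ℕ} (φ : ℝ≥0 → ℝ≥0∞) (f : Rn n → ℂ) {x c : Rn n} {l : ℝ}
    (hl : 0 < l) (hx : x ∈ cube c l) : luxemburg φ (cube c l) f ≤ maximalYoung φ f x :=
  le_iSup₂ (f := fun Q (_ : Q ∈ {Q ∈ cubes n | x ∈ Q}) => luxemburg φ Q f) (cube c l)
    ⟨cube_mem_cubes c hl, hx⟩

/-- The near part is bounded by weak type and Kolmogorov's inequality, the far part by its near
constancy on the cube. One z serves the far part; the near part needs none. -/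
theorem exists_lintegral_top_order_le {n : ℕ} (hn : 1 ≤ n) {m : ℕ}
    (r : Fin m → ℝ) (hr : ∀ i, 1 ≤ r i) (r₀ : ℝ) (hr₀ : 1 / r₀ = ∑ i, 1 / r i)
    (η φ : ℝ≥0 → ℝ≥0∞) (hφ : IsYoung φ)
    (hηφ : ∃ A : ℝ≥0, ∀ t : ℝ, Real.exp 1 ≤ t →
      genInv (complementary η) (ENNReal.ofReal t) * genInv φ (ENNReal.ofReal t) *
        ENNReal.ofReal (Real.log t ^ (1 / r₀)) ≤ A * ENNReal.ofReal t)
    (T : L2Op n) (K : Rn n → ℂ) (hTK : HasKernel T K) (hKm : Measurable K) (hK : MemH φ m K)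
    {δ : ℝ} (hδ : 0 < δ) (hδ1 : δ < 1) :
    ∃ (κ : ℝ) (C : ℝ≥0), 1 ≤ κ ∧ ∀ (b : Fin m → Rn n → ℂ) (_ : ∀ i, MemOsc (r i) (b i))
      (f : Rn n → ℂ) (_ : InDomain b f) (x c : Rn n) (l : ℝ) (_ : 0 < l) (_ : x ∈ cube c l),
      ∃ z : ℂ,
        (∫⁻ y in cube c l, ‖applyFun T ((cube c (κ * l)).indicator
          fun y => (∏ i, (b i y - ⨍ w in cube c (κ * l), b i w)) * f y) y‖ₑ ^ δ) +
        (∫⁻ y in cube c l, ‖applyFun T ((cube c (κ * l))ᶜ.indicator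
          fun y => (∏ i, (b i y - ⨍ w in cube c (κ * l), b i w)) * f y) y - z‖ₑ ^ δ) ≤
        C * (symbolNorm r b Finset.univ * maximalYoung (complementary η) f x) ^ δ *
          volume (cube c l) := by
  obtain ⟨ρ, C₃, hρ, hC₃⟩ := exists_lintegral_compl_cube_le r hr r₀ hr₀ η φ hφ hηφ hKm hK
  obtain ⟨C₁, hC₁0, hC₁⟩ := exists_lintegral_cube_mul_prod_le r hr r₀ hr₀ η φ hφ hηφ n
  obtain ⟨cH, B, hcH, hB⟩ := hK.exists_lintegral_le hφ hKm
  obtain ⟨C₂, hC₂⟩ := hTK.exists_weak_type hn hKm hcH hB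
  obtain ⟨C₄, hC₄⟩ := exists_lintegral_rpow_le_of_weak hδ hδ1 n
  set κ : ℝ := 2 * ρ + 1 with hκdef
  have hκ1 : 1 < κ := by linarith
  have hκ0 : 0 < κ := by linarith
  -- Kolmogorov's inequality is applied at a positive level; C₂ + 1 in place of C₂ ensures this.
  set τ : ℝ≥0 := (C₂ + 1) * C₁ * Real.toNNReal (κ ^ n) with hτ
  have hτ0 : τ ≠ 0 := by
    have : 0 < κ ^ n := by positivity
    have h2 : Real.toNNReal (κ ^ n) ≠ 0 := (Real.toNNReal_pos.2 this).ne'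
    positivity
  -- The power 2^(m+1) arises from doubling the m seminorms and the maximal function to obtain
  -- strict bounds. The summand 1 keeps the constant nonzero, so the bound is infinite when M = ∞.
  refine ⟨κ, (C₄ * τ ^ δ + C₃ ^ δ) * (2 ^ (m + 1)) ^ δ + 1, hκ1.le, ?_⟩
  intro b hb f hf x c l hl hx
  set L := κ * l with hL
  have hL0 : 0 < L := by positivity
  have hlL : l < L := by rw [hL]; nlinarith
  set Q := cube c l with hQ
  set A := cube c L with hA
  have hAm : MeasurableSet A := measurableSet_cube _ _
  set M := maximalYoung (complementary η) f x with hM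
  set a : Fin m → ℂ := fun i => ⨍ w in A, b i w with ha
  set g : Rn n → ℂ := fun y => (∏ i, (b i y - a i)) * f y with hg
  have hgL : MemLp g 2 volume := memLp_prod_sub_mul b a Finset.univ f fun σ _ => hf σ
  have hfm : AEStronglyMeasurable f volume := by
    simpa using (hf ∅).aestronglyMeasurable
  have hge : ∀ y, ‖g y‖ₑ = ‖f y‖ₑ * ∏ i, ‖b i y - a i‖ₑ := by
    intro y
    rw [hg, enorm_mul, mul_comm]
    simp only [enorm_eq_nnnorm, nnnorm_prod]
    push_cast
    rfl
  -- The degenerate cases, where a seminorm or M vanishes, are those with g = 0 almost everywhere;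
  -- the left side is then 0 with z = 0.
  have hgzero : g =ᵐ[volume] 0 → (∫⁻ y in Q, ‖applyFun T (A.indicator g) y‖ₑ ^ δ) +
      (∫⁻ y in Q, ‖applyFun T (Aᶜ.indicator g) y - 0‖ₑ ^ δ) = 0 := by
    intro h0
    have h1 : ∀ E : Set (Rn n), applyFun T (E.indicator g) = applyFun T (fun _ => 0) := by
      intro E
      refine applyFun_congr T ?_
      filter_upwards [h0] with y hy
      by_cases hyE : y ∈ E
      · rw [Set.indicator_of_mem hyE, hy, Pi.zero_apply]
      · rw [Set.indicator_of_notMem hyE]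
    have h2 : ∫⁻ y in Q, ‖applyFun T (fun _ => 0) y‖ₑ ^ δ = 0 := by
      rw [← lintegral_zero (μ := volume.restrict Q)]
      refine lintegral_congr_ae (ae_restrict_of_ae ?_)
      filter_upwards [applyFun_zero T] with y hy
      rw [hy, Pi.zero_apply, enorm_zero, ENNReal.zero_rpow_of_pos hδ]
    simp only [sub_zero, h1, h2, add_zero]
  have hv0 : volume Q ≠ 0 := (volume_cube_pos c hl).ne'
  by_cases hosc : ∃ i, oscNorm (r i) (b i) = 0
  · obtain ⟨i, hi⟩ := hosc
    refine ⟨0, le_of_eq_of_le (hgzero ?_) zero_le⟩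
    filter_upwards [ae_eq_average_of_oscNorm_eq_zero_global (hr i) (hb i).1 hi c hL0] with y hy
    rw [hg, Pi.zero_apply]
    simp only
    rw [Finset.prod_eq_zero (Finset.mem_univ i), zero_mul]
    rw [hy, sub_self]
  push Not at hosc
  have hsym0 : symbolNorm r b Finset.univ ≠ 0 := Finset.prod_ne_zero_iff.2 fun i _ => hosc i
  by_cases hMtop : M = ∞
  · refine ⟨0, le_of_le_of_eq le_top ?_⟩
    rw [hMtop, ENNReal.mul_top hsym0, ENNReal.top_rpow_of_pos hδ, ENNReal.mul_top,
      ENNReal.top_mul hv0]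
    simp
  have hlux : ∀ k : ℕ, luxemburg (complementary η) (cube c (2 ^ k * L)) f ≤ M := fun k =>
    luxemburg_le_maximalYoung _ f (by positivity) (cube_mono c (by
      have : (1 : ℝ) ≤ 2 ^ k := one_le_pow₀ (by norm_num)
      nlinarith) hx)
  set N : Fin m → ℝ≥0 := fun i => 2 * (oscNorm (r i) (b i)).toNNReal with hN
  have hNe : ∀ i, (N i : ℝ≥0∞) = 2 * oscNorm (r i) (b i) := fun i => by
    rw [hN]
    push_cast
    rw [ENNReal.coe_toNNReal (hb i).2.ne]
  have hNlt : ∀ i, oscNorm (r i) (b i) < N i := fun i => by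
    rw [hNe, two_mul]
    exact ENNReal.lt_add_right (hb i).2.ne (hosc i)
  by_cases hM0 : M = 0
  · refine ⟨0, le_of_eq_of_le (hgzero ?_) zero_le⟩
    refine ae_of_forall_ae_restrict_cube c hL0 fun k => ?_
    -- When M = 0 every lam > 0 is admissible on every dilate, so letting lam tend to 0 forces g to
    -- vanish almost everywhere.
    have hX : ∀ lam : ℝ≥0, 0 < lam → ∫⁻ y in cube c (2 ^ k * L), ‖g y‖ₑ ≤
        lam * (C₁ * ((k + 1 : ℕ) : ℝ≥0∞) ^ m * (∏ i, (N i : ℝ≥0∞)) *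
          volume (cube c (2 ^ k * L))) := by
      intro lam hlam
      simp_rw [hge]
      refine (hC₁ b N (fun i => (hb i).1) hNlt f hfm lam c L hL0 k
        ((hlux k).trans_lt (by rw [hM0]; exact_mod_cast hlam))).trans_eq ?_
      ring
    have hne : C₁ * ((k + 1 : ℕ) : ℝ≥0∞) ^ m * (∏ i, (N i : ℝ≥0∞)) *
        volume (cube c (2 ^ k * L)) ≠ ∞ := by
      have h1 : ∏ i, (N i : ℝ≥0∞) ≠ ∞ := ENNReal.prod_ne_top fun i _ => ENNReal.coe_ne_top
      exact ENNReal.mul_ne_top (ENNReal.mul_ne_top (by finiteness) h1)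
        (volume_cube_ne_top c (by positivity))
    have hz : ∫⁻ y in cube c (2 ^ k * L), ‖g y‖ₑ = 0 := by
      refine le_antisymm (le_of_forall_gt fun s hs => ?_) zero_le
      obtain ⟨lam, hlam, hlt⟩ := ENNReal.exists_nnreal_pos_mul_lt hne hs.ne'
      exact (hX lam hlam).trans_lt hlt
    rw [lintegral_eq_zero_iff' hgL.aestronglyMeasurable.enorm.restrict] at hz
    filter_upwards [hz] with y hy
    simpa using hy
  set lam : ℝ≥0 := 2 * M.toNNReal with hlam
  have hlame : (lam : ℝ≥0∞) = 2 * M := by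
    rw [hlam]
    push_cast
    rw [ENNReal.coe_toNNReal hMtop]
  have hMlt : M < lam := by
    rw [hlame, two_mul]
    exact ENNReal.lt_add_right hMtop hM0
  set Y : ℝ≥0 := lam * ∏ i, N i with hY
  have hYe : (Y : ℝ≥0∞) = 2 ^ (m + 1) * (symbolNorm r b Finset.univ * M) := by
    rw [hY]
    push_cast
    simp_rw [hNe]
    rw [Finset.prod_mul_distrib, hlame, symbolNorm, Finset.prod_const, Finset.card_univ,
      Fintype.card_fin]
    ring
  have hY0 : Y ≠ 0 := by
    intro h
    rw [h] at hYe
    have h1 : (2 : ℝ≥0∞) ^ (m + 1) * (symbolNorm r b Finset.univ * M) ≠ 0 :=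
      mul_ne_zero (pow_ne_zero _ two_ne_zero) (mul_ne_zero hsym0 hM0)
    exact h1 (by rw [← hYe]; simp)
  have hYprod : (Y : ℝ≥0∞) = lam * ∏ i, (N i : ℝ≥0∞) := by rw [hY]; push_cast; rfl
  have hnear : ∫⁻ y, ‖A.indicator g y‖ₑ ≤
      (C₁ * Real.toNNReal (κ ^ n) : ℝ≥0) * Y * volume Q := by
    have h1 := hC₁ b N (fun i => (hb i).1) hNlt f hfm lam c L hL0 0 ((hlux 0).trans_lt hMlt)
    simp only [pow_zero, one_mul, zero_add, Nat.cast_one, one_pow, mul_one, ← hYprod] at h1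
    calc ∫⁻ y, ‖A.indicator g y‖ₑ = ∫⁻ y in A, ‖g y‖ₑ := by
          rw [← lintegral_indicator hAm]
          refine lintegral_congr fun y => ?_
          by_cases hy : y ∈ A <;> simp [hy]
      _ ≤ C₁ * Y * volume A := by
          simp_rw [hge]
          exact h1
      _ = _ := by
          rw [hA, hL, volume_cube_mul c c hl hκ0, ENNReal.ofReal]
          push_cast
          ring
  have hnearInt : Integrable (A.indicator g) volume :=
    ⟨(hgL.indicator hAm).aestronglyMeasurable,
      hnear.trans_lt (ENNReal.mul_lt_top (by finiteness)
        (lt_top_iff_ne_top.2 (volume_cube_ne_top c hl)))⟩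
  have hII : ∫⁻ y in Q, ‖applyFun T (A.indicator g) y‖ₑ ^ δ ≤
      C₄ * ((τ * Y : ℝ≥0) : ℝ≥0∞) ^ δ * volume Q := by
    refine hC₄ Q (measurableSet_cube _ _) _ (aestronglyMeasurable_applyFun T _).enorm
      (fun _ => enorm_ne_top) (τ * Y) (by positivity) fun α hα => ?_
    refine (hC₂ _ hnearInt (hgL.indicator hAm) α hα).trans (ENNReal.div_le_div_right ?_ _)
    calc C₂ * ∫⁻ y, ‖A.indicator g y‖ₑ
        ≤ (C₂ + 1 : ℝ≥0) * ((C₁ * Real.toNNReal (κ ^ n) : ℝ≥0) * Y * volume Q) := by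
          gcongr
          exact le_self_add
      _ = _ := by rw [hτ]; push_cast; ring
  obtain ⟨z, hz⟩ := hTK.exists_ae_enorm_sub_le (hgL.indicator hAm.compl) hlL
    (fun y hy => Set.indicator_of_notMem (not_not.2 hy) g) (B := C₃ * Y) (fun z hzQ w hwQ => by
      have h1 := hC₃ b N (fun i => (hb i).1) hNlt f hfm lam c l hl
        (fun k => (hlux k).trans_lt hMlt) z w hzQ hwQ
      rw [← hYprod] at h1
      refine le_of_eq_of_le ?_ h1
      rw [← lintegral_indicator hAm.compl]
      refine lintegral_congr fun y => ?_
      by_cases hy : y ∈ Aᶜ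
      · rw [Set.indicator_of_mem hy, Set.indicator_of_mem hy, hge]
      · rw [Set.indicator_of_notMem hy, Set.indicator_of_notMem hy, enorm_zero, mul_zero])
  refine ⟨z, ?_⟩
  have hIII : ∫⁻ y in Q, ‖applyFun T (Aᶜ.indicator g) y - z‖ₑ ^ δ ≤
      (C₃ * Y : ℝ≥0∞) ^ δ * volume Q := by
    rw [← setLIntegral_const]
    refine lintegral_mono_ae ?_
    filter_upwards [hz] with y hy
    exact ENNReal.rpow_le_rpow hy hδ.le
  refine (add_le_add hII hIII).trans ?_
  rw [← add_mul]
  gcongr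
  rw [ENNReal.coe_mul, ENNReal.mul_rpow_of_nonneg _ _ hδ.le, ENNReal.mul_rpow_of_nonneg _ _ hδ.le,
    hYe, ENNReal.mul_rpow_of_nonneg _ _ hδ.le]
  push_cast
  rw [ENNReal.coe_rpow_of_nonneg _ hδ.le, ENNReal.coe_rpow_of_nonneg _ hδ.le,
    ENNReal.coe_rpow_of_nonneg _ hδ.le, add_mul _ 1]
  push_cast
  refine le_trans (le_of_eq ?_) le_self_add
  ring

/-! ### The sharp function estimate for a Borel kernel -/

theorem exists_sharpPow_multiComm_le {n : ℕ} (hn : 1 ≤ n) {m : ℕ}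
    (r : Fin m → ℝ) (hr : ∀ i, 1 ≤ r i) (r₀ : ℝ) (hr₀ : 1 / r₀ = ∑ i, 1 / r i)
    (η φ : ℝ≥0 → ℝ≥0∞) (hφ : IsYoung φ)
    (hηφ : ∃ A : ℝ≥0, ∀ t : ℝ, Real.exp 1 ≤ t →
      genInv (complementary η) (ENNReal.ofReal t) * genInv φ (ENNReal.ofReal t) *
        ENNReal.ofReal (Real.log t ^ (1 / r₀)) ≤ A * ENNReal.ofReal t)
    (T : L2Op n) (K : Rn n → ℂ) (hTK : HasKernel T K) (hKm : Measurable K) (hK : MemH φ m K)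
    {δ ε : ℝ} (hδ : 0 < δ) (hδε : δ < ε) (hε : ε < 1) :
    ∃ C : ℝ≥0, ∀ b : Fin m → Rn n → ℂ, (∀ i, MemOsc (r i) (b i)) →
      ∀ f : Rn n → ℂ, InDomain b f → ∀ x : Rn n,
        sharpPow δ (multiComm T (List.ofFn b) f) x ≤
          C * (symbolNorm r b Finset.univ * maximalYoung (complementary η) f x +
          ∑ σ ∈ Finset.univ.filter (fun σ : Finset (Fin m) => σ.card < m),
            symbolNorm r b σᶜ * maximalPow ε (multiComm T (subSymbol b σ) f) x) := by
  have hδ1 : δ < 1 := hδε.trans hε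
  obtain ⟨κ, C₁, hκ, hC₁⟩ :=
    exists_lintegral_top_order_le hn r hr r₀ hr₀ η φ hφ hηφ T K hTK hKm hK hδ hδ1
  obtain ⟨C₂, hC₂⟩ := exists_lintegral_lower_order_le r hr n hδ hδε hκ
  -- The 2 comes from replacing the average by a constant, and 2^m bounds the number of lower order
  -- terms.
  set D : ℝ≥0 := 2 * (C₁ + 2 ^ m * C₂) with hD
  refine ⟨D ^ (1 / δ), fun b hb f hf x => ?_⟩
  set F := multiComm T (List.ofFn b) f with hF
  set J := Finset.univ.filter (fun σ : Finset (Fin m) => σ.card < m) with hJ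
  set top := symbolNorm r b Finset.univ * maximalYoung (complementary η) f x with htop
  set low : Finset (Fin m) → ℝ≥0∞ := fun σ =>
    symbolNorm r b σᶜ * maximalPow ε (multiComm T (subSymbol b σ) f) x with hlow
  set X := top + ∑ σ ∈ J, low σ with hX
  have hbm : ∀ i, AEStronglyMeasurable (b i) volume := fun i => (hb i).1.aestronglyMeasurable
  have hcomm : ∀ σ, AEStronglyMeasurable (multiComm T (subSymbol b σ) f) volume := fun σ =>
    aestronglyMeasurable_multiComm T _ (fun β hβ => by
      simp only [subSymbol, List.mem_map] at hβ
      obtain ⟨i, -, rfl⟩ := hβ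
      exact hbm i) f
  have hFm : AEStronglyMeasurable F volume := by
    rw [hF, ← subSymbol_univ]
    exact hcomm _
  have hhm : AEStronglyMeasurable (fun y => ‖F y‖ ^ δ) volume :=
    (hFm.norm.aemeasurable.pow_const δ).aestronglyMeasurable
  suffices hQ : ∀ Q ∈ {Q ∈ cubes n | x ∈ Q},
      (volume Q)⁻¹ * ∫⁻ y in Q, ‖‖F y‖ ^ δ - ⨍ z in Q, ‖F z‖ ^ δ‖ₑ ≤ D * X ^ δ by
    rw [sharpPow, sharp]
    calc (⨆ Q ∈ {Q ∈ cubes n | x ∈ Q}, (volume Q)⁻¹ *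
          ∫⁻ y in Q, ‖‖F y‖ ^ δ - ⨍ z in Q, ‖F z‖ ^ δ‖ₑ) ^ (1 / δ)
        ≤ (D * X ^ δ) ^ (1 / δ) := ENNReal.rpow_le_rpow (iSup₂_le hQ) (by positivity)
      _ = _ := by
        rw [ENNReal.mul_rpow_of_nonneg _ _ (by positivity), ← ENNReal.rpow_mul,
          mul_one_div_cancel hδ.ne', ENNReal.rpow_one,
          ENNReal.coe_rpow_of_nonneg _ (by positivity)]
  rintro Q ⟨⟨c, l, hl, rfl⟩, hx⟩
  have hv0 : volume (cube c l) ≠ 0 := (volume_cube_pos c hl).ne'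
  have hvt : volume (cube c l) ≠ ∞ := volume_cube_ne_top c hl
  obtain ⟨z, hz⟩ := hC₁ b hb f hf x c l hl hx
  set a : Fin m → ℂ := fun i => ⨍ w in cube c (κ * l), b i w with ha
  set A := cube c (κ * l) with hA
  set u : Rn n → ℝ≥0∞ := fun y =>
    ‖applyFun T (A.indicator fun y => (∏ i, (b i y - a i)) * f y) y‖ₑ with hu
  set v : Rn n → ℝ≥0∞ := fun y =>
    ‖applyFun T (Aᶜ.indicator fun y => (∏ i, (b i y - a i)) * f y) y - z‖ₑ with hv
  set w : Finset (Fin m) → Rn n → ℝ≥0∞ := fun σ y =>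
    (∏ i ∈ σᶜ, ‖b i y - a i‖ₑ) * ‖multiComm T (subSymbol b σ) f y‖ₑ with hw
  have hum : AEMeasurable (fun y => u y ^ δ) volume :=
    (aestronglyMeasurable_applyFun T _).enorm.pow_const _
  have hvm : AEMeasurable (fun y => v y ^ δ) volume :=
    ((aestronglyMeasurable_applyFun T _).sub aestronglyMeasurable_const).enorm.pow_const _
  have hwm : ∀ σ, AEMeasurable (fun y => w σ y ^ δ) volume := fun σ => by
    refine AEMeasurable.pow_const (AEMeasurable.mul ?_ (hcomm σ).enorm) _
    exact Finset.aemeasurable_fun_prod _ fun i _ =>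
      ((hbm i).sub aestronglyMeasurable_const).enorm
  have hcard : (J.card : ℝ≥0∞) ≤ 2 ^ m := by
    have h1 : J.card ≤ 2 ^ m := by
      calc J.card ≤ (Finset.univ : Finset (Finset (Fin m))).card := Finset.card_filter_le _ _
        _ = 2 ^ m := by simp
    exact_mod_cast h1
  -- The comparison constant is |(-1)^m z|^δ. Subadditivity of the power δ ≤ 1 separates the near
  -- part, the far part and the lower order terms.
  have hmain : ∫⁻ y in cube c l, ‖‖F y‖ ^ δ - ‖(-1) ^ m * z‖ ^ δ‖ₑ ≤
      (C₁ + 2 ^ m * C₂) * X ^ δ * volume (cube c l) := by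
    calc ∫⁻ y in cube c l, ‖‖F y‖ ^ δ - ‖(-1) ^ m * z‖ ^ δ‖ₑ
        ≤ ∫⁻ y in cube c l, (u y ^ δ + v y ^ δ + ∑ σ ∈ J, w σ y ^ δ) := by
          refine lintegral_mono_ae (ae_restrict_of_ae ?_)
          filter_upwards [enorm_multiComm_sub_le T b a f hf A (measurableSet_cube _ _) z] with y hy
          refine (enorm_rpow_norm_sub_le hδ hδ1.le _ _).trans
            ((ENNReal.rpow_le_rpow hy hδ.le).trans ?_)
          refine (ENNReal.rpow_add_le_add_rpow _ _ hδ.le hδ1.le).trans (add_le_add ?_ ?_)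
          · exact ENNReal.rpow_add_le_add_rpow _ _ hδ.le hδ1.le
          · exact rpow_sum_le_sum_rpow _ _ hδ hδ1.le
      _ = ((∫⁻ y in cube c l, u y ^ δ) + ∫⁻ y in cube c l, v y ^ δ) +
            ∑ σ ∈ J, ∫⁻ y in cube c l, w σ y ^ δ := by
          rw [lintegral_add_right' _ (Finset.aemeasurable_fun_sum _ fun σ _ => (hwm σ).restrict),
            lintegral_add_left' hum.restrict, lintegral_finsetSum' _ fun σ _ => (hwm σ).restrict]
      _ ≤ C₁ * X ^ δ * volume (cube c l) + ∑ _σ ∈ J, C₂ * X ^ δ * volume (cube c l) := by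
          refine add_le_add (hz.trans ?_) (Finset.sum_le_sum fun σ hσ => ?_)
          · gcongr
            exact le_self_add
          · refine (hC₂ σᶜ b hb _ (hcomm σ) x c l hl hx).trans ?_
            gcongr
            exact (Finset.single_le_sum (f := low) (fun _ _ => zero_le) hσ).trans le_add_self
      _ ≤ C₁ * X ^ δ * volume (cube c l) + 2 ^ m * (C₂ * X ^ δ * volume (cube c l)) := by
          rw [Finset.sum_const, nsmul_eq_mul]
          gcongr
      _ = _ := by ring
  calc (volume (cube c l))⁻¹ * ∫⁻ y in cube c l, ‖‖F y‖ ^ δ - ⨍ z in cube c l, ‖F z‖ ^ δ‖ₑ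
      ≤ (volume (cube c l))⁻¹ * (2 * ((C₁ + 2 ^ m * C₂) * X ^ δ * volume (cube c l))) := by
        gcongr
        exact (lintegral_sub_average_le hhm hv0 hvt _).trans (by gcongr)
    _ = ((volume (cube c l))⁻¹ * volume (cube c l)) * (2 * (C₁ + 2 ^ m * C₂) * X ^ δ) := by ring
    _ = D * X ^ δ := by
        rw [ENNReal.inv_mul_cancel hv0 hvt, one_mul, hD]
        push_cast
        rfl

end HormanderCommutator

end

/-! ### Conclusion for an almost everywhere measurable kernel -/

open HormanderCommutator
theorem mainTheorem5 {n : ℕ} (hn : 1 ≤ n) {m : ℕ} (hm : 1 ≤ m)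
    (r : Fin m → ℝ) (hr : ∀ i, 1 ≤ r i) (r₀ : ℝ) (hr₀ : 1 / r₀ = ∑ i, 1 / r i)
    (η φ : ℝ≥0 → ℝ≥0∞) (hη : IsYoung η) (hφ : IsYoung φ)
    (hηφ : ∃ A : ℝ≥0, ∀ t : ℝ, Real.exp 1 ≤ t →
      genInv (complementary η) (ENNReal.ofReal t) * genInv φ (ENNReal.ofReal t) *
        ENNReal.ofReal (Real.log t ^ (1 / r₀)) ≤ A * ENNReal.ofReal t)
    (T : L2Op n) (K : Rn n → ℂ) (hTK : HasKernel T K) (hK : MemH φ m K)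
    (δ ε : ℝ) (hδ : 0 < δ) (hδε : δ < ε) (hε : ε < 1) :
    ∃ C : ℝ≥0, ∀ b : Fin m → Rn n → ℂ, (∀ i, MemOsc (r i) (b i)) →
      ∀ f : Rn n → ℂ, InDomain b f → ∀ x : Rn n,
        sharpPow δ (multiComm T (List.ofFn b) f) x ≤
          C * symbolNorm r b Finset.univ * maximalYoung (complementary η) f x +
          C * ∑ σ ∈ Finset.univ.filter (fun σ : Finset (Fin m) => σ.card < m),
            symbolNorm r b σᶜ * maximalPow ε (multiComm T (subSymbol b σ) f) x := by
  -- K is replaced by a Borel function equal to it almost everywhere; neither the representation of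
  -- T nor the Hörmander condition is affected.
  have hae := hTK.measurable.ae_eq_mk
  obtain ⟨C, hC⟩ := exists_sharpPow_multiComm_le hn r hr r₀ hr₀ η φ hφ hηφ T _ (hTK.congr hae)
    hTK.measurable.stronglyMeasurable_mk.measurable (hK.congr hae) hδ hδε hε
  refine ⟨C, fun b hb f hf x => (hC b hb f hf x).trans_eq ?_⟩
  rw [mul_add, mul_assoc]
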